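/- Let $K\in\mathbb R$, $N>1$, $D>0$ and $p\in(1,\infty)$. Put $D_{K,N}=\pi/\sqrt{K/(N-1)}$ if $K>0$ and $D_{K,N}=+\infty$ otherwise. **Densities.** For $t\in[0,1]$ and $\theta\ge0$ let $\sigma^{(t)}(\theta)=\infty$ if $K\theta^2\ge(N-1)\pi^2$, $\sigma^{(t)}(\theta)=\frac{\sin(t\theta\sqrt{K/(N-1)})}{\sin(\theta\sqrt{K/(N-1)})}$ if $0<K\theta^2<(N-1)\pi^2$, $\sigma^{(t)}(\theta)=t$ if $K\theta^2=0$, and $\sigma^{(t)}(\theta)=\frac{\sinh(t\theta\sqrt{-K/(N-1)})}{\sinh(\theta\sqrt{-K/(N-1)})}$ if $K\theta^2<0$. Let $\mathcal F_{K,N,D}$ be the set of non-negative integrable Borel functions $h$ with $\operatorname{supp}h=[0,\min(D,D_{K,N})]$ and $$h(tx_1+(1-t)x_0)\ \ge\ \sigma^{(1-t)}(|x_1-x_0|)^{N-1}\,h(x_0)\qquad\text{for all }x_0,x_1\in\operatorname{supp}h,\ t\in[0,1]$$ (with $\infty\cdot0=0$). **Spectral gaps.** For $h\in\mathcal F_{K,N,D}$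 let $$\lambda^{p,h}=\inf\left\{\frac{\int|u'|^ph\,dx}{\int|u|^ph\,dx}:\ u\in \mathrm{Lip}\cap L^p(h\,dx),\ \int u|u|^{p-2}h\,dx=0,\ u\ne0\text{ in }L^p(h\,dx)\right\},$$ and let $$\lambda^p_{K,N,D}=\inf\Big\{\lambda^{p,h}:\ h\in\bigcup_{0<D'\le D}\mathcal F_{K,N,D'}\Big\}.$$ **Model problem.** Let $\pi_p=\int_{-1}^1(1-|t|^p)^{-1/p}\,dt$. Let $\sin_p:\mathbb R\to[-1,1]$ be the $2\pi_p$-periodic $C^1$ function with $t=\int_0^{\sin_p t}(1-|s|^p)^{-1/p}\,ds$ for $t\in[-\frac{\pi_p}2,\frac{\pi_p}2]$ and $\sin_p t=\sin_p(\pi_p-t)$ for $t\in[\frac{\pi_p}2,\frac{3\pi_p}2]$, and let $\cos_p=\sin_p'$. Let $c(x)=\sqrt{K(N-1)}\cot\big(\sqrt{K/(N-1)}\,x\big)$ if $K>0$, $c(x)=(N-1)/x$ if $K=0$, and $c(x)=\sqrt{-K(N-1)}\coth\big(\sqrt{-K/(N-1)}\,x\big)$ if $K<0$. For $0<D'<\infty$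 with $D'\le D_{K,N}$ let $T_{D'}(x)=c(x)$ for $x\in[\frac{D'}2,D')$ and $T_{D'}(x)=-c(D'-x)$ for $x\in(0,\frac{D'}2)$. Let $\hat\lambda^p_{K,N,D'}$ be the minimal $\lambda\ge0$ for which there is a continuous $\varphi:[0,D']\to\mathbb R$ with $$\varphi'=\Big(\frac{\lambda}{p-1}\Big)^{1/p}+\frac1{p-1}\,T_{D'}\,|\cos_p\varphi|^{p-2}\cos_p\varphi\,\sin_p\varphi\quad\text{on }(0,D'),$$ $$\varphi(0)=-\frac{\pi_p}2,\qquad\varphi\Big(\frac{D'}2\Big)=0,\qquad\varphi(D')=\frac{\pi_p}2 .$$ **Claim.** For every $D'\in(0,\min(D,D_{K,N})]$ the minimum defining $\hat\lambda^p_{K,N,D'}$ exists, and $$\lambda^p_{K,N,D}=\begin{cases}\hat\lambda^p_{K,N,D}&\text{if }K\le0,\\[2pt]\displaystyle\inf_{D'\in(0,\min(D,D_{K,N})]}\hat\lambda^p_{K,N,D'}&\text{if }K>0.\end{cases}$$ -/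

import Mathlib

open MeasureTheory

noncomputable section

namespace MCPGap

/-! ### One-dimensional `MCP(K, N)` densities -/

/-- The distortion coefficient `σ^{(t)}_{K, N-1}(θ)`, i.e. the one with curvature `K / (N - 1)`,
with values in `[0, ∞]`. -/
def sigma (K N t θ : ℝ) : ENNReal :=
  if (N - 1) * Real.pi ^ 2 ≤ K * θ ^ 2 then ⊤
  else if 0 < K * θ ^ 2 then
    ENNReal.ofReal
      (Real.sin (t * θ * Real.sqrt (K / (N - 1))) / Real.sin (θ * Real.sqrt (K / (N - 1))))
  else if K * θ ^ 2 = 0 then ENNReal.ofReal t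
  else
    ENNReal.ofReal
      (Real.sinh (t * θ * Real.sqrt (-K / (N - 1))) / Real.sinh (θ * Real.sqrt (-K / (N - 1))))

/-- The Bonnet--Myers diameter bound `D_{K,N}`. -/
def bonnetMyers (K N : ℝ) : EReal :=
  if 0 < K then ((Real.pi / Real.sqrt (K / (N - 1)) : ℝ) : EReal) else ⊤

/-- `h` is an `MCP(K, N)` density: a non-negative integrable Borel function with
`h (t x₁ + (1 - t) x₀) ≥ σ^{(1-t)}_{K, N-1}(|x₁ - x₀|)^{N-1} h (x₀)` for `x₀, x₁ ∈ supp h`.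
The inequality is read in `[0, ∞]` with `∞ * 0 = 0`. -/
structure IsMCPDensity (K N : ℝ) (h : ℝ → ℝ) : Prop where
  measurable : Measurable h
  nonneg : ∀ x, 0 ≤ h x
  integrable : Integrable h
  contraction : ∀ x₀ ∈ tsupport h, ∀ x₁ ∈ tsupport h, ∀ t ∈ Set.Icc (0 : ℝ) 1,
    sigma K N (1 - t) |x₁ - x₀| ^ (N - 1) * ENNReal.ofReal (h x₀)
      ≤ ENNReal.ofReal (h (t * x₁ + (1 - t) * x₀))

/-- The class `𝓕_{K,N,D}` of `MCP(K, N)` densities with support `[0, min (D, D_{K,N})]`. -/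
def densities (K N D : ℝ) : Set (ℝ → ℝ) :=
  {h | IsMCPDensity K N h ∧
    tsupport h = {x : ℝ | 0 ≤ x ∧ (x : EReal) ≤ min (D : EReal) (bonnetMyers K N)}}

/-! ### Spectral gaps -/

/-- Admissible functions for the `p`-spectral gap of `h`: Lipschitz, in `L^p (h dx)`, not zero in
`L^p (h dx)`, and with `∫ u |u|^{p-2} h dx = 0`. (A Lipschitz function on the interval `supp h` is
the same as the restriction of a Lipschitz function on `ℝ`.) -/
structure IsAdmissible (p : ℝ) (h u : ℝ → ℝ) : Prop where
  lipschitz : ∃ C : NNReal, LipschitzWith C u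
  integrable : Integrable (fun x => |u x| ^ p * h x)
  ne_zero : 0 < ∫ x, |u x| ^ p * h x
  mean_zero : ∫ x, u x * |u x| ^ (p - 2) * h x = 0

/-- The `p`-spectral gap `λ^{p,h}`. -/
def spectralGap (p : ℝ) (h : ℝ → ℝ) : ℝ :=
  sInf {r | ∃ u : ℝ → ℝ, IsAdmissible p h u ∧
    r = (∫ x, |deriv u x| ^ p * h x) / ∫ x, |u x| ^ p * h x}

/-- The optimal constant `λ^p_{K,N,D}`, the infimum of `λ^{p,h}` over all `h ∈ 𝓕_{K,N,D'}`,
`0 < D' ≤ D`. -/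
def optimalConstant (p K N D : ℝ) : ℝ :=
  sInf {r | ∃ D' : ℝ, 0 < D' ∧ D' ≤ D ∧ ∃ h ∈ densities K N D', r = spectralGap p h}

/-! ### Generalized trigonometric functions -/

/-- `π_p = ∫_{-1}^1 (1 - |t|^p)^{-1/p} dt`. -/
def piP (p : ℝ) : ℝ := ∫ t in (-1 : ℝ)..1, 1 / (1 - |t| ^ p) ^ (1 / p)

/-- The inverse `s ↦ ∫_0^s (1 - |r|^p)^{-1/p} dr` of `sin_p`, for `s ∈ [-1, 1]`. -/
def arcsinP (p s : ℝ) : ℝ := ∫ r in (0 : ℝ)..s, 1 / (1 - |r| ^ p) ^ (1 / p)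

/-- `sin_p` on `[-π_p/2, π_p/2]`: the `s ∈ [-1, 1]` with `arcsinP p s = t`. -/
def sinPBase (p : ℝ) : ℝ → ℝ := Function.invFunOn (arcsinP p) (Set.Icc (-1) 1)

/-- The representative of `t` modulo `2 π_p` in `[-π_p/2, 3π_p/2)`. -/
def reduceP (p t : ℝ) : ℝ :=
  -(piP p / 2) + 2 * piP p * Int.fract ((t + piP p / 2) / (2 * piP p))

/-- The `2 π_p`-periodic function `sin_p`, with `sin_p t = sin_p (π_p - t)` on
`[π_p/2, 3π_p/2]`. -/
def sinP (p t : ℝ) : ℝ :=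
  if reduceP p t ≤ piP p / 2 then sinPBase p (reduceP p t)
  else sinPBase p (piP p - reduceP p t)

/-- `cos_p = (sin_p)'`. -/
def cosP (p : ℝ) : ℝ → ℝ := deriv (sinP p)

/-! ### The model problem -/

/-- The function `cot_{K,N,D}` (which does not depend on `D`), the logarithmic derivative of
`s_{K/(N-1)}^{N-1}`. -/
def cotKN (K N x : ℝ) : ℝ :=
  if 0 < K then
    Real.sqrt (K * (N - 1)) *
      (Real.cos (Real.sqrt (K / (N - 1)) * x) / Real.sin (Real.sqrt (K / (N - 1)) * x))
  else if K = 0 then (N - 1) / x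
  else
    Real.sqrt (-K * (N - 1)) *
      (Real.cosh (Real.sqrt (-K / (N - 1)) * x) / Real.sinh (Real.sqrt (-K / (N - 1)) * x))

/-- The function `T_{K,N,D}`, the logarithmic derivative of the model density `h_{K,N,D}`. -/
def modelT (K N D x : ℝ) : ℝ :=
  if D / 2 ≤ x then cotKN K N x else -cotKN K N (D - x)

/-- `φ` solves the model problem with parameter `lam`: it is continuous on `[0, D]`, satisfies
`φ' = (lam/(p-1))^{1/p} + T_{K,N,D} cos_p^{p-1}(φ) sin_p(φ) / (p-1)` on `(0, D)`, and
`φ(0) = -π_p/2`, `φ(D/2) = 0`, `φ(D) = π_p/2`. The power `cos_p^{p-1}` is the signed power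
`|cos_p|^{p-2} cos_p`. The equation is not imposed at the end points, where `T_{K,N,D}` is
singular if `D = D_{K,N}`; at `x = D/2` the value of `T_{K,N,D}` is irrelevant, as
`sin_p(0) = 0`. -/
structure IsModelSolution (p K N D lam : ℝ) (φ : ℝ → ℝ) : Prop where
  continuousOn : ContinuousOn φ (Set.Icc 0 D)
  hasDerivAt : ∀ x ∈ Set.Ioo 0 D, HasDerivAt φ
    ((lam / (p - 1)) ^ (1 / p) + 1 / (p - 1) * modelT K N D x *
      (|cosP p (φ x)| ^ (p - 2) * cosP p (φ x)) * sinP p (φ x)) x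
  left : φ 0 = -(piP p / 2)
  mid : φ (D / 2) = 0
  right : φ D = piP p / 2

/-- The parameters `lam ≥ 0` for which the model problem has a solution. -/
def modelParameters (p K N D : ℝ) : Set ℝ :=
  {lam | 0 ≤ lam ∧ ∃ φ : ℝ → ℝ, IsModelSolution p K N D lam φ}

/-- The model constant: the smallest parameter for which the model problem has a solution. -/
def modelConstant (p K N D : ℝ) : ℝ := sInf (modelParameters p K N D)

end MCPGap

end

/-! The contraction property is used only with `x₁` an end point of the support. With `s` the
generalized sine `sn`, it then says that `h x / s(x)^(N-1)` and `h (D - x) / s(x)^(N-1)` are both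
non-increasing (`isComparable_of_mem_densities`). The extremal density is `s(max(x, D - x))^(N-1)`;
it lies in the class by the addition formula for `s` (`sn_mul_max_le`).

The equation for `φ` is the phase equation of a Prüfer transform. With `u = r sin_p φ`, `u' = α r
cos_p φ` and `lam = (p-1) α^p`, it says that `u` is a `p`-Laplace eigenfunction on `[D/2, D]` for
the weight `m = s^(N-1)`, with `u = 0` at `D/2` and `u'/u = 0` at `D`. A solution exists by shooting
in `α`. If `D = D_{K,N}`, where the coefficient tends to `-∞` at `D`, the right `α` is the largest
speed whose trajectory stays below `π_p/2`.

Every such `lam` is a lower bound for the gap of every comparable density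
(`IsComparable.le_spectralGap`). Vanishing `p`-mean means that the norm of a test function is
minimal among its translates by constants, so subtracting its value at `D/2` does not increase the
Rayleigh quotient. For a function `v` vanishing at `D/2`, Picone's inequality gives `lam ∫ |v|^p m ≤
∫ |v'|^p m` on every interval `[D/2, y]`. As `h = (h/m) m` with `h/m` non-increasing, a layer-cake
argument carries this over from `m` to `h`. The left half follows by reflection.

Conversely, the odd extension of `u` is a test function for the model density with quotient at most
`lam` (`spectralGap_modelDensity_le`). Hence there is exactly one parameter, the gap of the model
density, and the model density is extremal for its length. For `K ≤ 0` stretching an interval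
preserves comparability and lowers the gap, so the longest interval is optimal; for `K > 0` the
infimum over lengths remains. -/

noncomputable section

namespace MCPGap

/-! ### Generalized sine -/

/-- The integrand defining `arcsinP`. -/
def arcsinPDeriv (p r : ℝ) : ℝ := 1 / (1 - |r| ^ p) ^ (1 / p)

theorem arcsinP_eq (p s : ℝ) : arcsinP p s = ∫ r in (0 : ℝ)..s, arcsinPDeriv p r := rfl

theorem one_sub_abs_rpow_pos {p r : ℝ} (hp : 1 < p) (hr : r ∈ Set.Ioo (-1 : ℝ) 1) :
    0 < 1 - |r| ^ p := by
  have : |r| < 1 := abs_lt.2 ⟨hr.1, hr.2⟩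
  have := Real.rpow_lt_one (abs_nonneg r) this (by linarith : 0 < p)
  linarith

theorem arcsinPDeriv_pos {p r : ℝ} (hp : 1 < p) (hr : r ∈ Set.Ioo (-1 : ℝ) 1) :
    0 < arcsinPDeriv p r := by
  have := one_sub_abs_rpow_pos hp hr
  unfold arcsinPDeriv
  positivity

theorem arcsinPDeriv_neg (p r : ℝ) : arcsinPDeriv p (-r) = arcsinPDeriv p r := by
  simp [arcsinPDeriv]

theorem measurable_arcsinPDeriv (p : ℝ) : Measurable (arcsinPDeriv p) := by
  unfold arcsinPDeriv
  fun_prop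

/-- As `r ^ p ≤ r` on `[0, 1]`, the integrand is dominated by `(1 - r) ^ (-1/p)`, which is
integrable because `1/p < 1`. -/
theorem intervalIntegrable_arcsinPDeriv_zero_one {p : ℝ} (hp : 1 < p) :
    IntervalIntegrable (arcsinPDeriv p) volume 0 1 := by
  have hp0 : 0 < p := by linarith
  have h1 : IntervalIntegrable (fun x : ℝ => (1 - x) ^ (-(1 / p))) volume 0 1 := by
    have h := (intervalIntegral.intervalIntegrable_rpow' (a := 0) (b := 1) (r := -(1 / p))
      (by
        have : 1 / p < 1 := by rw [div_lt_one hp0]; exact hp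
        linarith)).comp_sub_left 1
    simpa using h.symm
  refine h1.mono_fun (measurable_arcsinPDeriv p).aestronglyMeasurable ?_
  refine (ae_restrict_mem measurableSet_uIoc).mono fun r hr => ?_
  rw [Set.uIoc_of_le zero_le_one] at hr
  -- At the singularity `r = 1` the integrand has the default value `1 / 0 = 0`.
  rcases eq_or_lt_of_le hr.2 with h | h
  · subst h
    have : (1 / p) ≠ 0 := by positivity
    simp only [arcsinPDeriv, abs_one, Real.one_rpow, sub_self, Real.zero_rpow this, div_zero,
      norm_zero]
    positivity
  · have hpos : 0 < 1 - r := by linarith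
    have hle : 1 - r ≤ 1 - |r| ^ p := by
      rw [abs_of_pos hr.1]
      have := Real.rpow_le_rpow_of_exponent_ge hr.1 hr.2 hp.le
      rw [Real.rpow_one] at this
      linarith
    have h2 : (1 - r) ^ (1 / p) ≤ (1 - |r| ^ p) ^ (1 / p) :=
      Real.rpow_le_rpow hpos.le hle (by positivity)
    have h3 : 0 < (1 - r) ^ (1 / p) := by positivity
    beta_reduce
    rw [Real.norm_of_nonneg (arcsinPDeriv_pos hp ⟨by linarith [hr.1], h⟩).le,
      Real.norm_of_nonneg (by positivity), Real.rpow_neg hpos.le, ← one_div]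
    exact one_div_le_one_div_of_le h3 h2

theorem intervalIntegrable_arcsinPDeriv {p a b : ℝ} (hp : 1 < p)
    (ha : a ∈ Set.Icc (-1 : ℝ) 1) (hb : b ∈ Set.Icc (-1 : ℝ) 1) :
    IntervalIntegrable (arcsinPDeriv p) volume a b := by
  have h1 := intervalIntegrable_arcsinPDeriv_zero_one hp
  have h2 : IntervalIntegrable (arcsinPDeriv p) volume (-1) 0 := by
    have := (IntervalIntegrable.iff_comp_neg (f := arcsinPDeriv p) (a := 0) (b := 1) (by simp)).1 h1
    simp only [arcsinPDeriv_neg, neg_zero] at this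
    exact this.symm
  exact (h2.trans h1).mono_set (by
    rw [Set.uIcc_of_le (by norm_num : (-1 : ℝ) ≤ 1)]
    exact Set.uIcc_subset_Icc ha hb)

theorem arcsinP_sub {p x y : ℝ} (hp : 1 < p) (hx : x ∈ Set.Icc (-1 : ℝ) 1)
    (hy : y ∈ Set.Icc (-1 : ℝ) 1) :
    arcsinP p y - arcsinP p x = ∫ r in x..y, arcsinPDeriv p r := by
  have h0 : (0 : ℝ) ∈ Set.Icc (-1 : ℝ) 1 := by constructor <;> norm_num
  exact intervalIntegral.integral_interval_sub_left (intervalIntegrable_arcsinPDeriv hp h0 hy)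
    (intervalIntegrable_arcsinPDeriv hp h0 hx)

theorem arcsinP_strictMonoOn {p : ℝ} (hp : 1 < p) :
    StrictMonoOn (arcsinP p) (Set.Icc (-1) 1) := by
  intro x hx y hy hxy
  have : 0 < ∫ r in x..y, arcsinPDeriv p r :=
    intervalIntegral.intervalIntegral_pos_of_pos_on (intervalIntegrable_arcsinPDeriv hp hx hy)
      (fun r hr => arcsinPDeriv_pos hp ⟨hx.1.trans_lt hr.1, hr.2.trans_le hy.2⟩) hxy
  rw [← arcsinP_sub hp hx hy] at this
  linarith

theorem arcsinP_continuousOn {p : ℝ} (hp : 1 < p) :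
    ContinuousOn (arcsinP p) (Set.Icc (-1) 1) := by
  have h := intervalIntegral.continuousOn_primitive_interval' (a := 0)
    (intervalIntegrable_arcsinPDeriv hp (a := -1) (b := 1) (by simp) (by simp))
    (by rw [Set.uIcc_of_le (by norm_num : (-1 : ℝ) ≤ 1)]; constructor <;> norm_num)
  rwa [Set.uIcc_of_le (by norm_num : (-1 : ℝ) ≤ 1)] at h

theorem arcsinP_neg (p s : ℝ) : arcsinP p (-s) = -arcsinP p s := by
  have h : (∫ r in (-(-s))..(-0 : ℝ), arcsinPDeriv p r) = ∫ r in (0 : ℝ)..(-s), arcsinPDeriv p r := by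
    rw [← intervalIntegral.integral_comp_neg]
    simp only [arcsinPDeriv_neg]
  rw [arcsinP_eq, arcsinP_eq, ← h, intervalIntegral.integral_symm]
  simp

theorem arcsinP_zero (p : ℝ) : arcsinP p 0 = 0 := by simp [arcsinP]

theorem arcsinP_one {p : ℝ} (hp : 1 < p) : arcsinP p 1 = piP p / 2 := by
  have h := arcsinP_sub hp (x := -1) (y := 1) (by simp) (by simp)
  rw [arcsinP_neg] at h
  have : piP p = ∫ r in (-1 : ℝ)..1, arcsinPDeriv p r := rfl
  linarith

theorem piP_pos {p : ℝ} (hp : 1 < p) : 0 < piP p := by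
  have h := arcsinP_strictMonoOn hp (a := 0) (b := 1) (by simp) (by simp) one_pos
  rw [arcsinP_zero, arcsinP_one hp] at h
  linarith

theorem arcsinP_hasDerivAt {p s : ℝ} (hp : 1 < p) (hs : s ∈ Set.Ioo (-1 : ℝ) 1) :
    HasDerivAt (arcsinP p) (arcsinPDeriv p s) s := by
  have hcont : ContinuousAt (arcsinPDeriv p) s := by
    have h1 := one_sub_abs_rpow_pos hp hs
    have h2 : (1 - |s| ^ p) ^ (1 / p) ≠ 0 := by positivity
    unfold arcsinPDeriv
    refine continuousAt_const.div ?_ h2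
    refine ContinuousAt.rpow_const ?_ (Or.inl h1.ne')
    exact continuousAt_const.sub ((continuous_abs.continuousAt).rpow_const (Or.inr (by linarith)))
  exact intervalIntegral.integral_hasDerivAt_right
    (intervalIntegrable_arcsinPDeriv hp (by constructor <;> norm_num) (Set.Ioo_subset_Icc_self hs))
    ((measurable_arcsinPDeriv p).stronglyMeasurable.stronglyMeasurableAtFilter) hcont

theorem arcsinP_mapsTo {p : ℝ} (hp : 1 < p) :
    Set.MapsTo (arcsinP p) (Set.Icc (-1) 1) (Set.Icc (-(piP p / 2)) (piP p / 2)) := by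
  intro s hs
  have h := (arcsinP_strictMonoOn hp).monotoneOn
  have h1 := h (by simp) hs hs.1
  have h2 := h hs (by simp) hs.2
  rw [arcsinP_neg, arcsinP_one hp] at h1
  rw [arcsinP_one hp] at h2
  exact ⟨h1, h2⟩

theorem arcsinP_surjOn {p : ℝ} (hp : 1 < p) :
    Set.SurjOn (arcsinP p) (Set.Icc (-1) 1) (Set.Icc (-(piP p / 2)) (piP p / 2)) := by
  have h := intermediate_value_Icc (by norm_num : (-1 : ℝ) ≤ 1) (arcsinP_continuousOn hp)
  rw [arcsinP_neg, arcsinP_one hp] at h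
  exact h

theorem sinPBase_mem {p t : ℝ} (hp : 1 < p) (ht : t ∈ Set.Icc (-(piP p / 2)) (piP p / 2)) :
    sinPBase p t ∈ Set.Icc (-1 : ℝ) 1 :=
  Function.invFunOn_mem (arcsinP_surjOn hp ht)

theorem arcsinP_sinPBase {p t : ℝ} (hp : 1 < p) (ht : t ∈ Set.Icc (-(piP p / 2)) (piP p / 2)) :
    arcsinP p (sinPBase p t) = t :=
  Function.invFunOn_eq (arcsinP_surjOn hp ht)

theorem sinPBase_arcsinP {p s : ℝ} (hp : 1 < p) (hs : s ∈ Set.Icc (-1 : ℝ) 1) :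
    sinPBase p (arcsinP p s) = s :=
  (arcsinP_strictMonoOn hp).injOn (sinPBase_mem hp (arcsinP_mapsTo hp hs)) hs
    (arcsinP_sinPBase hp (arcsinP_mapsTo hp hs))

theorem sinPBase_strictMonoOn {p : ℝ} (hp : 1 < p) :
    StrictMonoOn (sinPBase p) (Set.Icc (-(piP p / 2)) (piP p / 2)) := by
  intro x hx y hy hxy
  by_contra! h
  have := (arcsinP_strictMonoOn hp).monotoneOn (sinPBase_mem hp hy) (sinPBase_mem hp hx) h
  rw [arcsinP_sinPBase hp hx, arcsinP_sinPBase hp hy] at this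
  linarith

/-- A monotone surjection between intervals is continuous. This covers the end points, where
`arcsinP` has no finite derivative. -/
theorem sinPBase_continuousOn {p : ℝ} (hp : 1 < p) :
    ContinuousOn (sinPBase p) (Set.Icc (-(piP p / 2)) (piP p / 2)) := by
  rw [continuousOn_iff_continuous_domRestrict]
  let f : Set.Icc (-(piP p / 2)) (piP p / 2) → Set.Icc (-1 : ℝ) 1 :=
    fun t => ⟨sinPBase p t, sinPBase_mem hp t.2⟩
  have hf : Continuous f := by
    refine Monotone.continuous_of_surjective ?_ ?_
    · intro x y hxy
      exact (sinPBase_strictMonoOn hp).monotoneOn x.2 y.2 hxy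
    · intro s
      exact ⟨⟨arcsinP p s, arcsinP_mapsTo hp s.2⟩, Subtype.ext (sinPBase_arcsinP hp s.2)⟩
  exact continuous_subtype_val.comp hf

theorem reduceP_eq {p t : ℝ} (hp : 1 < p) (ht : t ∈ Set.Ico (-(piP p / 2)) (3 * (piP p / 2))) :
    reduceP p t = t := by
  have hpi := piP_pos hp
  have : Int.fract ((t + piP p / 2) / (2 * piP p)) = (t + piP p / 2) / (2 * piP p) := by
    rw [Int.fract_eq_self]
    constructor
    · apply div_nonneg <;> linarith [ht.1]
    · rw [div_lt_one (by linarith)]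
      linarith [ht.2]
  rw [reduceP, this]
  field_simp
  ring

theorem sinP_eq_base {p t : ℝ} (hp : 1 < p) (ht : t ∈ Set.Icc (-(piP p / 2)) (piP p / 2)) :
    sinP p t = sinPBase p t := by
  have hpi := piP_pos hp
  have := reduceP_eq hp (t := t) ⟨ht.1, by linarith [ht.2]⟩
  rw [sinP, this, if_pos ht.2]

theorem sinP_reflect {p t : ℝ} (hp : 1 < p) (ht : t ∈ Set.Ioo (piP p / 2) (3 * (piP p / 2))) :
    sinP p t = sinP p (piP p - t) := by
  have hpi := piP_pos hp
  have h := reduceP_eq hp (t := t) ⟨by linarith [ht.1], ht.2⟩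
  rw [sinP_eq_base hp (t := piP p - t) ⟨by linarith [ht.2], by linarith [ht.1]⟩, sinP, h,
    if_neg (not_le.2 ht.1)]

theorem sinP_continuousOn {p : ℝ} (hp : 1 < p) :
    ContinuousOn (sinP p) (Set.Icc (-(piP p / 2)) (piP p / 2)) :=
  (sinPBase_continuousOn hp).congr fun _ ht => sinP_eq_base hp ht

theorem sinP_strictMonoOn {p : ℝ} (hp : 1 < p) :
    StrictMonoOn (sinP p) (Set.Icc (-(piP p / 2)) (piP p / 2)) :=
  (sinPBase_strictMonoOn hp).congr fun _ ht => (sinP_eq_base hp ht).symm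

theorem sinP_zero {p : ℝ} (hp : 1 < p) : sinP p 0 = 0 := by
  have hpi := piP_pos hp
  rw [sinP_eq_base hp ⟨by linarith, by linarith⟩]
  have := sinPBase_arcsinP hp (s := 0) (by constructor <;> norm_num)
  rwa [arcsinP_zero] at this

theorem sinP_piP_half {p : ℝ} (hp : 1 < p) : sinP p (piP p / 2) = 1 := by
  have hpi := piP_pos hp
  rw [sinP_eq_base hp ⟨by linarith, le_rfl⟩]
  have := sinPBase_arcsinP hp (s := 1) (by constructor <;> norm_num)
  rwa [arcsinP_one hp] at this

theorem sinP_neg {p t : ℝ} (hp : 1 < p) (ht : t ∈ Set.Icc (-(piP p / 2)) (piP p / 2)) :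
    sinP p (-t) = -sinP p t := by
  have ht' : -t ∈ Set.Icc (-(piP p / 2)) (piP p / 2) := ⟨by linarith [ht.2], by linarith [ht.1]⟩
  rw [sinP_eq_base hp ht, sinP_eq_base hp ht']
  have h := sinPBase_mem hp ht
  have := sinPBase_arcsinP hp (s := -sinPBase p t) ⟨by linarith [h.2], by linarith [h.1]⟩
  rwa [arcsinP_neg, arcsinP_sinPBase hp ht] at this

theorem sinP_mem_Ioo {p t : ℝ} (hp : 1 < p) (ht : t ∈ Set.Ioo (-(piP p / 2)) (piP p / 2)) :
    sinP p t ∈ Set.Ioo (-1 : ℝ) 1 := by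
  have hpi := piP_pos hp
  have h := sinP_strictMonoOn hp
  have h1 := h ⟨le_rfl, by linarith⟩ (Set.Ioo_subset_Icc_self ht) ht.1
  have h2 := h (Set.Ioo_subset_Icc_self ht) ⟨by linarith, le_rfl⟩ ht.2
  rw [sinP_neg hp ⟨by linarith, le_rfl⟩, sinP_piP_half hp] at h1
  rw [sinP_piP_half hp] at h2
  exact ⟨h1, h2⟩

theorem sinP_pos {p t : ℝ} (hp : 1 < p) (ht : t ∈ Set.Ioc 0 (piP p / 2)) : 0 < sinP p t := by
  have hpi := piP_pos hp
  have h := sinP_strictMonoOn hp ⟨by linarith, by linarith⟩ ⟨by linarith [ht.1], ht.2⟩ ht.1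
  rwa [sinP_zero hp] at h

/-- `cos_p` on `[-π_p/2, π_p/2]`. -/
def cosPBase (p t : ℝ) : ℝ := (1 - |sinP p t| ^ p) ^ (1 / p)

theorem sinP_hasDerivAt {p t : ℝ} (hp : 1 < p) (ht : t ∈ Set.Ioo (-(piP p / 2)) (piP p / 2)) :
    HasDerivAt (sinP p) (cosPBase p t) t := by
  have hs := sinP_mem_Ioo hp ht
  have hnhds : Set.Icc (-(piP p / 2)) (piP p / 2) ∈ nhds t := Icc_mem_nhds ht.1 ht.2
  have h := HasDerivAt.of_local_left_inverse
    ((sinP_continuousOn hp).continuousAt hnhds) (arcsinP_hasDerivAt hp hs) (arcsinPDeriv_pos hp hs).ne' (by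
      filter_upwards [hnhds] with x hx
      rw [sinP_eq_base hp hx, arcsinP_sinPBase hp hx])
  simpa [arcsinPDeriv, cosPBase] using h

theorem cosP_eq_base {p t : ℝ} (hp : 1 < p) (ht : t ∈ Set.Ioo (-(piP p / 2)) (piP p / 2)) :
    cosP p t = cosPBase p t := (sinP_hasDerivAt hp ht).deriv

theorem sinP_reflect' {p t : ℝ} (hp : 1 < p)
    (ht : t ∈ Set.Ioo (-(piP p / 2)) (3 * (piP p / 2))) :
    sinP p (piP p - t) = sinP p t := by
  rcases lt_trichotomy t (piP p / 2) with h | h | h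
  · rw [sinP_reflect hp (t := piP p - t) ⟨by linarith, by linarith [ht.1]⟩, sub_sub_cancel]
  · rw [h]; congr 1; ring
  · exact (sinP_reflect hp ⟨h, ht.2⟩).symm

theorem cosP_reflect {p t : ℝ} (hp : 1 < p)
    (ht : t ∈ Set.Ioo (-(piP p / 2)) (3 * (piP p / 2))) :
    cosP p (piP p - t) = -cosP p t := by
  have h : (fun x => sinP p (piP p - x)) =ᶠ[nhds t] sinP p := by
    filter_upwards [Ioo_mem_nhds ht.1 ht.2] with x hx using sinP_reflect' hp hx
  have h2 := h.deriv_eq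
  rw [deriv_comp_const_sub] at h2
  rw [cosP, ← h2, neg_neg]

/-- Oddness of the derivative about `π_p/2` forces the value, so differentiability of `sinP` at that
point is never needed. -/
theorem cosP_piP_half {p : ℝ} (hp : 1 < p) : cosP p (piP p / 2) = 0 := by
  have hpi := piP_pos hp
  have h := cosP_reflect hp (t := piP p / 2) ⟨by linarith, by linarith⟩
  rw [sub_half] at h
  linarith

theorem cosPBase_pos {p t : ℝ} (hp : 1 < p) (ht : t ∈ Set.Ioo (-(piP p / 2)) (piP p / 2)) :
    0 < cosPBase p t := by
  have := one_sub_abs_rpow_pos hp (sinP_mem_Ioo hp ht)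
  unfold cosPBase
  positivity

theorem cosPBase_piP_half {p : ℝ} (hp : 1 < p) : cosPBase p (piP p / 2) = 0 := by
  have : 1 / p ≠ 0 := by positivity
  rw [cosPBase, sinP_piP_half hp, abs_one, Real.one_rpow, sub_self, Real.zero_rpow this]

theorem cosPBase_zero {p : ℝ} (hp : 1 < p) : cosPBase p 0 = 1 := by
  have : p ≠ 0 := by positivity
  simp [cosPBase, sinP_zero hp, Real.zero_rpow this]

theorem abs_sinP_le_one {p t : ℝ} (hp : 1 < p) (ht : t ∈ Set.Icc (-(piP p / 2)) (piP p / 2)) :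
    |sinP p t| ≤ 1 := by
  rw [sinP_eq_base hp ht]
  exact abs_le.2 (sinPBase_mem hp ht)

theorem cosPBase_nonneg {p t : ℝ} (hp : 1 < p)
    (ht : t ∈ Set.Icc (-(piP p / 2)) (piP p / 2)) : 0 ≤ cosPBase p t := by
  have : |sinP p t| ^ p ≤ 1 := Real.rpow_le_one (abs_nonneg _) (abs_sinP_le_one hp ht) (by linarith)
  exact Real.rpow_nonneg (by linarith) _

theorem cosPBase_rpow {p t : ℝ} (hp : 1 < p) (ht : t ∈ Set.Icc (-(piP p / 2)) (piP p / 2)) :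
    cosPBase p t ^ p = 1 - |sinP p t| ^ p := by
  have : |sinP p t| ^ p ≤ 1 := Real.rpow_le_one (abs_nonneg _) (abs_sinP_le_one hp ht) (by linarith)
  rw [cosPBase, ← Real.rpow_mul (by linarith), one_div, inv_mul_cancel₀ (by linarith), Real.rpow_one]

theorem cosPBase_le_one {p t : ℝ} (hp : 1 < p)
    (ht : t ∈ Set.Icc (-(piP p / 2)) (piP p / 2)) : cosPBase p t ≤ 1 := by
  have : |sinP p t| ^ p ≤ 1 := Real.rpow_le_one (abs_nonneg _) (abs_sinP_le_one hp ht) (by linarith)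
  have h2 : 0 ≤ |sinP p t| ^ p := by positivity
  exact Real.rpow_le_one (by linarith) (by linarith) (by positivity)

theorem cosPBase_continuousOn {p : ℝ} (hp : 1 < p) :
    ContinuousOn (cosPBase p) (Set.Icc (-(piP p / 2)) (piP p / 2)) := by
  unfold cosPBase
  refine ContinuousOn.rpow_const ?_ fun _ _ => Or.inr (by positivity)
  exact continuousOn_const.sub ((sinP_continuousOn hp).abs.rpow_const
    fun _ _ => Or.inr (by linarith))

/-- Written as `(1 - |sin_p|^p)^((p-1)/p)`, this power of `cos_p` has an inner derivative whose
factor `cos_p` cancels the outer power exactly. -/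
theorem hasDerivAt_cosPBase_rpow {p t : ℝ} (hp : 1 < p)
    (ht : t ∈ Set.Ioo (-(piP p / 2)) (piP p / 2)) :
    HasDerivAt (fun x => cosPBase p x ^ (p - 1))
      (-((p - 1) * (|sinP p t| ^ (p - 2) * sinP p t))) t := by
  have hp0 : 0 < p := by linarith
  have h1 := one_sub_abs_rpow_pos hp (sinP_mem_Ioo hp ht)
  have h2 : HasDerivAt (fun x => 1 - |sinP p x| ^ p)
      (-(p * |sinP p t| ^ (p - 2) * sinP p t * cosPBase p t)) t :=
    ((hasDerivAt_abs_rpow (sinP p t) hp).comp t (sinP_hasDerivAt hp ht)).const_sub 1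
  have h3 := h2.rpow_const (p := (p - 1) / p) (Or.inl h1.ne')
  have hnhds : Set.Icc (-(piP p / 2)) (piP p / 2) ∈ nhds t := Icc_mem_nhds ht.1 ht.2
  refine (h3.congr_of_eventuallyEq ?_).congr_deriv ?_
  · filter_upwards [hnhds] with x hx
    have : |sinP p x| ^ p ≤ 1 :=
      Real.rpow_le_one (abs_nonneg _) (abs_sinP_le_one hp hx) (by linarith)
    rw [cosPBase, ← Real.rpow_mul (by linarith)]
    congr 1
    field_simp
  · have : (p - 1) / p - 1 = -(1 / p) := by field_simp; ring
    rw [this, Real.rpow_neg h1.le]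
    have h4 := cosPBase_pos hp ht
    unfold cosPBase at *
    field_simp

/-! ### The clamped nonlinearity -/

/-- The function `cos_p^{p-1} sin_p / (p - 1)`, with the argument clamped to `[0, π_p/2]`. -/
def drift (p t : ℝ) : ℝ :=
  cosPBase p (Set.projIcc 0 (max 0 (piP p / 2)) (le_max_left _ _) t) ^ (p - 1) *
    sinP p (Set.projIcc 0 (max 0 (piP p / 2)) (le_max_left _ _) t) / (p - 1)

theorem drift_eq {p t : ℝ} (ht : t ∈ Set.Icc 0 (piP p / 2)) :
    drift p t = cosPBase p t ^ (p - 1) * sinP p t / (p - 1) := by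
  have : t ∈ Set.Icc 0 (max 0 (piP p / 2)) := ⟨ht.1, le_max_of_le_right ht.2⟩
  simp [drift, Set.projIcc_of_mem _ this]

theorem drift_of_nonpos {p t : ℝ} (hp : 1 < p) (ht : t ≤ 0) : drift p t = 0 := by
  simp [drift, Set.projIcc_of_le_left _ ht, sinP_zero hp]

theorem drift_of_ge {p t : ℝ} (hp : 1 < p) (ht : piP p / 2 ≤ t) : drift p t = 0 := by
  have hpi := piP_pos hp
  have h : max 0 (piP p / 2) = piP p / 2 := max_eq_right (by linarith)
  have h2 : max 0 (piP p / 2) ≤ t := by rwa [h]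
  have h3 : p - 1 ≠ 0 := by linarith
  simp [drift, Set.projIcc_of_right_le _ h2, h, cosPBase_piP_half hp, Real.zero_rpow h3]

theorem drift_nonneg {p : ℝ} (hp : 1 < p) (t : ℝ) : 0 ≤ drift p t := by
  have hpi := piP_pos hp
  rcases le_total t 0 with h | h
  · rw [drift_of_nonpos hp h]
  rcases le_total (piP p / 2) t with h' | h'
  · rw [drift_of_ge hp h']
  rw [drift_eq ⟨h, h'⟩]
  have h1 := cosPBase_nonneg hp (t := t) ⟨by linarith, h'⟩
  have h2 : 0 ≤ sinP p t := by
    rcases eq_or_lt_of_le h with h | h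
    · rw [← h, sinP_zero hp]
    · exact (sinP_pos hp ⟨h, h'⟩).le
  have : 0 ≤ p - 1 := by linarith
  positivity

theorem drift_pos {p t : ℝ} (hp : 1 < p) (ht : t ∈ Set.Ioo 0 (piP p / 2)) : 0 < drift p t := by
  rw [drift_eq (Set.Ioo_subset_Icc_self ht)]
  have h1 := cosPBase_pos hp (t := t) ⟨by linarith [ht.1, ht.2], ht.2⟩
  have h2 := sinP_pos hp (t := t) ⟨ht.1, ht.2.le⟩
  have : 0 < p - 1 := by linarith
  positivity

/-- On the open interval the derivative is `(cos_p^p - (p-1) sin_p^p) / (p-1)`, which is bounded for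
every `p > 1`. Continuity extends the bound to the closed interval, and clamping is composition with
a `1`-Lipschitz projection. Clamping thus yields a globally Lipschitz, bounded nonlinearity that
vanishes outside `(0, π_p/2)`, as the shooting argument requires. -/
theorem drift_lipschitz {p : ℝ} (hp : 1 < p) :
    ∃ L : NNReal, LipschitzWith L (drift p) := by
  have hpi := piP_pos hp
  have hp1 : 0 < p - 1 := by linarith
  have hmax : max 0 (piP p / 2) = piP p / 2 := max_eq_right (by linarith)
  have hsub : Set.Icc 0 (piP p / 2) ⊆ Set.Icc (-(piP p / 2)) (piP p / 2) :=
    Set.Icc_subset_Icc_left (by linarith)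
  have key : LipschitzOnWith (p / (p - 1)).toNNReal
      (fun t => cosPBase p t ^ (p - 1) * sinP p t / (p - 1)) (Set.Icc 0 (piP p / 2)) := by
    have hder : ∀ t ∈ Set.Ioo 0 (piP p / 2),
        HasDerivAt (fun t => cosPBase p t ^ (p - 1) * sinP p t / (p - 1))
          ((-((p - 1) * (|sinP p t| ^ (p - 2) * sinP p t)) * sinP p t +
            cosPBase p t ^ (p - 1) * cosPBase p t) / (p - 1)) t := fun t ht =>
      ((hasDerivAt_cosPBase_rpow hp ⟨by linarith [ht.1], ht.2⟩).mul
        (sinP_hasDerivAt hp ⟨by linarith [ht.1], ht.2⟩)).div_const _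
    have hcont : ContinuousOn (fun t => cosPBase p t ^ (p - 1) * sinP p t / (p - 1))
        (Set.Icc 0 (piP p / 2)) :=
      ((((cosPBase_continuousOn hp).mono hsub).rpow_const fun _ _ => Or.inr hp1.le).mul
        ((sinP_continuousOn hp).mono hsub)).div_const _
    have hIoo : LipschitzOnWith (p / (p - 1)).toNNReal
        (fun t => cosPBase p t ^ (p - 1) * sinP p t / (p - 1)) (Set.Ioo 0 (piP p / 2)) := by
      refine (convex_Ioo _ _).lipschitzOnWith_of_nnnorm_hasDerivWithin_le
        (fun t ht => (hder t ht).hasDerivWithinAt) fun t ht => ?_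
      rw [← NNReal.coe_le_coe, coe_nnnorm, Real.coe_toNNReal _ (by positivity)]
      have hm : t ∈ Set.Icc (-(piP p / 2)) (piP p / 2) := ⟨by linarith [ht.1], ht.2.le⟩
      have hs := sinP_pos hp ⟨ht.1, ht.2.le⟩
      have hs1 := abs_sinP_le_one hp hm
      have hc := cosPBase_nonneg hp hm
      have hc1 := cosPBase_le_one hp hm
      rw [abs_of_pos hs] at *
      have e1 : sinP p t ^ (p - 2) * sinP p t * sinP p t = sinP p t ^ p := by
        rw [mul_assoc, ← sq, ← Real.rpow_two, ← Real.rpow_add hs]; congr 1; ring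
      have e2 : sinP p t ^ p ≤ 1 := Real.rpow_le_one hs.le hs1 (by linarith)
      have e3 : 0 ≤ sinP p t ^ p := by positivity
      have e4 : cosPBase p t ^ (p - 1) ≤ 1 := Real.rpow_le_one hc hc1 hp1.le
      have e5 : 0 ≤ cosPBase p t ^ (p - 1) := by positivity
      have e6 : cosPBase p t ^ (p - 1) * cosPBase p t ≤ 1 := mul_le_one₀ e4 hc hc1
      have e7 : 0 ≤ cosPBase p t ^ (p - 1) * cosPBase p t := by positivity
      rw [norm_div, Real.norm_of_nonneg hp1.le]
      gcongr
      rw [Real.norm_eq_abs, abs_le]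
      have e8 : -((p - 1) * (sinP p t ^ (p - 2) * sinP p t)) * sinP p t
        = -((p - 1) * sinP p t ^ p) := by rw [← e1]; ring
      rw [e8]
      constructor <;> nlinarith
    have := hIoo.closure (by rw [closure_Ioo (by linarith)]; exact hcont)
    rwa [closure_Ioo (by linarith)] at this
  refine ⟨(p / (p - 1)).toNNReal, ?_⟩
  have h := (lipschitzOnWith_iff_restrict.1 key).comp
    (LipschitzWith.projIcc (by linarith : (0 : ℝ) ≤ piP p / 2))
  simp only [mul_one] at h
  convert! h using 1
  ext t
  simp only [drift, Function.comp_apply, Set.domRestrict_apply, Set.coe_projIcc, hmax]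

theorem drift_bounded {p : ℝ} (hp : 1 < p) (t : ℝ) : |drift p t| ≤ 1 / (p - 1) := by
  have hpi := piP_pos hp
  have hp1 : 0 < p - 1 := by linarith
  rw [abs_of_nonneg (drift_nonneg hp t)]
  rcases le_total t 0 with h | h
  · rw [drift_of_nonpos hp h]; positivity
  rcases le_total (piP p / 2) t with h' | h'
  · rw [drift_of_ge hp h']; positivity
  rw [drift_eq ⟨h, h'⟩]
  have hm : t ∈ Set.Icc (-(piP p / 2)) (piP p / 2) := ⟨by linarith, h'⟩
  have h1 : cosPBase p t ^ (p - 1) ≤ 1 :=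
    Real.rpow_le_one (cosPBase_nonneg hp hm) (cosPBase_le_one hp hm) hp1.le
  have h2 : 0 ≤ cosPBase p t ^ (p - 1) := Real.rpow_nonneg (cosPBase_nonneg hp hm) _
  have h3 := abs_le.1 (abs_sinP_le_one hp hm)
  gcongr
  nlinarith

/-- The unclamped nonlinearity of the model problem agrees with `drift` on `[0, π_p/2]`. -/
theorem model_nonlinearity_eq {p t : ℝ} (hp : 1 < p) (ht : t ∈ Set.Icc 0 (piP p / 2)) :
    |cosP p t| ^ (p - 2) * cosP p t * sinP p t = (p - 1) * drift p t := by
  have hp1 : 0 < p - 1 := by linarith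
  have hpi := piP_pos hp
  rcases eq_or_lt_of_le ht.2 with h | h
  · rw [drift_of_ge hp h.ge, h, cosP_piP_half hp]; simp
  · rw [drift_eq ht, cosP_eq_base hp ⟨by linarith [ht.1], h⟩]
    have hc := cosPBase_pos hp (t := t) ⟨by linarith [ht.1], h⟩
    rw [abs_of_pos hc]
    have : cosPBase p t ^ (p - 1) = cosPBase p t ^ (p - 2) * cosPBase p t := by
      rw [← Real.rpow_add_one hc.ne']; congr 1; ring
    rw [this]
    field_simp

/-- The nonlinearity is odd. -/
theorem model_nonlinearity_neg {p t : ℝ} (hp : 1 < p)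
    (ht : t ∈ Set.Ioo (-(piP p / 2)) (piP p / 2)) :
    |cosP p (-t)| ^ (p - 2) * cosP p (-t) * sinP p (-t) =
      -(|cosP p t| ^ (p - 2) * cosP p t * sinP p t) := by
  have hs := sinP_neg hp (Set.Ioo_subset_Icc_self ht)
  rw [hs, cosP_eq_base hp ht, cosP_eq_base hp ⟨by linarith [ht.2], by linarith [ht.1]⟩,
    cosPBase, hs, abs_neg, ← cosPBase]
  ring

/-- The nonlinearity is odd under reflection at `π_p/2`. -/
theorem model_nonlinearity_reflect {p t : ℝ} (hp : 1 < p)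
    (ht : t ∈ Set.Icc (piP p / 2) (piP p)) :
    |cosP p t| ^ (p - 2) * cosP p t * sinP p t = -((p - 1) * drift p (piP p - t)) := by
  have hpi := piP_pos hp
  rw [← model_nonlinearity_eq hp (t := piP p - t) ⟨by linarith [ht.2], by linarith [ht.1]⟩,
    cosP_reflect hp ⟨by linarith [ht.1], by linarith [ht.2]⟩,
    sinP_reflect' hp ⟨by linarith [ht.1], by linarith [ht.2]⟩, abs_neg]
  ring

end MCPGap

end

noncomputable section

namespace MCPGap

/-! ### The shooting problem on a half interval -/

open Set Filter Topology

/-- `φ` solves `φ' = α + c G(φ)` on `[a, b)` with `φ a = 0`. -/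
structure IsFlow (c G : ℝ → ℝ) (a b α : ℝ) (φ : ℝ → ℝ) : Prop where
  left : φ a = 0
  deriv : ∀ x ∈ Ico a b, HasDerivWithinAt φ (α + c x * G (φ x)) (Ici a) x

namespace IsFlow

variable {c G φ ψ : ℝ → ℝ} {a b α β M P : ℝ} {L : NNReal}

theorem continuousOn (h : IsFlow c G a b α φ) : ContinuousOn φ (Ico a b) := fun x hx =>
  (h.deriv x hx).continuousWithinAt.mono Ico_subset_Ici_self

theorem hasDerivAt (h : IsFlow c G a b α φ) {x : ℝ} (hx : x ∈ Ioo a b) :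
    HasDerivAt φ (α + c x * G (φ x)) x :=
  (h.deriv x (Ioo_subset_Ico_self hx)).hasDerivAt (Ici_mem_nhds hx.1)

theorem deriv_right (h : IsFlow c G a b α φ) {x : ℝ} (hx : x ∈ Ico a b) :
    HasDerivWithinAt φ (α + c x * G (φ x)) (Ici x) x :=
  (h.deriv x hx).mono (Ici_subset_Ici.2 hx.1)

/-- Grönwall estimate for the dependence on `α`. -/
theorem exists_dist_le (hc : ContinuousOn c (Ico a b)) (hG : LipschitzWith L G) {x : ℝ}
    (hx : x ∈ Ico a b) :
    ∃ K : NNReal, ∀ α β φ ψ, IsFlow c G a b α φ → IsFlow c G a b β ψ →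
      dist (φ x) (ψ x) ≤ gronwallBound 0 K |α - β| (x - a) := by
  have hsub : Icc a x ⊆ Ico a b := Icc_subset_Ico_right hx.2
  obtain ⟨C, hC⟩ := isCompact_Icc.exists_bound_of_continuousOn (hc.mono hsub)
  have hC0 : 0 ≤ C := (norm_nonneg _).trans (hC a ⟨le_rfl, hx.1⟩)
  -- The Grönwall constant `sup |c| * L` does not depend on the speeds. Here `φ` is regarded as an
  -- approximate trajectory of the equation with speed `β`, with error `|α - β|`.
  refine ⟨C.toNNReal * L, fun α β φ ψ hφ hψ => ?_⟩
  have key := dist_le_of_approx_trajectories_ODE_of_mem (v := fun t y => β + c t * G y)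
    (s := fun _ => univ) (K := C.toNNReal * L) (f := φ) (g := ψ) (a := a) (b := x)
    (f' := fun t => α + c t * G (φ t)) (g' := fun t => β + c t * G (ψ t))
    (εf := |α - β|) (εg := 0) (δ := 0) ?_ (hφ.continuousOn.mono hsub)
    (fun t ht => hφ.deriv_right (hsub (Ico_subset_Icc_self ht))) ?_ (fun _ _ => trivial)
    (hψ.continuousOn.mono hsub)
    (fun t ht => hψ.deriv_right (hsub (Ico_subset_Icc_self ht))) ?_ (fun _ _ => trivial)
    (by simp [hφ.left, hψ.left]) x ⟨hx.1, le_rfl⟩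
  · simpa using key
  · intro t ht
    refine LipschitzOnWith.of_dist_le_mul fun y _ z _ => ?_
    have h1 := hC t (Ico_subset_Icc_self ht)
    have h2 := hG.dist_le_mul y z
    rw [dist_add_left, Real.dist_eq, ← mul_sub, abs_mul, NNReal.coe_mul, Real.coe_toNNReal _ hC0,
      mul_assoc]
    exact mul_le_mul h1 h2 (abs_nonneg _) hC0
  · intro t _
    rw [dist_add_right, Real.dist_eq]
  · intro t _
    simp

theorem eqOn (hc : ContinuousOn c (Ico a b)) (hG : LipschitzWith L G)
    (hφ : IsFlow c G a b α φ) (hψ : IsFlow c G a b α ψ) : EqOn φ ψ (Ico a b) := by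
  intro x hx
  obtain ⟨K, hK⟩ := exists_dist_le hc hG hx
  have := hK α α φ ψ hφ hψ
  rw [sub_self, abs_zero, gronwallBound_ε0, zero_mul] at this
  exact dist_le_zero.1 this

theorem continuous_param (hc : ContinuousOn c (Ico a b)) (hG : LipschitzWith L G)
    {Φ : ℝ → ℝ → ℝ} (hΦ : ∀ α, IsFlow c G a b α (Φ α)) {x : ℝ} (hx : x ∈ Ico a b) :
    Continuous fun α => Φ α x := by
  obtain ⟨K, hK⟩ := exists_dist_le hc hG hx
  rw [continuous_iff_continuousAt]
  intro β
  have h1 : Tendsto (fun α => gronwallBound 0 K |α - β| (x - a)) (𝓝 β) (𝓝 0) := by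
    have : Continuous fun α => gronwallBound 0 K |α - β| (x - a) :=
      (gronwallBound_continuous_ε 0 K (x - a)).comp (by fun_prop)
    have h := this.tendsto β
    rwa [sub_self, abs_zero, gronwallBound_ε0, zero_mul] at h
  exact tendsto_iff_dist_tendsto_zero.2 (squeeze_zero (fun _ => dist_nonneg)
    (fun α => hK α β _ _ (hΦ α) (hΦ β)) h1)

theorem mono_right (hφ : IsFlow c G a b α φ) {b' : ℝ} (hb : b' ≤ b) : IsFlow c G a b' α φ :=
  ⟨hφ.left, fun x hx => hφ.deriv x ⟨hx.1, hx.2.trans_le hb⟩⟩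

/-- The right-hand side is bounded by `|α| + C M` for all values of the unknown, so Picard–Lindelöf
applies on the whole interval at once, in a ball of radius `(|α| + C M)(b - a)`. -/
theorem exists_isFlow_of_continuousOn_Icc (hab : a < b) (hc : ContinuousOn c (Icc a b))
    (hG : LipschitzWith L G) (hM : ∀ y, |G y| ≤ M) (α : ℝ) : ∃ φ, IsFlow c G a b α φ := by
  obtain ⟨C, hC⟩ := isCompact_Icc.exists_bound_of_continuousOn hc
  have hC0 : 0 ≤ C := (norm_nonneg _).trans (hC a ⟨le_rfl, hab.le⟩)
  have hM0 : 0 ≤ M := (abs_nonneg _).trans (hM 0)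
  have hbound : ∀ t ∈ Icc a b, ∀ y, ‖α + c t * G y‖ ≤ |α| + C * M := fun t ht y => by
    refine (norm_add_le _ _).trans (add_le_add le_rfl ?_)
    rw [norm_mul]
    exact mul_le_mul (hC t ht) (hM y) (norm_nonneg _) hC0
  have hPL : IsPicardLindelof (fun t y => α + c t * G y) (tmin := a) (tmax := b)
      ⟨a, le_rfl, hab.le⟩ 0 ((|α| + C * M) * (b - a)).toNNReal 0 (|α| + C * M).toNNReal
      (C.toNNReal * L) := by
    have hnn : 0 ≤ |α| + C * M := by positivity
    refine ⟨fun t ht => ?_, fun y _ => ?_, fun t ht y _ => ?_, ?_⟩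
    · refine LipschitzOnWith.of_dist_le_mul fun y _ z _ => ?_
      have h1 := hC t ht
      have h2 := hG.dist_le_mul y z
      rw [dist_add_left, Real.dist_eq, ← mul_sub, abs_mul, NNReal.coe_mul, Real.coe_toNNReal _ hC0,
        mul_assoc]
      exact mul_le_mul h1 h2 (abs_nonneg _) hC0
    · exact continuousOn_const.add (hc.mul continuousOn_const)
    · rw [Real.coe_toNNReal _ hnn]
      exact hbound t ht y
    · have : 0 ≤ b - a := by linarith
      rw [Real.coe_toNNReal _ hnn, Real.coe_toNNReal _ (by positivity)]
      simp [this]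
  obtain ⟨φ, h0, hφ⟩ := hPL.exists_eq_forall_mem_Icc_hasDerivWithinAt₀
  refine ⟨φ, h0, fun x hx => ?_⟩
  refine (hφ x (Ico_subset_Icc_self hx)).mono_of_mem_nhdsWithin ?_
  rw [← Ici_inter_Iic]
  exact inter_mem self_mem_nhdsWithin (mem_nhdsWithin_of_mem_nhds (Iic_mem_nhds hx.2))

/-- The coefficient may blow up at `b`. Trajectories on `[a, d)` with `d < b` agree where they
overlap, by uniqueness, so the value at `x` may be read off the one with `d = (x + b) / 2`. -/
theorem exists_isFlow (hab : a < b) (hc : ContinuousOn c (Ico a b))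
    (hG : LipschitzWith L G) (hM : ∀ y, |G y| ≤ M) (α : ℝ) : ∃ φ, IsFlow c G a b α φ := by
  have h : ∀ d, ∃ φ, d ∈ Ioo a b → IsFlow c G a d α φ := fun d => by
    by_cases hd : d ∈ Ioo a b
    · obtain ⟨φ, hφ⟩ := exists_isFlow_of_continuousOn_Icc hd.1
        (hc.mono (Icc_subset_Ico_right hd.2)) hG hM α
      exact ⟨φ, fun _ => hφ⟩
    · exact ⟨0, fun h => absurd h hd⟩
  choose ψ hψ using h
  have hmid : ∀ x ∈ Ico a b, (x + b) / 2 ∈ Ioo a b := fun x hx =>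
    ⟨by linarith [hx.1, hx.2], by linarith [hx.2]⟩
  have heq : ∀ d ∈ Ioo a b, ∀ x ∈ Ico a d, ψ ((x + b) / 2) x = ψ d x := fun d hd x hx => by
    have hx' : x ∈ Ico a b := ⟨hx.1, hx.2.trans hd.2⟩
    have hm := hmid x hx'
    have h1 := (hψ _ hm).mono_right (min_le_left _ d)
    have h2 := (hψ _ hd).mono_right (min_le_right ((x + b) / 2) _)
    refine eqOn (hc.mono (Ico_subset_Ico_right ?_)) hG h1 h2 ⟨hx.1, ?_⟩
    · exact (min_le_right _ _).trans hd.2.le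
    · exact lt_min (by linarith [hx'.2]) hx.2
  refine ⟨fun x => ψ ((x + b) / 2) x, ?_, fun x hx => ?_⟩
  · exact (hψ _ (hmid a ⟨le_rfl, hab⟩)).left
  · have hd := hmid x hx
    have hxd : x ∈ Ico a ((x + b) / 2) := ⟨hx.1, by linarith [hx.2]⟩
    refine ((hψ _ hd).deriv x hxd).congr_of_eventuallyEq ?_ rfl
    filter_upwards [self_mem_nhdsWithin, mem_nhdsWithin_of_mem_nhds (Iio_mem_nhds hxd.2)]
      with y hy1 hy2
    exact heq _ hd y ⟨hy1, hy2⟩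

theorem eqOn_zero (hc : ContinuousOn c (Ico a b)) (hG : LipschitzWith L G)
    (hG0 : ∀ y ≤ 0, G y = 0) (hφ : IsFlow c G a b 0 φ) : EqOn φ 0 (Ico a b) :=
  eqOn hc hG hφ ⟨rfl, fun x _ => by
    have h : (0 : ℝ) + c x * G ((0 : ℝ → ℝ) x) = 0 := by simp [hG0 0 le_rfl]
    rw [h]
    exact hasDerivWithinAt_const x (Ici a) (0 : ℝ)⟩

/-- Above level `P` the nonlinearity is switched off and `φ' = α`, so a trajectory that reaches `P`
keeps rising. The slope `α / 2` instead of `α` provides the strict inequality needed by the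
comparison principle. -/
theorem add_le_of_ge (hGP : ∀ y, P ≤ y → G y = 0) (hα : 0 < α) (hφ : IsFlow c G a b α φ)
    {x y : ℝ} (hx : a ≤ x) (hxy : x ≤ y) (hy : y < b) (h : P ≤ φ x) :
    P + α / 2 * (y - x) ≤ φ y := by
  have hsub : Icc x y ⊆ Ico a b := fun z hz => ⟨hx.trans hz.1, hz.2.trans_lt hy⟩
  refine image_le_of_deriv_right_lt_deriv_boundary' (f := fun z => P + α / 2 * (z - x))
    (f' := fun _ => α / 2) (B := φ) (B' := fun z => α + c z * G (φ z)) (a := x) (b := y)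
    (by fun_prop) (fun z _ => ?_) (by simpa using h) (hφ.continuousOn.mono hsub)
    (fun z hz => hφ.deriv_right (hsub (Ico_subset_Icc_self hz))) (fun z hz hz' => ?_)
    ⟨hxy, le_rfl⟩
  · have := (((hasDerivAt_id z).sub_const x).const_mul (α / 2)).const_add P
    simpa using this.hasDerivWithinAt
  · have : P ≤ φ z := by
      rw [← hz']
      have : 0 ≤ z - x := by linarith [hz.1]
      have : 0 ≤ α / 2 * (z - x) := by positivity
      linarith
    rw [hGP _ this]
    linarith

theorem nonneg (hG0 : ∀ y ≤ 0, G y = 0) (hα : 0 < α) (hφ : IsFlow c G a b α φ)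
    {x : ℝ} (hx : x ∈ Ico a b) : 0 ≤ φ x := by
  have hsub : Icc a x ⊆ Ico a b := Icc_subset_Ico_right hx.2
  refine image_le_of_deriv_right_lt_deriv_boundary' (f := fun _ => 0)
    (f' := fun _ => 0) (B := φ) (B' := fun z => α + c z * G (φ z)) (a := a) (b := x)
    (by fun_prop) (fun z _ => hasDerivWithinAt_const _ _ _) hφ.left.ge (hφ.continuousOn.mono hsub)
    (fun z hz => hφ.deriv_right (hsub (Ico_subset_Icc_self hz))) (fun z hz hz' => ?_)
    ⟨hx.1, le_rfl⟩
  rw [hG0 _ hz'.ge]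
  linarith

/-- An interior zero would be a local minimum, yet the slope there is `α > 0`. -/
theorem pos (hG0 : ∀ y ≤ 0, G y = 0) (hα : 0 < α) (hφ : IsFlow c G a b α φ)
    {x : ℝ} (hx : x ∈ Ioo a b) : 0 < φ x := by
  refine (hφ.nonneg hG0 hα (Ioo_subset_Ico_self hx)).lt_of_ne fun h => ?_
  have hmin : IsLocalMin φ x := by
    filter_upwards [Ioo_mem_nhds hx.1 hx.2] with y hy
    rw [← h]
    exact hφ.nonneg hG0 hα (Ioo_subset_Ico_self hy)
  have := hmin.hasDerivAt_eq_zero (hφ.hasDerivAt hx)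
  rw [hG0 _ h.ge] at this
  linarith

theorem lt_of_le (hGP : ∀ y, P ≤ y → G y = 0) (hα : 0 < α) (hφ : IsFlow c G a b α φ)
    (hle : ∀ x ∈ Ioo a b, φ x ≤ P) {x : ℝ} (hx : x ∈ Ioo a b) : φ x < P := by
  by_contra! h
  have := hφ.add_le_of_ge hGP hα (x := x) (y := (x + b) / 2) hx.1.le (by linarith [hx.2])
    (by linarith [hx.2]) h
  have h2 := hle ((x + b) / 2) ⟨by linarith [hx.1, hx.2], by linarith [hx.2]⟩
  have : 0 < α / 2 * ((x + b) / 2 - x) := mul_pos (by linarith) (by linarith [hx.2])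
  linarith

/-- If `α` exceeds `C M` by more than `|P| / (x - a)`, the trajectory stays above the line from `0`
at `a` to `|P|` at `x`. -/
theorem exists_forall_ge (hc : ContinuousOn c (Ico a b)) (hM : ∀ y, |G y| ≤ M)
    {x : ℝ} (hx : x ∈ Ioo a b) :
    ∃ A, 0 ≤ A ∧ ∀ α φ, A ≤ α → IsFlow c G a b α φ → P ≤ φ x := by
  have hsub : Icc a x ⊆ Ico a b := Icc_subset_Ico_right hx.2
  obtain ⟨C, hC⟩ := isCompact_Icc.exists_bound_of_continuousOn (hc.mono hsub)
  have hC0 : 0 ≤ C := (norm_nonneg _).trans (hC a ⟨le_rfl, hx.1.le⟩)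
  have hM0 : 0 ≤ M := (abs_nonneg _).trans (hM 0)
  have hxa : 0 < x - a := by linarith [hx.1]
  refine ⟨|P| / (x - a) + C * M + 1, by positivity, fun α φ hα hφ => ?_⟩
  have h := image_le_of_deriv_right_lt_deriv_boundary' (f := fun z => |P| / (x - a) * (z - a))
    (f' := fun _ => |P| / (x - a)) (B := φ) (B' := fun z => α + c z * G (φ z)) (a := a) (b := x)
    (by fun_prop) (fun z _ => ?_) (by simp [hφ.left]) (hφ.continuousOn.mono hsub)
    (fun z hz => hφ.deriv_right (hsub (Ico_subset_Icc_self hz))) (fun z hz hz' => ?_)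
    ⟨hx.1.le, le_rfl⟩
  · beta_reduce at h
    rw [div_mul_cancel₀ _ hxa.ne'] at h
    exact (le_abs_self P).trans h
  · have := (((hasDerivAt_id z).sub_const a).const_mul (|P| / (x - a)))
    simpa using this.hasDerivWithinAt
  · have h1 : |c z * G (φ z)| ≤ C * M := by
      rw [abs_mul]
      exact mul_le_mul (hC z (Ico_subset_Icc_self hz)) (hM _) (abs_nonneg _) hC0
    linarith [(abs_le.1 h1).1]

end IsFlow

/-! ### Half solutions by shooting -/

/-- `φ` solves the right half of the model problem: `φ' = α + c G(φ)` on `[a, b)`,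
`φ a = 0`, `φ b = P`, with values in `(0, P)` on `(a, b)`. -/
structure IsHalfSolution (c G : ℝ → ℝ) (P a b α : ℝ) (φ : ℝ → ℝ) : Prop extends
    IsFlow c G a b α φ where
  alpha_pos : 0 < α
  continuousOn_Icc : ContinuousOn φ (Icc a b)
  right : φ b = P
  mem : ∀ x ∈ Ioo a b, φ x ∈ Ioo 0 P

variable {c G : ℝ → ℝ} {P M a b : ℝ} {L : NNReal}

/-- Regular right end: the end value depends continuously on `α`, is `0` for `α = 0` and at least
`P` for large `α`, so the intermediate value theorem applies. -/
theorem exists_isHalfSolution_of_continuousOn_Icc (hP : 0 < P) (hG : LipschitzWith L G)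
    (hM : ∀ y, |G y| ≤ M) (hG0 : ∀ y ≤ 0, G y = 0) (hGP : ∀ y, P ≤ y → G y = 0) (hab : a < b)
    (hc : ContinuousOn c (Icc a b)) : ∃ α φ, IsHalfSolution c G P a b α φ := by
  -- Continuing the coefficient past `b` makes `b` an interior time of the flow, so that the
  -- dependence on `α` is controlled there.
  set c' := IccExtend hab.le ((Icc a b).domRestrict c) with hc'
  have hcont : Continuous c' := (continuousOn_iff_continuous_domRestrict.1 hc).Icc_extend'
  have heq : ∀ x ∈ Icc a b, c' x = c x := fun x hx => by
    rw [hc', IccExtend_of_mem _ _ hx, domRestrict_apply]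
  have hab1 : a < b + 1 := by linarith
  choose Φ hΦ using fun α => IsFlow.exists_isFlow (c := c') hab1 hcont.continuousOn hG hM α
  have hb : b ∈ Ioo a (b + 1) := ⟨hab, by linarith⟩
  have hΦc := IsFlow.continuous_param hcont.continuousOn hG hΦ (Ioo_subset_Ico_self hb)
  obtain ⟨A, hA0, hA⟩ := IsFlow.exists_forall_ge (P := P) (c := c') (G := G) hcont.continuousOn hM hb
  have h0 : Φ 0 b = 0 :=
    IsFlow.eqOn_zero hcont.continuousOn hG hG0 (hΦ 0) (Ioo_subset_Ico_self hb)
  obtain ⟨α, hα, hαb⟩ := intermediate_value_Icc hA0 hΦc.continuousOn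
    (show P ∈ Icc (Φ 0 b) (Φ A b) from ⟨by rw [h0]; exact hP.le, hA A _ le_rfl (hΦ A)⟩)
  have hα0 : 0 < α := hα.1.lt_of_ne (by rintro rfl; beta_reduce at hαb; linarith)
  have hle : ∀ x ∈ Ioo a b, Φ α x ≤ P := fun x hx => by
    by_contra! h
    have := (hΦ α).add_le_of_ge hGP hα0 hx.1.le hx.2.le (by linarith) h.le
    have h2 : 0 < α / 2 * (b - x) := mul_pos (by linarith) (by linarith [hx.2])
    beta_reduce at hαb
    linarith
  have hflow : IsFlow c G a b α (Φ α) := ⟨(hΦ α).left, fun x hx => by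
    rw [← heq x (Ico_subset_Icc_self hx)]
    exact (hΦ α).deriv x ⟨hx.1, by linarith [hx.2]⟩⟩
  exact ⟨α, Φ α, hflow, hα0, (hΦ α).continuousOn.mono (Icc_subset_Ico_right (by linarith)), hαb,
    fun x hx => ⟨hflow.pos hG0 hα0 hx, hflow.lt_of_le hGP hα0 hle hx⟩⟩

/-- Singular right end: `α` is the largest speed whose trajectory never exceeds `P`. If this
trajectory came below a level under `P` arbitrarily late, the coefficient would be so negative by
then that slightly faster trajectories would be trapped as well, against maximality. -/
theorem exists_isHalfSolution_of_tendsto_atBot (hP : 0 < P) (hG : LipschitzWith L G)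
    (hM : ∀ y, |G y| ≤ M) (hG0 : ∀ y ≤ 0, G y = 0) (hGP : ∀ y, P ≤ y → G y = 0)
    (hGpos : ∀ y ∈ Ioo 0 P, 0 < G y) (hab : a < b)
    (hc : ContinuousOn c (Ico a b)) (hlim : Tendsto c (𝓝[<] b) atBot) :
    ∃ α φ, IsHalfSolution c G P a b α φ := by
  choose Φ hΦ using fun α => IsFlow.exists_isFlow (c := c) hab hc hG hM α
  set T : Set ℝ := {α | 0 ≤ α ∧ ∀ x ∈ Ico a b, Φ α x ≤ P} with hT
  have hzero : EqOn (Φ 0) 0 (Ico a b) := IsFlow.eqOn_zero hc hG hG0 (hΦ 0)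
  have h0T : (0 : ℝ) ∈ T := ⟨le_rfl, fun x hx => by rw [hzero hx]; exact hP.le⟩
  have hmid : (a + b) / 2 ∈ Ioo a b := ⟨by linarith, by linarith⟩
  obtain ⟨A, hA0, hA⟩ := IsFlow.exists_forall_ge (P := P) (c := c) (G := G) hc hM hmid
  have hbdd : BddAbove T := ⟨A, fun α hα => by
    by_contra! h
    have hα0 : 0 < α := by linarith
    have := (hΦ α).lt_of_le hGP hα0 (fun x hx => hα.2 x (Ioo_subset_Ico_self hx)) hmid
    linarith [hA α _ h.le (hΦ α)]⟩
  have hclosed : IsClosed T := by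
    have : T = Ici 0 ∩ ⋂ x ∈ Ico a b, {α | Φ α x ≤ P} := by
      ext α; simp [hT]
    rw [this]
    refine isClosed_Ici.inter (isClosed_biInter fun x hx => ?_)
    exact isClosed_le (IsFlow.continuous_param hc hG hΦ hx) continuous_const
  set α := sSup T with hαdef
  have hαT : α ∈ T := hclosed.csSup_mem ⟨0, h0T⟩ hbdd
  have hlimφ : Tendsto (Φ α) (𝓝[<] b) (𝓝 P) := by
    refine tendsto_order.2 ⟨fun l hl => ?_, fun u hu => ?_⟩
    · by_contra hfreq
      rw [not_eventually] at hfreq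
      obtain ⟨ℓ, hℓ1, hℓ2⟩ := exists_between (max_lt hl hP)
      have hGℓ : 0 < G ℓ := hGpos ℓ ⟨(le_max_right _ _).trans_lt hℓ1, hℓ2⟩
      -- After time `d` the level `ℓ` is a barrier for all speeds below `α + 1` simultaneously,
      -- which leaves room for a `β > α`.
      have hev : ∀ᶠ x in 𝓝[<] b, c x * G ℓ < -(α + 1) :=
        (hlim.atBot_mul_const hGℓ).eventually_lt_atBot _
      obtain ⟨d, hd, hdsub⟩ := (mem_nhdsLT_iff_exists_Ioo_subset' hab).1 hev
      obtain ⟨x₁, hx₁, hx₁'⟩ := (hfreq.and_eventually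
        (Ioo_mem_nhdsLT (max_lt hd hab : max d a < b))).exists
      have hx₁a : x₁ ∈ Ico a b := ⟨(le_max_right _ _).trans hx₁'.1.le, hx₁'.2⟩
      have hx₁d : d < x₁ := (le_max_left _ _).trans_lt hx₁'.1
      have hlt : Φ α x₁ < ℓ := (not_lt.1 hx₁).trans_lt ((le_max_left _ _).trans_lt hℓ1)
      have hev2 : ∀ᶠ β in 𝓝 α, Φ β x₁ < ℓ :=
        (IsFlow.continuous_param hc hG hΦ hx₁a).continuousAt.eventually_lt_const hlt
      obtain ⟨β, hβ⟩ := ((hev2.filter_mono nhdsWithin_le_nhds).and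
        (Ioo_mem_nhdsGT (lt_add_one α))).exists
      have hβ0 : 0 < β := hαT.1.trans_lt hβ.2.1
      have hβT : β ∈ T := by
        refine ⟨hβ0.le, fun x hx => ?_⟩
        -- Before `x₁`, exceeding `P` would keep `Φ β x₁` above `P > ℓ`; after `x₁`, the barrier `ℓ`
        -- holds.
        rcases le_total x x₁ with hxx | hxx
        · by_contra! h
          have := (hΦ β).add_le_of_ge hGP hβ0 hx.1 hxx hx₁a.2 h.le
          have h2 : 0 ≤ β / 2 * (x₁ - x) := mul_nonneg (by linarith) (by linarith)
          linarith [hβ.1]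
        · have hsub : Icc x₁ x ⊆ Ico a b := fun z hz =>
            ⟨hx₁a.1.trans hz.1, hz.2.trans_lt hx.2⟩
          have := image_le_of_deriv_right_lt_deriv_boundary' (f := Φ β)
            (f' := fun z => β + c z * G (Φ β z)) (B := fun _ => ℓ) (B' := fun _ => 0)
            (a := x₁) (b := x) ((hΦ β).continuousOn.mono hsub)
            (fun z hz => (hΦ β).deriv_right (hsub (Ico_subset_Icc_self hz))) hβ.1.le
            continuousOn_const (fun z _ => hasDerivWithinAt_const _ _ _) (fun z hz hz' => by
              rw [hz']
              have : c z * G ℓ < -(α + 1) := hdsub ⟨hx₁d.trans_le hz.1, hz.2.trans hx.2⟩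
              linarith [hβ.2.2]) ⟨hxx, le_rfl⟩
          exact this.trans hℓ2.le
      exact absurd (le_csSup hbdd hβT) (not_le.2 hβ.2.1)
    · filter_upwards [Ioo_mem_nhdsLT hab] with x hx
      exact (hαT.2 x (Ioo_subset_Ico_self hx)).trans_lt hu
  have hα0 : 0 < α := by
    refine hαT.1.lt_of_ne fun h => ?_
    rw [← h] at hlimφ
    have : Tendsto (Φ 0) (𝓝[<] b) (𝓝 0) := tendsto_const_nhds.congr' (by
      filter_upwards [Ioo_mem_nhdsLT hab] with x hx
      exact (hzero (Ioo_subset_Ico_self hx)).symm)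
    exact hP.ne (tendsto_nhds_unique this hlimφ)
  -- The flow says nothing about the time `b`, so the limit `P` is installed there as a value.
  have heq : ∀ x, x ≠ b → Function.update (Φ α) b P x = Φ α x := fun x hx =>
    Function.update_of_ne hx _ _
  have hflow : IsFlow c G a b α (Function.update (Φ α) b P) := by
    refine ⟨by rw [heq a hab.ne, (hΦ α).left], fun x hx => ?_⟩
    rw [heq x hx.2.ne]
    refine ((hΦ α).deriv x hx).congr_of_eventuallyEq ?_ (heq x hx.2.ne)
    filter_upwards [mem_nhdsWithin_of_mem_nhds (Iio_mem_nhds hx.2)] with y hy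
    exact heq y (ne_of_lt hy)
  refine ⟨α, _, hflow, hα0, ?_, Function.update_self _ _ _, fun x hx => ?_⟩
  · intro x hx
    rcases eq_or_lt_of_le hx.2 with rfl | h
    · rw [continuousWithinAt_update_same, Icc_sdiff_right]
      exact hlimφ.mono_left (nhdsWithin_mono _ Ico_subset_Iio_self)
    · exact ((hflow.deriv x ⟨hx.1, h⟩).continuousWithinAt).mono Icc_subset_Ici_self
  · rw [heq x hx.2.ne]
    exact ⟨(hΦ α).pos hG0 hα0 hx, (hΦ α).lt_of_le hGP hα0
      (fun x hx => hαT.2 x (Ioo_subset_Ico_self hx)) hx⟩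

end MCPGap

end

noncomputable section

namespace MCPGap

/-! ### Generalized sine of constant curvature -/

open Set Filter Topology

/-- The solution `s` of `s'' + K / (N - 1) s = 0`, `s 0 = 0`, `s' 0 = 1`. -/
def sn (K N x : ℝ) : ℝ :=
  if 0 < K then Real.sin (Real.sqrt (K / (N - 1)) * x) / Real.sqrt (K / (N - 1))
  else if K = 0 then x
  else Real.sinh (Real.sqrt (-K / (N - 1)) * x) / Real.sqrt (-K / (N - 1))

/-- The derivative of `sn`. -/
def cn (K N x : ℝ) : ℝ :=
  if 0 < K then Real.cos (Real.sqrt (K / (N - 1)) * x)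
  else if K = 0 then 1
  else Real.cosh (Real.sqrt (-K / (N - 1)) * x)

variable {K N : ℝ}

theorem sqrt_curvature_pos (hN : 1 < N) (hK : 0 < K) : 0 < Real.sqrt (K / (N - 1)) :=
  Real.sqrt_pos.2 (div_pos hK (by linarith))

theorem curvature_cases (K : ℝ) : 0 < K ∨ (¬0 < K ∧ K = 0) ∨ (¬0 < K ∧ ¬K = 0 ∧ 0 < -K) := by
  rcases lt_trichotomy K 0 with h | h | h
  · exact Or.inr (Or.inr ⟨h.not_gt, h.ne, by linarith⟩)
  · exact Or.inr (Or.inl ⟨by simp [h], h⟩)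
  · exact Or.inl h

theorem sn_hasDerivAt (hN : 1 < N) (x : ℝ) : HasDerivAt (sn K N) (cn K N x) x := by
  unfold sn cn
  rcases curvature_cases K with h | ⟨h, h'⟩ | ⟨h, h', h''⟩
  · have hs := sqrt_curvature_pos hN h
    simp only [h, if_true]
    have := (((hasDerivAt_id x).const_mul (Real.sqrt (K / (N - 1)))).sin).div_const
      (Real.sqrt (K / (N - 1)))
    refine this.congr_deriv ?_
    rw [mul_one, mul_div_cancel_right₀ _ hs.ne']
    rfl
  · simp only [h', lt_irrefl, if_false, if_true]
    exact hasDerivAt_id x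
  · have hs := sqrt_curvature_pos hN h''
    simp only [h, h', if_false]
    have := (((hasDerivAt_id x).const_mul (Real.sqrt (-K / (N - 1)))).sinh).div_const
      (Real.sqrt (-K / (N - 1)))
    refine this.congr_deriv ?_
    rw [mul_one, mul_div_cancel_right₀ _ hs.ne']
    rfl

theorem continuous_sn (hN : 1 < N) : Continuous (sn K N) :=
  continuous_iff_continuousAt.2 fun x => (sn_hasDerivAt hN x).continuousAt

theorem continuous_cn : Continuous (cn K N) := by
  unfold cn
  split_ifs <;> fun_prop

/-- As functions of `e`, both sides solve the equation of `sn` and they agree at `e = 0` and `e =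
b`. The sign of the right-hand side is what yields the contraction inequality for the model density.
-/
theorem sn_mul_sub_sub (hN : 1 < N) (a b e : ℝ) :
    sn K N (a - e) * sn K N b - sn K N (b - e) * sn K N a = sn K N e * sn K N (a - b) := by
  unfold sn
  rcases curvature_cases K with h | ⟨h, h'⟩ | ⟨h, h', h''⟩
  · have hs := sqrt_curvature_pos hN h
    simp only [h, if_true, mul_sub, Real.sin_sub]
    field_simp
    ring
  · simp only [h', lt_irrefl, if_false, if_true]
    ring
  · have hs := sqrt_curvature_pos hN h''
    simp only [h, h', if_false, mul_sub, Real.sinh_sub]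
    field_simp
    ring

theorem sn_neg (x : ℝ) : sn K N (-x) = -sn K N x := by
  unfold sn
  split_ifs <;> simp [neg_div]

theorem sn_mul_add_sub (hN : 1 < N) (a b e : ℝ) :
    sn K N (a + e) * sn K N b - sn K N (b - e) * sn K N a = sn K N e * sn K N (a + b) := by
  have h := sn_mul_sub_sub (K := K) hN (-a) b e
  have h1 : sn K N (-a - e) = -sn K N (a + e) := by rw [← sn_neg]; congr 1; ring
  have h2 : sn K N (-a - b) = -sn K N (a + b) := by rw [← sn_neg]; congr 1; ring
  rw [h1, h2, sn_neg] at h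
  linarith

theorem le_bonnetMyers_iff {D : ℝ} :
    (D : EReal) ≤ bonnetMyers K N ↔ (0 < K → D ≤ Real.pi / Real.sqrt (K / (N - 1))) := by
  unfold bonnetMyers
  split_ifs with h
  · simp [h]
  · simp [h]

theorem sn_pos (hN : 1 < N) {x : ℝ} (hx : 0 < x)
    (hx' : 0 < K → x < Real.pi / Real.sqrt (K / (N - 1))) : 0 < sn K N x := by
  unfold sn
  rcases curvature_cases K with h | ⟨h, h'⟩ | ⟨h, h', h''⟩
  · have hs := sqrt_curvature_pos hN h
    simp only [h, if_true]
    refine div_pos (Real.sin_pos_of_pos_of_lt_pi (by positivity) ?_) hs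
    have := (lt_div_iff₀ hs).1 (hx' h)
    linarith
  · simp only [h', lt_irrefl, if_false, if_true]
    exact hx
  · have hs := sqrt_curvature_pos hN h''
    simp only [h, h', if_false]
    exact div_pos (Real.sinh_pos_iff.2 (by positivity)) hs

theorem sn_nonneg (hN : 1 < N) {x : ℝ} (hx : 0 ≤ x)
    (hx' : 0 < K → x ≤ Real.pi / Real.sqrt (K / (N - 1))) : 0 ≤ sn K N x := by
  unfold sn
  rcases curvature_cases K with h | ⟨h, h'⟩ | ⟨h, h', h''⟩
  · have hs := sqrt_curvature_pos hN h
    simp only [h, if_true]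
    refine div_nonneg (Real.sin_nonneg_of_nonneg_of_le_pi (by positivity) ?_) hs.le
    have := (le_div_iff₀ hs).1 (hx' h)
    linarith
  · simp only [h', lt_irrefl, if_false, if_true]
    exact hx
  · have hs := sqrt_curvature_pos hN h''
    simp only [h, h', if_false]
    exact div_nonneg (Real.sinh_nonneg_iff.2 (by positivity)) hs.le

theorem sn_diameter (hN : 1 < N) (hK : 0 < K) :
    sn K N (Real.pi / Real.sqrt (K / (N - 1))) = 0 := by
  have hs := sqrt_curvature_pos hN hK
  simp only [sn, hK, if_true]
  rw [mul_div_cancel₀ _ hs.ne', Real.sin_pi, zero_div]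

theorem cn_diameter (hN : 1 < N) (hK : 0 < K) :
    cn K N (Real.pi / Real.sqrt (K / (N - 1))) = -1 := by
  have hs := sqrt_curvature_pos hN hK
  simp only [cn, hK, if_true]
  rw [mul_div_cancel₀ _ hs.ne', Real.cos_pi]

theorem cotKN_eq (hN : 1 < N) (x : ℝ) : cotKN K N x = (N - 1) * (cn K N x / sn K N x) := by
  have hN1 : 0 < N - 1 := by linarith
  have key : ∀ k : ℝ, Real.sqrt (k * (N - 1)) = (N - 1) * Real.sqrt (k / (N - 1)) := fun k => by
    have : k * (N - 1) = (N - 1) ^ 2 * (k / (N - 1)) := by field_simp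
    rw [this, Real.sqrt_mul (by positivity), Real.sqrt_sq hN1.le]
  unfold cotKN sn cn
  rcases curvature_cases K with h | ⟨h, h'⟩ | ⟨h, h', h''⟩
  · simp only [h, if_true]
    rw [key, div_div_eq_mul_div]
    ring
  · simp only [h', lt_irrefl, if_false, if_true]
    ring
  · simp only [h, h', if_false]
    rw [key, div_div_eq_mul_div]
    ring

theorem sigma_eq (hN : 1 < N) {t θ : ℝ} (hθ : 0 < θ)
    (hθ' : 0 < K → θ < Real.pi / Real.sqrt (K / (N - 1))) :
    sigma K N t θ = ENNReal.ofReal (sn K N (t * θ) / sn K N θ) := by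
  have hN1 : 0 < N - 1 := by linarith
  have hθ2 : 0 < θ ^ 2 := by positivity
  unfold sigma sn
  rcases curvature_cases K with h | ⟨h, h'⟩ | ⟨h, h', h''⟩
  · have hs := sqrt_curvature_pos hN h
    have hlt : K * θ ^ 2 < (N - 1) * Real.pi ^ 2 := by
      have h1 := (lt_div_iff₀ hs).1 (hθ' h)
      have h2 : (θ * Real.sqrt (K / (N - 1))) ^ 2 < Real.pi ^ 2 := by
        have : 0 < θ * Real.sqrt (K / (N - 1)) := by positivity
        gcongr
      rw [mul_pow, Real.sq_sqrt (by positivity)] at h2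
      have h3 : K * θ ^ 2 = (N - 1) * (θ ^ 2 * (K / (N - 1))) := by field_simp
      rw [h3]
      gcongr
    have hpos : 0 < K * θ ^ 2 := by positivity
    simp only [not_le.2 hlt, hpos, h, if_true, if_false]
    rw [div_div_div_cancel_right₀ hs.ne', mul_comm (t * θ), mul_comm θ]
  · simp only [h', lt_irrefl, if_false, if_true, zero_mul]
    have : ¬((N - 1) * Real.pi ^ 2 ≤ 0) := by
      have := Real.pi_pos
      simp only [not_le]; positivity
    rw [if_neg this, mul_div_assoc, div_self hθ.ne', mul_one]
  · have hs := sqrt_curvature_pos hN h''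
    have hneg : K * θ ^ 2 < 0 := mul_neg_of_neg_of_pos (by linarith) hθ2
    have h1 : ¬((N - 1) * Real.pi ^ 2 ≤ K * θ ^ 2) := by
      have : 0 < (N - 1) * Real.pi ^ 2 := by have := Real.pi_pos; positivity
      linarith
    simp only [h1, hneg.not_gt, hneg.ne, h, h', if_false]
    rw [div_div_div_cancel_right₀ hs.ne', mul_comm (t * θ), mul_comm θ]

theorem cotKN_continuousAt (hN : 1 < N) {x : ℝ} (hx : 0 < sn K N x) :
    ContinuousAt (cotKN K N) x := by
  have : cotKN K N = fun x => (N - 1) * (cn K N x / sn K N x) := funext (cotKN_eq hN)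
  rw [this]
  exact continuousAt_const.mul
    (continuous_cn.continuousAt.div (continuous_sn hN).continuousAt hx.ne')

theorem sn_pos_of_mem_Ioo (hN : 1 < N) {D x : ℝ}
    (hD : 0 < K → D ≤ Real.pi / Real.sqrt (K / (N - 1))) (hx : x ∈ Ioo 0 D) : 0 < sn K N x :=
  sn_pos hN hx.1 fun hK => hx.2.trans_le (hD hK)

theorem cotKN_continuousOn (hN : 1 < N) {D : ℝ}
    (hD : 0 < K → D ≤ Real.pi / Real.sqrt (K / (N - 1))) :
    ContinuousOn (cotKN K N) (Ioo 0 D) := fun _ hx =>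
  (cotKN_continuousAt hN (sn_pos_of_mem_Ioo hN hD hx)).continuousWithinAt

theorem cotKN_tendsto_atBot (hN : 1 < N) (hK : 0 < K) :
    Tendsto (cotKN K N) (𝓝[<] (Real.pi / Real.sqrt (K / (N - 1)))) atBot := by
  set D := Real.pi / Real.sqrt (K / (N - 1)) with hDdef
  have hD : 0 < D := div_pos Real.pi_pos (sqrt_curvature_pos hN hK)
  have hsn : Tendsto (sn K N) (𝓝[<] D) (𝓝[>] 0) := by
    refine tendsto_nhdsWithin_iff.2 ⟨?_, ?_⟩
    · have := ((continuous_sn (K := K) hN).tendsto D).mono_left (nhdsWithin_le_nhds (s := Iio D))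
      rwa [hDdef, sn_diameter hN hK] at this
    · filter_upwards [Ioo_mem_nhdsLT hD] with x hx
      exact sn_pos_of_mem_Ioo hN (D := D) (fun _ => le_rfl) hx
  have hcn : Tendsto (cn K N) (𝓝[<] D) (𝓝 (-1)) := by
    have := ((continuous_cn (K := K) (N := N)).tendsto D).mono_left
      (nhdsWithin_le_nhds (s := Iio D))
    rwa [hDdef, cn_diameter hN hK] at this
  have h := (hcn.neg_mul_atTop (by norm_num) hsn.inv_tendsto_nhdsGT_zero).const_mul_atBot
    (by linarith : 0 < N - 1)
  refine h.congr fun x => ?_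
  rw [cotKN_eq hN]
  rfl

/-- The second alternative occurs exactly for `K > 0` and `D = D_{K,N}`; the alternatives match the
two shooting arguments. -/
theorem cotKN_right_end (hN : 1 < N) {D : ℝ} (hD0 : 0 < D)
    (hD : 0 < K → D ≤ Real.pi / Real.sqrt (K / (N - 1))) :
    ContinuousAt (cotKN K N) D ∨ Tendsto (cotKN K N) (𝓝[<] D) atBot := by
  by_cases h : 0 < K ∧ D = Real.pi / Real.sqrt (K / (N - 1))
  · right
    rw [h.2]
    exact cotKN_tendsto_atBot hN h.1
  · left
    refine cotKN_continuousAt hN (sn_pos hN hD0 fun hK => (hD hK).lt_of_ne fun h' => h ⟨hK, h'⟩)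

/-- `sn ^ (N - 1)`, the model density on the right half of the interval. -/
def snPow (K N x : ℝ) : ℝ := sn K N x ^ (N - 1)

theorem snPow_hasDerivAt (hN : 1 < N) {x : ℝ} (hx : 0 < sn K N x) :
    HasDerivAt (snPow K N) (cotKN K N x * snPow K N x) x := by
  have h := (sn_hasDerivAt (K := K) hN x).rpow_const (p := N - 1) (Or.inl hx.ne')
  refine h.congr_deriv ?_
  rw [cotKN_eq hN, snPow, Real.rpow_sub_one hx.ne']
  field_simp

theorem continuous_snPow (hN : 1 < N) : Continuous (snPow K N) :=
  (continuous_sn hN).rpow_const fun _ => Or.inr (by linarith)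

theorem snPow_pos (hN : 1 < N) {D x : ℝ}
    (hD : 0 < K → D ≤ Real.pi / Real.sqrt (K / (N - 1))) (hx : x ∈ Ioo 0 D) : 0 < snPow K N x :=
  Real.rpow_pos_of_pos (sn_pos_of_mem_Ioo hN hD hx) _

theorem snPow_nonneg (hN : 1 < N) {D x : ℝ}
    (hD : 0 < K → D ≤ Real.pi / Real.sqrt (K / (N - 1))) (hx : x ∈ Icc 0 D) : 0 ≤ snPow K N x :=
  Real.rpow_nonneg (sn_nonneg hN hx.1 fun hK => hx.2.trans (hD hK)) _

/-- For non-positive curvature, `sn (r x) / sn x` is non-increasing if `r ∈ [0, 1]`. -/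
theorem sn_mul_le (hN : 1 < N) (hK : K ≤ 0) {r x y : ℝ} (hr : r ∈ Icc (0 : ℝ) 1) (hx : 0 < x)
    (hxy : x ≤ y) : sn K N (r * y) * sn K N x ≤ sn K N (r * x) * sn K N y := by
  rcases eq_or_lt_of_le hK with h0 | hneg
  · subst h0
    simp only [sn, lt_irrefl, if_true, if_false]
    nlinarith
  have hs := sqrt_curvature_pos hN (by linarith : 0 < -K)
  set s := Real.sqrt (-K / (N - 1))
  -- This is the sign of the numerator of the derivative of `sinh (r z) / sinh z`. The difference
  -- vanishes at `0` and has derivative `(r² - 1) sinh (r z) sinh z ≤ 0`.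
  have hdiff : ∀ z, 0 ≤ z → r * Real.cosh (r * z) * Real.sinh z ≤ Real.sinh (r * z) * Real.cosh z := by
    have hd : ∀ z, HasDerivAt (fun z => r * Real.cosh (r * z) * Real.sinh z -
        Real.sinh (r * z) * Real.cosh z) ((r ^ 2 - 1) * (Real.sinh (r * z) * Real.sinh z)) z := by
      intro z
      have h1 : HasDerivAt (fun z => r * z) r z := by simpa using (hasDerivAt_id z).const_mul r
      have h2 := ((h1.cosh.const_mul r).mul (Real.hasDerivAt_sinh z)).sub
        (h1.sinh.mul (Real.hasDerivAt_cosh z))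
      refine h2.congr_deriv ?_
      ring
    have hanti : AntitoneOn (fun z => r * Real.cosh (r * z) * Real.sinh z -
        Real.sinh (r * z) * Real.cosh z) (Ici 0) := by
      refine antitoneOn_of_deriv_nonpos (convex_Ici 0)
        (fun z _ => (hd z).continuousAt.continuousWithinAt)
        (fun z _ => (hd z).differentiableAt.differentiableWithinAt) fun z hz => ?_
      rw [interior_Ici] at hz
      rw [(hd z).deriv]
      have h1 : 0 ≤ Real.sinh z := Real.sinh_nonneg_iff.2 (le_of_lt hz)
      have h2 : 0 ≤ Real.sinh (r * z) := Real.sinh_nonneg_iff.2 (mul_nonneg hr.1 (le_of_lt hz))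
      exact mul_nonpos_of_nonpos_of_nonneg (by nlinarith [hr.1, hr.2]) (by positivity)
    intro z hz
    have := hanti (mem_Ici.2 le_rfl) (mem_Ici.2 hz) hz
    simp at this
    linarith
  have hanti : AntitoneOn (fun z => Real.sinh (r * z) / Real.sinh z) (Ioi 0) := by
    have hd : ∀ z, 0 < z → HasDerivAt (fun z => Real.sinh (r * z) / Real.sinh z)
        ((Real.cosh (r * z) * r * Real.sinh z - Real.sinh (r * z) * Real.cosh z) /
          Real.sinh z ^ 2) z := by
      intro z hz
      have h1 : HasDerivAt (fun z => r * z) r z := by simpa using (hasDerivAt_id z).const_mul r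
      exact h1.sinh.div (Real.hasDerivAt_sinh z) (Real.sinh_pos_iff.2 hz).ne'
    refine antitoneOn_of_deriv_nonpos (convex_Ioi 0)
      (fun z hz => (hd z hz).continuousAt.continuousWithinAt)
      (fun z hz => (hd z (interior_subset hz)).differentiableAt.differentiableWithinAt)
      fun z hz => ?_
    rw [interior_Ioi] at hz
    rw [(hd z hz).deriv]
    refine div_nonpos_of_nonpos_of_nonneg ?_ (by positivity)
    have := hdiff z (le_of_lt hz)
    linarith
  have hsx : 0 < s * x := by positivity
  have hsy : 0 < s * y := mul_pos hs (hx.trans_le hxy)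
  have := hanti (mem_Ioi.2 hsx) (mem_Ioi.2 hsy) (by gcongr)
  beta_reduce at this
  rw [div_le_div_iff₀ (Real.sinh_pos_iff.2 hsy) (Real.sinh_pos_iff.2 hsx)] at this
  simp only [sn, hneg.not_gt, hneg.ne, if_false]
  rw [mul_left_comm s r y, mul_left_comm s r x]
  change Real.sinh (r * (s * y)) / s * (Real.sinh (s * x) / s) ≤
    Real.sinh (r * (s * x)) / s * (Real.sinh (s * y) / s)
  rw [div_mul_div_comm, div_mul_div_comm]
  gcongr

end MCPGap

end

noncomputable section

namespace MCPGap

/-! ### The model problem and its right half -/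

open Set Filter Topology

variable {p K N D lam α : ℝ} {φ : ℝ → ℝ}

theorem drift_exists_isHalfSolution (hp : 1 < p) (hN : 1 < N) (hD0 : 0 < D)
    (hD : 0 < K → D ≤ Real.pi / Real.sqrt (K / (N - 1))) :
    ∃ α φ, IsHalfSolution (cotKN K N) (drift p) (piP p / 2) (D / 2) D α φ := by
  have hpi := piP_pos hp
  obtain ⟨L, hL⟩ := drift_lipschitz hp
  have hcont : ContinuousOn (cotKN K N) (Ico (D / 2) D) :=
    (cotKN_continuousOn hN hD).mono fun x hx => ⟨by linarith [hx.1], hx.2⟩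
  rcases cotKN_right_end hN hD0 hD with h | h
  · refine exists_isHalfSolution_of_continuousOn_Icc (by linarith) hL (drift_bounded hp)
      (fun y hy => drift_of_nonpos hp hy) (fun y hy => drift_of_ge hp hy) (by linarith) ?_
    intro x hx
    rcases eq_or_lt_of_le hx.2 with rfl | hlt
    · exact h.continuousWithinAt
    · exact ((cotKN_continuousOn hN hD).continuousAt
        (Ioo_mem_nhds (by linarith [hx.1]) hlt)).continuousWithinAt
  · exact exists_isHalfSolution_of_tendsto_atBot (by linarith) hL (drift_bounded hp)
      (fun y hy => drift_of_nonpos hp hy) (fun y hy => drift_of_ge hp hy)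
      (fun y hy => drift_pos hp hy) (by linarith) hcont h

/-- The solution is continued oddly about `D/2`: there the coefficient and the nonlinearity both
change sign, so their product is preserved. -/
theorem IsHalfSolution.isModelSolution (hp : 1 < p) (hD0 : 0 < D)
    (h : IsHalfSolution (cotKN K N) (drift p) (piP p / 2) (D / 2) D α φ) :
    IsModelSolution p K N D ((p - 1) * α ^ p)
      (fun x => if D / 2 ≤ x then φ x else -φ (D - x)) := by
  have hp1 : 0 < p - 1 := by linarith
  have hpi := piP_pos hp
  have hα : ((p - 1) * α ^ p / (p - 1)) ^ (1 / p) = α := by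
    rw [mul_div_cancel_left₀ _ hp1.ne', ← Real.rpow_mul h.alpha_pos.le,
      mul_one_div_cancel (by linarith), Real.rpow_one]
  have hmid : D - D / 2 = D / 2 := by ring
  set ψ : ℝ → ℝ := fun x => if D / 2 ≤ x then φ x else -φ (D - x) with hψ
  have hright : ∀ x, D / 2 ≤ x → ψ x = φ x := fun x hx => if_pos hx
  have hleft : ∀ x, x ≤ D / 2 → ψ x = -φ (D - x) := fun x hx => by
    rcases eq_or_lt_of_le hx with rfl | hx
    · rw [hright _ le_rfl, hmid, h.left, neg_zero]
    · exact if_neg (not_le.2 hx)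
  have hrefl : MapsTo (fun x => D - x) (Icc 0 (D / 2)) (Icc (D / 2) D) := fun x hx =>
    ⟨by linarith [hx.2], by linarith [hx.1]⟩
  refine ⟨?_, fun x hx => ?_, ?_, ?_, ?_⟩
  · have h1 : ContinuousOn ψ (Icc 0 (D / 2)) :=
      ((h.continuousOn_Icc.comp (continuousOn_const.sub continuousOn_id) hrefl).neg).congr
        fun x hx => hleft x hx.2
    have h2 : ContinuousOn ψ (Icc (D / 2) D) := h.continuousOn_Icc.congr fun x hx => hright x hx.1
    have := h1.union_of_isClosed h2 isClosed_Icc isClosed_Icc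
    rwa [Icc_union_Icc_eq_Icc (by linarith) (by linarith)] at this
  · rw [hα]
    rcases lt_trichotomy x (D / 2) with hlt | heq | hgt
    · have hDx : D - x ∈ Ioo (D / 2) D := ⟨by linarith, by linarith [hx.1]⟩
      have hm := h.mem _ hDx
      have hd := ((h.toIsFlow.hasDerivAt hDx).comp_const_sub D x).neg
      have hd2 : HasDerivAt ψ (α + cotKN K N (D - x) * drift p (φ (D - x))) x := by
        refine (hd.congr_of_eventuallyEq ?_).congr_deriv (by ring)
        filter_upwards [Iio_mem_nhds hlt] with y hy using hleft y (le_of_lt hy)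
      refine hd2.congr_deriv ?_
      have hn := model_nonlinearity_neg hp (t := φ (D - x)) ⟨by linarith [hm.1], hm.2⟩
      rw [model_nonlinearity_eq hp (Ioo_subset_Icc_self hm)] at hn
      rw [modelT, if_neg (not_le.2 hlt), mul_assoc, hleft x hlt.le, hn]
      field_simp
    -- At the midpoint the coefficient jumps, but `sin_p 0 = 0` removes it, and both one-sided
    -- derivatives equal `α`.
    · subst heq
      rw [hright _ le_rfl, h.left, sinP_zero hp, mul_zero, add_zero]
      have hd := h.deriv (D / 2) ⟨le_rfl, by linarith⟩
      rw [h.left, drift_of_nonpos hp le_rfl, mul_zero, add_zero] at hd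
      have hd1 : HasDerivWithinAt ψ α (Ici (D / 2)) (D / 2) :=
        hd.congr (fun x hx => hright x hx) (hright _ le_rfl)
      have hd2 : HasDerivWithinAt ψ α (Iic (D / 2)) (D / 2) := by
        have hc : HasDerivWithinAt (fun x : ℝ => D - x) (-1) (Iic (D / 2)) (D / 2) :=
          ((hasDerivAt_id (D / 2)).const_sub D).hasDerivWithinAt
        have hd' : HasDerivWithinAt φ α (Ici (D / 2)) (D - D / 2) := by rwa [hmid]
        have := (hd'.comp (D / 2) hc (fun x hx => by
          simp only [mem_Iic] at hx
          simp only [mem_Ici]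
          linarith)).neg
        refine (this.congr (fun x hx => hleft x hx) (hleft _ le_rfl)).congr_deriv (by ring)
      have := hd2.union hd1
      rwa [Iic_union_Ici, hasDerivWithinAt_univ] at this
    · have hxI : x ∈ Ioo (D / 2) D := ⟨hgt, hx.2⟩
      have hm := h.mem _ hxI
      have hd := h.toIsFlow.hasDerivAt hxI
      refine (hd.congr_of_eventuallyEq ?_).congr_deriv ?_
      · filter_upwards [Ioi_mem_nhds hgt] with y hy using hright y (le_of_lt hy)
      · rw [modelT, if_pos hgt.le, mul_assoc, hright x hgt.le,
          model_nonlinearity_eq hp (Ioo_subset_Icc_self hm)]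
        field_simp
  · rw [hleft 0 (by linarith), sub_zero, h.right]
  · rw [hright _ le_rfl, h.left]
  · rw [hright D (by linarith), h.right]

namespace IsModelSolution

theorem deriv_right (h : IsModelSolution p K N D lam φ) (hD0 : 0 < D) {x : ℝ}
    (hx : x ∈ Ico (D / 2) D) :
    HasDerivAt φ ((lam / (p - 1)) ^ (1 / p) + 1 / (p - 1) * cotKN K N x *
      (|cosP p (φ x)| ^ (p - 2) * cosP p (φ x)) * sinP p (φ x)) x := by
  have := h.hasDerivAt x ⟨by linarith [hx.1], hx.2⟩
  rwa [modelT, if_pos hx.1] at this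

theorem deriv_right_of_mem (hp : 1 < p) (h : IsModelSolution p K N D lam φ) (hD0 : 0 < D) {x : ℝ}
    (hx : x ∈ Ico (D / 2) D) (hφ : φ x ∈ Icc 0 (piP p / 2)) :
    HasDerivAt φ ((lam / (p - 1)) ^ (1 / p) + cotKN K N x * drift p (φ x)) x := by
  have hp1 : 0 < p - 1 := by linarith
  refine (h.deriv_right hD0 hx).congr_deriv ?_
  rw [mul_assoc, model_nonlinearity_eq hp hφ]
  field_simp

/-- After its last time at or below `0` on the right half, the solution stays briefly in `[0,
π_p/2)` and follows the flow of speed `0` from `0`. Uniqueness makes it vanish there, a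
contradiction. -/
theorem lam_ne_zero (hp : 1 < p) (hN : 1 < N) (hD0 : 0 < D)
    (hD : 0 < K → D ≤ Real.pi / Real.sqrt (K / (N - 1)))
    (h : IsModelSolution p K N D lam φ) : lam ≠ 0 := by
  rintro rfl
  have hpi := piP_pos hp
  have hα : ((0 : ℝ) / (p - 1)) ^ (1 / p) = 0 := by
    rw [zero_div, Real.zero_rpow (by positivity)]
  have hcont : ContinuousOn φ (Icc (D / 2) D) := h.continuousOn.mono (Icc_subset_Icc_left (by linarith))
  set Z := Icc (D / 2) D ∩ φ ⁻¹' Iic 0 with hZ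
  have hZc : IsCompact Z := isCompact_Icc.of_isClosed_subset
    (hcont.preimage_isClosed_of_isClosed isClosed_Icc isClosed_Iic) inter_subset_left
  have hZne : Z.Nonempty := ⟨D / 2, ⟨le_rfl, by linarith⟩, h.mid.le⟩
  have hx₁ := hZc.sSup_mem hZne
  set x₁ := sSup Z with hx₁def
  have hpos : ∀ x ∈ Ioc x₁ D, 0 < φ x := fun x hx => by
    by_contra! hneg
    exact absurd (le_csSup hZc.bddAbove ⟨⟨hx₁.1.1.trans hx.1.le, hx.2⟩, hneg⟩) (not_le.2 hx.1)
  have hx₁D : x₁ < D := hx₁.1.2.lt_of_ne fun heq => by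
    have := hx₁.2
    rw [heq] at this
    simp only [mem_preimage, h.right, mem_Iic] at this
    linarith
  have hcx : ContinuousAt φ x₁ := (h.deriv_right hD0 ⟨hx₁.1.1, hx₁D⟩).continuousAt
  have hx₁0 : φ x₁ = 0 := by
    refine le_antisymm hx₁.2 (ge_of_tendsto (hcx.tendsto.mono_left
      (nhdsWithin_le_nhds (s := Ioi x₁))) ?_)
    filter_upwards [Ioo_mem_nhdsGT hx₁D] with x hx using (hpos x (Ioo_subset_Ioc_self hx)).le
  have hev : ∀ᶠ x in 𝓝 x₁, φ x < piP p / 2 := hcx.eventually_lt_const (by linarith)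
  obtain ⟨d, hd, hdsub⟩ := (mem_nhdsGE_iff_exists_Ico_subset' hx₁D).1
    (mem_nhdsWithin_of_mem_nhds hev)
  have hd' : x₁ < min d D := lt_min hd hx₁D
  have hflow : IsFlow (fun x => cotKN K N (max x (D / 2))) (fun y => drift p y) x₁ (min d D) 0
      φ := by
    refine ⟨hx₁0, fun x hx => ?_⟩
    have hxD : x < D := hx.2.trans_le (min_le_right _ _)
    have hxm : x ∈ Ico (D / 2) D := ⟨hx₁.1.1.trans hx.1, hxD⟩
    have hφ0 : 0 ≤ φ x := by
      rcases eq_or_lt_of_le hx.1 with heq | hlt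
      · rw [← heq, hx₁0]
      · exact (hpos x ⟨hlt, hxD.le⟩).le
    have := h.deriv_right_of_mem hp hD0 hxm ⟨hφ0, (hdsub ⟨hx.1, hx.2.trans_le (min_le_left _ _)⟩).le⟩
    rw [hα] at this
    rw [max_eq_left hxm.1]
    exact this.hasDerivWithinAt
  obtain ⟨L, hL⟩ := drift_lipschitz hp
  have hz := IsFlow.eqOn_zero (c := fun x => cotKN K N (max x (D / 2))) (b := min d D) (a := x₁)
    (by
      refine (cotKN_continuousOn hN hD).comp (by fun_prop) fun x hx => ⟨?_, ?_⟩
      · exact lt_max_of_lt_right (by linarith)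
      · exact max_lt (hx.2.trans_le (min_le_right _ _)) (by linarith)) hL
    (fun y hy => drift_of_nonpos hp hy) hflow
  have hm : (x₁ + min d D) / 2 ∈ Ico x₁ (min d D) := ⟨by linarith, by linarith⟩
  have := hz hm
  have h2 := hpos ((x₁ + min d D) / 2) ⟨by linarith, by linarith [hm.2, min_le_right d D]⟩
  simp only [Pi.zero_apply] at this
  linarith

/-- The model equation carries the periodic, unclamped nonlinearity, so the point is that `φ`
remains in `[0, π_p/2]` on the right half. Both levels can only be crossed upwards, since the
nonlinearity vanishes on them and `α > 0`. A solution that has passed `π_p/2` would have to come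
back down to it at `D`, but it is strictly increasing close to `D`. -/
theorem isHalfSolution (hp : 1 < p) (hN : 1 < N) (hD0 : 0 < D)
    (hD : 0 < K → D ≤ Real.pi / Real.sqrt (K / (N - 1))) (hlam : 0 ≤ lam)
    (h : IsModelSolution p K N D lam φ) :
    IsHalfSolution (cotKN K N) (drift p) (piP p / 2) (D / 2) D ((lam / (p - 1)) ^ (1 / p)) φ := by
  have hp1 : 0 < p - 1 := by linarith
  have hpi := piP_pos hp
  have hlam' : 0 < lam := hlam.lt_of_ne (h.lam_ne_zero hp hN hD0 hD).symm
  have hα : 0 < (lam / (p - 1)) ^ (1 / p) := by positivity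
  set α := (lam / (p - 1)) ^ (1 / p) with hαdef
  have hcont : ContinuousOn φ (Icc (D / 2) D) :=
    h.continuousOn.mono (Icc_subset_Icc_left (by linarith))
  have hnonneg : ∀ x ∈ Ico (D / 2) D, 0 ≤ φ x := fun x hx => by
    have hsub : Icc (D / 2) x ⊆ Icc (D / 2) D := Icc_subset_Icc_right hx.2.le
    refine image_le_of_deriv_right_lt_deriv_boundary' (f := fun _ => 0)
      (f' := fun _ => 0) (B := φ) (a := D / 2) (b := x)
      (by fun_prop) (fun z _ => hasDerivWithinAt_const _ _ _) h.mid.ge (hcont.mono hsub)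
      (fun z hz => (h.deriv_right hD0 ⟨hz.1, hz.2.trans hx.2⟩).hasDerivWithinAt)
      (fun z hz hz' => ?_) ⟨hx.1, le_rfl⟩
    rw [← hz', sinP_zero hp]
    linarith
  have hle : ∀ x ∈ Ico (D / 2) D, φ x ≤ piP p / 2 := fun x hx => by
    by_contra! hgt
    have hge : ∀ y ∈ Ico x D, piP p / 2 ≤ φ y := fun y hy => by
      refine image_le_of_deriv_right_lt_deriv_boundary' (f := fun _ => piP p / 2)
        (f' := fun _ => 0) (B := φ) (a := x) (b := y)
        (by fun_prop) (fun z _ => hasDerivWithinAt_const _ _ _) hgt.le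
        (hcont.mono (Icc_subset_Icc hx.1 hy.2.le))
        (fun z hz => (h.deriv_right hD0
          ⟨hx.1.trans hz.1, hz.2.trans hy.2⟩).hasDerivWithinAt)
        (fun z hz hz' => ?_) ⟨hy.1, le_rfl⟩
      rw [← hz', cosP_piP_half hp]
      simpa only [mul_zero, zero_mul, add_zero] using hα
    have hcD : Tendsto φ (𝓝[<] D) (𝓝 (piP p / 2)) := by
      rw [← h.right]
      exact ((hcont D ⟨by linarith, le_rfl⟩).mono_of_mem_nhdsWithin
        (mem_of_superset (Ioo_mem_nhdsLT (by linarith : D / 2 < D)) Ioo_subset_Icc_self))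
    -- Beyond `π_p/2` the nonlinearity is non-positive, so only an upper bound on the coefficient
    -- matters; a limit `-∞` does no harm.
    obtain ⟨M, hM0, hM⟩ : ∃ M : ℝ, 0 < M ∧ ∀ᶠ y in 𝓝[<] D, cotKN K N y ≤ M := by
      rcases cotKN_right_end hN hD0 hD with hc | hc
      · refine ⟨|cotKN K N D| + 1, by positivity, ?_⟩
        exact ((hc.eventually_lt_const (lt_of_le_of_lt (le_abs_self _) (lt_add_one _))).filter_mono
          nhdsWithin_le_nhds).mono fun _ hy => hy.le
      · exact ⟨1, one_pos, hc.eventually_le_atBot 1⟩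
    obtain ⟨L, hL⟩ := drift_lipschitz hp
    have hdr : ∀ᶠ y in 𝓝[<] D, M * drift p (piP p - φ y) < α := by
      have h1 : Tendsto (fun y => M * drift p (piP p - φ y)) (𝓝[<] D)
          (𝓝 (M * drift p (piP p - piP p / 2))) :=
        ((hL.continuous.tendsto _).comp (hcD.const_sub (piP p))).const_mul M
      rw [sub_half, drift_of_ge hp le_rfl, mul_zero] at h1
      exact h1.eventually_lt_const hα
    have hlt2 : ∀ᶠ y in 𝓝[<] D, φ y < piP p := hcD.eventually_lt_const (by linarith)
    obtain ⟨d, hd, hdsub⟩ := (mem_nhdsLT_iff_exists_Ioo_subset' hx.2).1 (hM.and (hdr.and hlt2))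
    have hderiv : ∀ y ∈ Ioo (max d x) D, 0 < deriv φ y := fun y hy => by
      obtain ⟨e1, e2, e3⟩ := hdsub ⟨(le_max_left _ _).trans_lt hy.1, hy.2⟩
      have hyx : x < y := (le_max_right _ _).trans_lt hy.1
      rw [(h.deriv_right hD0 ⟨hx.1.trans hyx.le, hy.2⟩).deriv, mul_assoc,
        model_nonlinearity_reflect hp ⟨hge y ⟨hyx.le, hy.2⟩, e3.le⟩]
      have e4 := drift_nonneg hp (piP p - φ y)
      have e5 : 1 / (p - 1) * cotKN K N y * -((p - 1) * drift p (piP p - φ y)) =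
          -(cotKN K N y * drift p (piP p - φ y)) := by field_simp
      rw [e5]
      have e6 : cotKN K N y * drift p (piP p - φ y) ≤ M * drift p (piP p - φ y) := by gcongr
      linarith [show M * drift p (piP p - φ y) < α from e2]
    have hm1 : max d x < D := max_lt hd hx.2
    have hm0 : D / 2 ≤ max d x := hx.1.trans (le_max_right _ _)
    have hmono : StrictMonoOn φ (Icc (max d x) D) := by
      refine strictMonoOn_of_deriv_pos (convex_Icc _ _) (hcont.mono (Icc_subset_Icc_left hm0)) ?_
      rw [interior_Icc]
      exact hderiv
    have h1 := hmono ⟨le_rfl, hm1.le⟩ ⟨hm1.le, le_rfl⟩ hm1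
    have h2 := hge (max d x) ⟨le_max_right _ _, hm1⟩
    rw [h.right] at h1
    linarith
  have hflow : IsFlow (cotKN K N) (drift p) (D / 2) D α φ := ⟨h.mid, fun x hx =>
    (h.deriv_right_of_mem hp hD0 hx ⟨hnonneg x hx, hle x hx⟩).hasDerivWithinAt⟩
  exact ⟨hflow, hα, hcont, h.right, fun x hx => ⟨hflow.pos (fun y hy => drift_of_nonpos hp hy) hα hx,
    hflow.lt_of_le (fun y hy => drift_of_ge hp hy) hα
      (fun y hy => hle y (Ioo_subset_Ico_self hy)) hx⟩⟩

end IsModelSolution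

theorem modelParameters_nonempty (hp : 1 < p) (hN : 1 < N) (hD0 : 0 < D)
    (hD : 0 < K → D ≤ Real.pi / Real.sqrt (K / (N - 1))) : (modelParameters p K N D).Nonempty := by
  obtain ⟨α, φ, h⟩ := drift_exists_isHalfSolution hp hN hD0 hD
  exact ⟨(p - 1) * α ^ p, mul_nonneg (by linarith) (Real.rpow_nonneg h.alpha_pos.le _),
    _, h.isModelSolution hp hD0⟩

/-- Every model parameter has the form `(p - 1) α ^ p`, with `α` the speed of a half solution. -/
theorem exists_isHalfSolution_of_mem_modelParameters (hp : 1 < p) (hN : 1 < N) (hD0 : 0 < D)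
    (hD : 0 < K → D ≤ Real.pi / Real.sqrt (K / (N - 1))) (h : lam ∈ modelParameters p K N D) :
    ∃ α φ, lam = (p - 1) * α ^ p ∧
      IsHalfSolution (cotKN K N) (drift p) (piP p / 2) (D / 2) D α φ := by
  obtain ⟨hlam, φ, hφ⟩ := h
  have hp1 : 0 < p - 1 := by linarith
  refine ⟨_, φ, ?_, hφ.isHalfSolution hp hN hD0 hD hlam⟩
  rw [← Real.rpow_mul (by positivity), one_div_mul_cancel (by linarith), Real.rpow_one]
  field_simp

end MCPGap

end

noncomputable section

namespace MCPGap

/-! ### Riccati equation and Picone inequality -/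

open Set Filter Topology

variable {p K N D lam α : ℝ} {φ : ℝ → ℝ}

theorem abs_abs_rpow_mul_self {p : ℝ} (hp : 1 < p) (x : ℝ) :
    |(|x| ^ (p - 2) * x)| = |x| ^ (p - 1) := by
  rcases eq_or_ne x 0 with rfl | hx
  · rw [mul_zero, abs_zero, Real.zero_rpow (by linarith)]
  · have := abs_pos.2 hx
    rw [abs_mul, abs_of_nonneg (by positivity), ← Real.rpow_add_one this.ne']
    congr 1; ring

theorem abs_rpow_mul_self_mul_self {p : ℝ} (hp : 1 < p) (x : ℝ) :
    |x| ^ (p - 2) * x * x = |x| ^ p := by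
  rcases eq_or_ne x 0 with rfl | hx
  · rw [mul_zero, abs_zero, Real.zero_rpow (by linarith)]
  · have := abs_pos.2 hx
    rw [mul_assoc, ← sq, ← sq_abs, ← Real.rpow_two, ← Real.rpow_add this]
    congr 1; ring

/-- Young's inequality, in the form of the convexity of `|·|^p`. -/
theorem mul_abs_rpow_le {p : ℝ} (hp : 1 < p) (x y : ℝ) :
    p * (|y| ^ (p - 2) * y * x) ≤ |x| ^ p + (p - 1) * |y| ^ p := by
  have hp0 : 0 < p := by linarith
  have hp1 : 0 < p - 1 := by linarith
  have h := Real.young_inequality x (|y| ^ (p - 2) * y) (Real.HolderConjugate.conjExponent hp)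
  rw [abs_abs_rpow_mul_self hp, ← Real.rpow_mul (abs_nonneg y), Real.conjExponent,
    mul_div_cancel₀ _ hp1.ne'] at h
  have h2 := mul_le_mul_of_nonneg_left h hp0.le
  calc p * (|y| ^ (p - 2) * y * x) = p * (x * (|y| ^ (p - 2) * y)) := by ring
    _ ≤ _ := h2
    _ = _ := by field_simp

/-- The logarithmic derivative `u' / u` of the eigenfunction associated with a half solution. -/
def logDerivHalf (p α : ℝ) (φ : ℝ → ℝ) (x : ℝ) : ℝ :=
  α * cosPBase p (φ x) / sinP p (φ x)

namespace IsHalfSolution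

variable {c : ℝ → ℝ} {a b : ℝ}

theorem mem_Ioo_symm (hp : 1 < p) (h : IsHalfSolution c (drift p) (piP p / 2) a b α φ) {x : ℝ}
    (hx : x ∈ Ioo a b) : φ x ∈ Ioo (-(piP p / 2)) (piP p / 2) :=
  ⟨by linarith [piP_pos hp, (h.mem x hx).1], (h.mem x hx).2⟩

theorem sinP_pos (hp : 1 < p) (h : IsHalfSolution c (drift p) (piP p / 2) a b α φ) {x : ℝ}
    (hx : x ∈ Ioo a b) : 0 < sinP p (φ x) :=
  MCPGap.sinP_pos hp (Ioo_subset_Ioc_self (h.mem x hx))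

theorem logDerivHalf_pos (hp : 1 < p) (h : IsHalfSolution c (drift p) (piP p / 2) a b α φ) {x : ℝ}
    (hx : x ∈ Ioo a b) : 0 < logDerivHalf p α φ x :=
  div_pos (mul_pos h.alpha_pos (cosPBase_pos hp (h.mem_Ioo_symm hp hx))) (h.sinP_pos hp hx)

/-- The Riccati equation satisfied by `(u' / u) ^ (p - 1)`. -/
theorem hasDerivAt_logDerivHalf_rpow (hp : 1 < p)
    (h : IsHalfSolution c (drift p) (piP p / 2) a b α φ) {x : ℝ} (hx : x ∈ Ioo a b) :
    HasDerivAt (fun y => logDerivHalf p α φ y ^ (p - 1))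
      (-((p - 1) * α ^ p) - (p - 1) * logDerivHalf p α φ x ^ p -
        c x * logDerivHalf p α φ x ^ (p - 1)) x := by
  have hp1 : 0 < p - 1 := by linarith
  have hα := h.alpha_pos
  have hm := h.mem_Ioo_symm hp hx
  have hS := h.sinP_pos hp hx
  have hC := cosPBase_pos hp hm
  have hφ := h.toIsFlow.hasDerivAt hx
  rw [drift_eq (Ioo_subset_Icc_self (h.mem x hx))] at hφ
  have h1 := (hasDerivAt_cosPBase_rpow hp hm).comp x hφ
  have h2 := ((sinP_hasDerivAt hp hm).rpow_const (p := p - 1) (Or.inl hS.ne')).comp x hφ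
  have h3 := (h1.div h2 (by simp only [Function.comp]; positivity)).const_mul (α ^ (p - 1))
  have hid := cosPBase_rpow hp (Ioo_subset_Icc_self hm)
  rw [abs_of_pos hS] at hid
  refine (h3.congr_of_eventuallyEq ?_).congr_deriv ?_
  · filter_upwards [Ioo_mem_nhds hx.1 hx.2] with y hy
    have hS' := h.sinP_pos hp hy
    have hC' := cosPBase_pos hp (h.mem_Ioo_symm hp hy)
    simp only [logDerivHalf, Pi.div_apply, Function.comp]
    rw [Real.div_rpow (by positivity) hS'.le, Real.mul_rpow hα.le hC'.le, mul_div_assoc]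
  · simp only [Function.comp, logDerivHalf]
    rw [Real.div_rpow (by positivity) hS.le, Real.mul_rpow hα.le hC.le,
      Real.div_rpow (by positivity) hS.le, Real.mul_rpow hα.le hC.le, abs_of_pos hS]
    generalize sinP p (φ x) = S at *
    generalize cosPBase p (φ x) = C at *
    have e1 : S ^ (p - 1) = S ^ (p - 2) * S := by
      rw [← Real.rpow_add_one hS.ne']; congr 1; ring
    have e2 : S ^ p = S ^ (p - 2) * S * S := by
      rw [← Real.rpow_add_one hS.ne', ← Real.rpow_add_one hS.ne']; congr 1; ring
    have e3 : C ^ p = C ^ (p - 1) * C := by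
      rw [← Real.rpow_add_one hC.ne']; congr 1; ring
    have e4 : α ^ p = α ^ (p - 1) * α := by
      rw [← Real.rpow_add_one hα.ne']; congr 1; ring
    have e5 : p - 1 - 1 = p - 2 := by ring
    have hX : 0 < S ^ (p - 2) := by positivity
    rw [e5, e1, e2, e3, e4]
    rw [e2, e3] at hid
    generalize S ^ (p - 2) = X at *
    generalize C ^ (p - 1) = Y at *
    generalize α ^ (p - 1) = Z at *
    field_simp
    -- What remains is a multiple of `cos_p^p + sin_p^p = 1`, the content of `hid`.
    linear_combination (-(Z * S * c x * Y)) * hid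

/-- The eigenfunction vanishes at most linearly at the left end. -/
theorem eventually_logDerivHalf_mul_le (hp : 1 < p)
    (h : IsHalfSolution c (drift p) (piP p / 2) a b α φ) (hab : a < b) :
    ∀ᶠ x in 𝓝[>] a, logDerivHalf p α φ x * (x - a) ≤ 2 := by
  have hα := h.alpha_pos
  have hpi := piP_pos hp
  have hd := h.deriv a ⟨le_rfl, hab⟩
  rw [h.left, drift_of_nonpos hp le_rfl, mul_zero, add_zero] at hd
  have hs : HasDerivAt (sinP p) 1 (φ a) := by
    rw [h.left, ← cosPBase_zero hp]
    exact sinP_hasDerivAt hp ⟨by linarith, by linarith⟩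
  have hcomp := (hs.comp_hasDerivWithinAt a hd).mono Ioi_subset_Ici_self
  rw [hasDerivWithinAt_iff_tendsto_slope' (by simp), one_mul] at hcomp
  -- The slope of `sin_p φ` at `a` is `α`, so eventually `sin_p φ > (α/2)(x - a)`. Halving the slope
  -- is the origin of the constant `2`.
  have hev := hcomp.eventually_const_lt (half_lt_self hα)
  filter_upwards [hev, Ioo_mem_nhdsGT hab] with x hx hxab
  have hxa : 0 < x - a := by linarith [hxab.1]
  rw [slope_def_field, Function.comp, Function.comp, h.left, sinP_zero hp, sub_zero,
    lt_div_iff₀ hxa] at hx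
  have hS := h.sinP_pos hp hxab
  have hC := cosPBase_le_one hp (Ioo_subset_Icc_self (h.mem_Ioo_symm hp hxab))
  rw [logDerivHalf, div_mul_eq_mul_div, div_le_iff₀ hS]
  have : α * cosPBase p (φ x) * (x - a) ≤ α * 1 * (x - a) := by gcongr
  linarith

variable {m v : ℝ → ℝ} {Lv : NNReal}

theorem continuousOn_logDerivHalf (hp : 1 < p)
    (h : IsHalfSolution c (drift p) (piP p / 2) a b α φ) :
    ContinuousOn (logDerivHalf p α φ) (Ioo a b) := by
  have hφ : ContinuousOn φ (Ioo a b) := h.continuousOn_Icc.mono Ioo_subset_Icc_self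
  have hmaps : MapsTo φ (Ioo a b) (Icc (-(piP p / 2)) (piP p / 2)) := fun x hx =>
    Ioo_subset_Icc_self (h.mem_Ioo_symm hp hx)
  exact (continuousOn_const.mul ((cosPBase_continuousOn hp).comp hφ hmaps)).div
    ((sinP_continuousOn hp).comp hφ hmaps) fun x hx => (h.sinP_pos hp hx).ne'

end IsHalfSolution

theorem abs_deriv_le_of_lipschitzWith {v : ℝ → ℝ} {Lv : NNReal} (hv : LipschitzWith Lv v) (x : ℝ) :
    |deriv v x| ≤ Lv :=
  norm_deriv_le_of_lipschitz hv

/-- For `p > 1` the function `|·|^p` is `C¹`, hence Lipschitz on bounded sets. This makes `|v|^p`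
absolutely continuous. -/
theorem LipschitzWith.exists_lipschitzOnWith_abs_rpow {p : ℝ} (hp : 1 < p) {v : ℝ → ℝ}
    {Lv : NNReal} (hv : LipschitzWith Lv v) (a b : ℝ) :
    ∃ C, LipschitzOnWith C (fun x => |v x| ^ p) (Icc a b) := by
  have hcomp : IsCompact (v '' Icc a b) := isCompact_Icc.image hv.continuous
  obtain ⟨R, hR⟩ := hcomp.isBounded.subset_closedBall 0
  have hcd : ContDiff ℝ 1 fun x : ℝ => ‖x‖ ^ p := contDiff_norm_rpow hp
  obtain ⟨C, hC⟩ := (hcd.contDiffOn (s := Metric.closedBall 0 R)).exists_lipschitzOnWith one_ne_zero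
    (convex_closedBall 0 R) (isCompact_closedBall 0 R)
  exact ⟨C * Lv, hC.comp hv.lipschitzOnWith fun x hx => hR (mem_image_of_mem v hx)⟩

/-- The energy density minus `lam` times the mass density, with respect to the weight `m`. -/
def energyGap (p lam : ℝ) (m v : ℝ → ℝ) (x : ℝ) : ℝ :=
  (|deriv v x| ^ p - lam * |v x| ^ p) * m x

theorem intervalIntegrable_energyGap {p lam : ℝ} (hp : 1 < p) {m v : ℝ → ℝ} {Lv : NNReal}
    (hm : Continuous m) (hv : LipschitzWith Lv v) (a b : ℝ) :
    IntervalIntegrable (energyGap p lam m v) volume a b := by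
  have hp0 : 0 < p := by linarith
  have h1 : IntervalIntegrable (fun x => |deriv v x| ^ p) volume a b := by
    refine (intervalIntegrable_const (c := (Lv : ℝ) ^ p)).mono_fun
      ((measurable_deriv v).abs.pow_const p).aestronglyMeasurable (Eventually.of_forall fun x => ?_)
    beta_reduce
    rw [Real.norm_of_nonneg (by positivity), Real.norm_of_nonneg (by positivity)]
    exact Real.rpow_le_rpow (abs_nonneg _) (abs_deriv_le_of_lipschitzWith hv x) hp0.le
  have h2 : IntervalIntegrable (fun x => lam * |v x| ^ p) volume a b := by
    have : Continuous fun x => lam * |v x| ^ p :=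
      continuous_const.mul (hv.continuous.abs.rpow_const fun _ => Or.inr hp0.le)
    exact this.intervalIntegrable _ _
  exact (h1.sub h2).mul_continuousOn hm.continuousOn

namespace IsHalfSolution

variable {c : ℝ → ℝ} {a b : ℝ} {m v : ℝ → ℝ} {Lv : NNReal}

/-- Picone's inequality on a compact subinterval. -/
theorem picone (hp : 1 < p) (h : IsHalfSolution c (drift p) (piP p / 2) a b α φ)
    (hm : Continuous m) (hmpos : ∀ x ∈ Ioo a b, 0 < m x)
    (hmd : ∀ x ∈ Ioo a b, HasDerivAt m (c x * m x) x) (hv : LipschitzWith Lv v) {x y : ℝ}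
    (hx : a < x) (hxy : x ≤ y) (hy : y < b) :
    logDerivHalf p α φ y ^ (p - 1) * m y * |v y| ^ p -
      logDerivHalf p α φ x ^ (p - 1) * m x * |v x| ^ p ≤
      ∫ z in x..y, energyGap p ((p - 1) * α ^ p) m v z := by
  have hp1 : 0 < p - 1 := by linarith
  have hsub : Icc x y ⊆ Ioo a b := fun z hz => ⟨hx.trans_le hz.1, hz.2.trans_lt hy⟩
  -- In the derivative of `w` the term `c` of the Riccati equation cancels against `m' = c m`. The
  -- inequality is then `(w |v|^p)' ≤ energyGap` almost everywhere, integrated by the fundamental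
  -- theorem for absolutely continuous functions, since `v` is only Lipschitz.
  set w := fun z => logDerivHalf p α φ z ^ (p - 1) * m z with hw
  have hwd : ∀ z ∈ Ioo a b, HasDerivAt w
      (-((p - 1) * α ^ p + (p - 1) * logDerivHalf p α φ z ^ p) * m z) z := fun z hz =>
    ((h.hasDerivAt_logDerivHalf_rpow hp hz).mul (hmd z hz)).congr_deriv (by ring)
  have hwAC : AbsolutelyContinuousOnInterval w x y := by
    have hcont : ContinuousOn
        (fun z => -((p - 1) * α ^ p + (p - 1) * logDerivHalf p α φ z ^ p) * m z) (Icc x y) := by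
      have := (h.continuousOn_logDerivHalf hp).mono hsub
      exact ((continuousOn_const.add (continuousOn_const.mul
        (this.rpow_const fun _ _ => Or.inr (by linarith)))).neg).mul hm.continuousOn
    obtain ⟨C, hC⟩ := isCompact_Icc.exists_bound_of_continuousOn hcont
    have hL : LipschitzOnWith C.toNNReal w (Icc x y) := by
      refine (convex_Icc x y).lipschitzOnWith_of_nnnorm_hasDerivWithin_le
        (fun z hz => (hwd z (hsub hz)).hasDerivWithinAt) fun z hz => ?_
      rw [← NNReal.coe_le_coe, coe_nnnorm]
      exact (hC z hz).trans (Real.le_coe_toNNReal C)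
    exact LipschitzOnWith.absolutelyContinuousOnInterval (by rwa [uIcc_of_le hxy])
  have hvAC : AbsolutelyContinuousOnInterval (fun z => |v z| ^ p) x y := by
    obtain ⟨C, hC⟩ := LipschitzWith.exists_lipschitzOnWith_abs_rpow hp hv x y
    exact LipschitzOnWith.absolutelyContinuousOnInterval (by rwa [uIcc_of_le hxy])
  have hAC : AbsolutelyContinuousOnInterval (fun z => w z * |v z| ^ p) x y := hwAC.mul hvAC
  have hFTC := hAC.integral_deriv_eq_sub
  rw [← hFTC]
  refine intervalIntegral.integral_mono_ae_restrict hxy hAC.intervalIntegrable_deriv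
    (intervalIntegrable_energyGap hp hm hv x y) ?_
  filter_upwards [ae_restrict_mem measurableSet_Icc,
    ae_restrict_of_ae hv.ae_differentiableAt_real] with z hz hvz
  have hzI := hsub hz
  have hd := (hwd z hzI).mul ((hasDerivAt_abs_rpow (v z) hp).comp z hvz.hasDerivAt)
  have hd' : deriv (fun z => w z * |v z| ^ p) z = _ := hd.deriv
  rw [hd']
  have hq := h.logDerivHalf_pos hp hzI
  -- Young's inequality is applied at `q v`, where `q = u'/u`; equality holds for `v = u`.
  have hy := mul_abs_rpow_le hp (deriv v z) (logDerivHalf p α φ z * v z)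
  rw [abs_mul, abs_of_pos hq, Real.mul_rpow hq.le (abs_nonneg _),
    Real.mul_rpow hq.le (abs_nonneg _)] at hy
  simp only [energyGap, hw, Function.comp]
  generalize deriv v z = v' at *
  generalize logDerivHalf p α φ z = q at *
  have e1 : q ^ (p - 1) = q ^ (p - 2) * q := by
    rw [← Real.rpow_add_one hq.ne']; congr 1; ring
  rw [e1]
  have hmz := hmpos z hzI
  have := mul_le_mul_of_nonneg_right hy hmz.le
  linarith

/-- The half-interval spectral gap inequality for the model weight. -/
theorem integral_energyGap_nonneg (hp : 1 < p)
    (h : IsHalfSolution c (drift p) (piP p / 2) a b α φ) (hab : a < b)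
    (hm : Continuous m) (hmpos : ∀ x ∈ Ioo a b, 0 < m x)
    (hmd : ∀ x ∈ Ioo a b, HasDerivAt m (c x * m x) x) (hv : LipschitzWith Lv v) (hva : v a = 0)
    {y : ℝ} (hy : y ∈ Icc a b) :
    0 ≤ ∫ z in a..y, energyGap p ((p - 1) * α ^ p) m v z := by
  have hp1 : 0 < p - 1 := by linarith
  have hint := intervalIntegrable_energyGap (lam := (p - 1) * α ^ p) hp hm hv
  have key : ∀ y ∈ Ioo a b, 0 ≤ ∫ z in a..y, energyGap p ((p - 1) * α ^ p) m v z := by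
    intro y hy
    have hlim1 : Tendsto (fun x => ∫ z in x..y, energyGap p ((p - 1) * α ^ p) m v z) (𝓝[>] a)
        (𝓝 (∫ z in a..y, energyGap p ((p - 1) * α ^ p) m v z)) := by
      have hc := (intervalIntegral.continuous_primitive hint y).neg
      have := (hc.tendsto a).mono_left (nhdsWithin_le_nhds (s := Ioi a))
      simpa only [Pi.neg_def, ← intervalIntegral.integral_symm] using this
    -- The boundary term at `y` is non-negative and is dropped. The one at `x` is at most `(q
    -- |v|)^(p-1) |v| m`, where `q |v| ≤ 2 Lv` because `|v x| ≤ Lv (x - a)`; it vanishes in the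
    -- limit since `v a = 0`.
    have hlim2 : Tendsto (fun x => -(2 * Lv : ℝ) ^ (p - 1) * |v x| * m x) (𝓝[>] a) (𝓝 0) := by
      have hc : Continuous fun x => -(2 * Lv : ℝ) ^ (p - 1) * |v x| * m x :=
        (continuous_const.mul hv.continuous.abs).mul hm
      have := (hc.tendsto a).mono_left (nhdsWithin_le_nhds (s := Ioi a))
      simpa [hva] using this
    refine le_of_tendsto_of_tendsto hlim2 hlim1 ?_
    filter_upwards [h.eventually_logDerivHalf_mul_le hp hab, Ioo_mem_nhdsGT hy.1] with x hx hxI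
    have hxI' : x ∈ Ioo a b := ⟨hxI.1, hxI.2.trans hy.2⟩
    refine le_trans ?_ (h.picone hp hm hmpos hmd hv hxI.1 hxI.2.le hy.2)
    have hqy := h.logDerivHalf_pos hp hy
    have hqx := h.logDerivHalf_pos hp hxI'
    have hmy := hmpos y hy
    have hmx := hmpos x hxI'
    have h1 : 0 ≤ logDerivHalf p α φ y ^ (p - 1) * m y * |v y| ^ p := by positivity
    have h2 : |v x| ≤ Lv * (x - a) := by
      have := hv.dist_le_mul x a
      rwa [hva, Real.dist_eq, Real.dist_eq, sub_zero,
        abs_of_pos (by linarith [hxI.1] : 0 < x - a)] at this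
    have h3 : logDerivHalf p α φ x * |v x| ≤ 2 * Lv := by
      have : 0 ≤ (Lv : ℝ) := Lv.2
      calc logDerivHalf p α φ x * |v x| ≤ logDerivHalf p α φ x * (Lv * (x - a)) := by gcongr
        _ = Lv * (logDerivHalf p α φ x * (x - a)) := by ring
        _ ≤ Lv * 2 := by gcongr
        _ = 2 * Lv := by ring
    have h4 : logDerivHalf p α φ x ^ (p - 1) * |v x| ^ p ≤ (2 * Lv : ℝ) ^ (p - 1) * |v x| := by
      have e : |v x| ^ p = |v x| ^ (p - 1) * |v x| := by
        rw [← Real.rpow_add_one' (abs_nonneg _) (by linarith)]; congr 1; ring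
      rw [e, ← mul_assoc, ← Real.mul_rpow hqx.le (abs_nonneg _)]
      gcongr
    have h5 := mul_le_mul_of_nonneg_right h4 hmx.le
    linarith
  rcases eq_or_lt_of_le hy.1 with rfl | hlt
  · simp
  rcases eq_or_lt_of_le hy.2 with rfl | hlt'
  · have hc := (intervalIntegral.continuous_primitive hint a).tendsto y
    refine ge_of_tendsto (hc.mono_left (nhdsWithin_le_nhds (s := Iio y))) ?_
    filter_upwards [Ioo_mem_nhdsLT hab] with x hx using key x hx
  · exact key y ⟨hlt, hlt'⟩

end IsHalfSolution

/-! ### Integrals against monotone weights -/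

/-- If all initial integrals of `k` on `(a, b)` are non-negative, then so is the integral of `k`
against a non-negative, bounded, non-increasing weight. -/
theorem integral_mul_antitone_nonneg {k g : ℝ → ℝ} {a b R : ℝ} (hab : a < b)
    (hk : IntervalIntegrable k volume a b) (hk0 : ∀ y ∈ Icc a b, 0 ≤ ∫ z in a..y, k z)
    (hg : AntitoneOn g (Ioo a b)) (hg0 : ∀ x ∈ Ioo a b, g x ∈ Icc 0 R)
    (hgm : Measurable g) : 0 ≤ ∫ x in Ioo a b, k x * g x := by
  have hkI : IntegrableOn k (Ioo a b) :=
    ((intervalIntegrable_iff_integrableOn_Ioc_of_le hab.le).1 hk).mono_set Ioo_subset_Ioc_self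
  -- Layer-cake formula: `g x` is the length of the set of `t ∈ (0, R]` with `t < g x`.
  have hlayer : ∀ x ∈ Ioo a b, k x * g x =
      ∫ t in Ioc 0 R, k x * (Ioi t).indicator 1 (g x) := fun x hx => by
    have h1 : ∀ t, (Ioi t).indicator (1 : ℝ → ℝ) (g x) = (Iio (g x)).indicator 1 t := fun t => by
      simp [indicator_apply]
    simp_rw [h1]
    rw [integral_const_mul, integral_indicator_one measurableSet_Iio]
    have h2 : (volume.restrict (Ioc 0 R)).real (Iio (g x)) = g x := by
      rw [measureReal_restrict_apply measurableSet_Iio]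
      have : Iio (g x) ∩ Ioc 0 R = Ioo 0 (g x) := by
        ext t
        simp only [mem_inter_iff, mem_Iio, mem_Ioc, mem_Ioo]
        constructor
        · rintro ⟨h, h', _⟩; exact ⟨h', h⟩
        · rintro ⟨h, h'⟩; exact ⟨h', h, h'.le.trans (hg0 x hx).2⟩
      rw [this, Real.volume_real_Ioo_of_le (hg0 x hx).1, sub_zero]
    rw [h2]
  rw [setIntegral_congr_fun measurableSet_Ioo hlayer, integral_integral_swap]
  · refine integral_nonneg fun t => ?_
    beta_reduce
    set E := Ioo a b ∩ g ⁻¹' Ioi t with hE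
    have hEm : MeasurableSet E := measurableSet_Ioo.inter (hgm measurableSet_Ioi)
    have h1 : ∫ x in Ioo a b, k x * (Ioi t).indicator 1 (g x) = ∫ x in E, k x := by
      rw [hE, ← setIntegral_indicator (hgm measurableSet_Ioi)]
      refine integral_congr_ae (Eventually.of_forall fun x => ?_)
      by_cases hx : t < g x <;> simp [hx]
    rw [h1]
    rcases E.eq_empty_or_nonempty with h0 | hne
    · simp [h0]
    have hbdd : BddAbove E := ⟨b, fun x hx => hx.1.2.le⟩
    obtain ⟨x₀, hx₀⟩ := hne
    have hs : sSup E ∈ Icc a b := ⟨hx₀.1.1.le.trans (le_csSup hbdd hx₀),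
      csSup_le ⟨x₀, hx₀⟩ fun x hx => hx.1.2.le⟩
    have hsub1 : E ⊆ Ioc a (sSup E) := fun x hx => ⟨hx.1.1, le_csSup hbdd hx⟩
    have hsub2 : Ioo a (sSup E) ⊆ E := fun x hx => by
      obtain ⟨y, hy, hxy⟩ := exists_lt_of_lt_csSup ⟨x₀, hx₀⟩ hx.2
      have hxI : x ∈ Ioo a b := ⟨hx.1, hxy.trans hy.1.2⟩
      exact ⟨hxI, lt_of_lt_of_le hy.2 (hg hxI hy.1 hxy.le)⟩
    -- A superlevel set of a non-increasing function is an initial interval, up to its right end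
    -- point.
    have hae : E =ᵐ[volume] Ioc a (sSup E) :=
      (LE.le.eventuallyLE hsub1).antisymm
        (Ioo_ae_eq_Ioc.symm.le.trans (LE.le.eventuallyLE hsub2))
    rw [setIntegral_congr_set hae, ← intervalIntegral.integral_of_le hs.1]
    exact hk0 _ hs
  · have h1 : Integrable (fun z : ℝ × ℝ => k z.1 * 1)
        ((volume.restrict (Ioo a b)).prod (volume.restrict (Ioc 0 R))) :=
      hkI.mul_prod (integrable_const 1)
    refine h1.mono ?_ (Eventually.of_forall fun z => ?_)
    · have hm2 : Measurable fun z : ℝ × ℝ => (Ioi z.2).indicator (1 : ℝ → ℝ) (g z.1) :=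
        (measurable_const (a := (1 : ℝ))).indicator
          (measurableSet_lt measurable_snd (hgm.comp measurable_fst))
      have := h1.aestronglyMeasurable.mul hm2.aestronglyMeasurable
      simp only [mul_one] at this
      exact this
    · by_cases hx : z.2 < g z.1 <;> simp [Function.uncurry, hx]

end MCPGap

end

noncomputable section

namespace MCPGap

/-! ### The lower bound for the spectral gap -/

open Set Filter Topology

variable {p K N D lam : ℝ} {h u : ℝ → ℝ}

/-- The consequences of the measure contraction property that are used for the lower bound of the
spectral gap: `h` and its reflection grow more slowly than `snPow`. -/
structure IsComparable (K N D : ℝ) (h : ℝ → ℝ) : Prop where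
  measurable : Measurable h
  nonneg : ∀ x, 0 ≤ h x
  integrable : Integrable h
  eq_zero : ∀ x, x ∉ Icc 0 D → h x = 0
  pos : ∀ x ∈ Ioo 0 D, 0 < h x
  antitone : AntitoneOn (fun x => h x / snPow K N x) (Ioo 0 D)
  antitone_reflect : AntitoneOn (fun x => h (D - x) / snPow K N x) (Ioo 0 D)

namespace IsComparable

theorem reflect (hh : IsComparable K N D h) : IsComparable K N D fun x => h (D - x) where
  measurable := hh.measurable.comp (measurable_const.sub measurable_id)
  nonneg x := hh.nonneg _
  integrable := hh.integrable.comp_sub_left D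
  eq_zero x hx := hh.eq_zero _ fun h => hx ⟨by linarith [h.2], by linarith [h.1]⟩
  pos x hx := hh.pos _ ⟨by linarith [hx.2], by linarith [hx.1]⟩
  antitone := hh.antitone_reflect
  antitone_reflect := by simpa using hh.antitone

theorem integrable_continuous_mul (hh : IsComparable K N D h) {f : ℝ → ℝ} (hf : Continuous f) :
    Integrable fun x => f x * h x := by
  obtain ⟨C, hC⟩ := isCompact_Icc.exists_bound_of_continuousOn (s := Icc 0 D) hf.continuousOn
  refine (hh.integrable.const_mul C).mono
    (hf.measurable.mul hh.measurable).aestronglyMeasurable (Eventually.of_forall fun x => ?_)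
  by_cases hx : x ∈ Icc 0 D
  · rw [norm_mul, norm_mul]
    gcongr
    exact (hC x hx).trans (le_abs_self C)
  · simp [hh.eq_zero x hx]

theorem integrable_abs_rpow_mul (hp : 1 < p) (hh : IsComparable K N D h) {v : ℝ → ℝ}
    (hv : Continuous v) : Integrable fun x => |v x| ^ p * h x :=
  hh.integrable_continuous_mul (hv.abs.rpow_const fun _ => Or.inr (by linarith))

theorem integrable_abs_deriv_rpow_mul (hp : 1 < p) (hh : IsComparable K N D h) {v : ℝ → ℝ}
    {L : NNReal} (hv : LipschitzWith L v) : Integrable fun x => |deriv v x| ^ p * h x := by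
  refine (hh.integrable.const_mul ((L : ℝ) ^ p)).mono
    (((measurable_deriv v).abs.pow_const p).mul hh.measurable).aestronglyMeasurable
    (Eventually.of_forall fun x => ?_)
  rw [norm_mul, norm_mul, Real.norm_of_nonneg (by positivity),
    Real.norm_of_nonneg (by positivity : 0 ≤ (L : ℝ) ^ p)]
  gcongr
  exact abs_deriv_le_of_lipschitzWith hv x

theorem integral_eq_setIntegral (hh : IsComparable K N D h) (f : ℝ → ℝ) :
    ∫ x, f x * h x = ∫ x in Ioo 0 D, f x * h x := by
  rw [← integral_Icc_eq_integral_Ioo]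
  refine (setIntegral_eq_integral_of_forall_compl_eq_zero fun x hx => ?_).symm
  rw [hh.eq_zero x hx, mul_zero]

theorem integral_eq_add (hh : IsComparable K N D h) {f : ℝ → ℝ} (hD : 0 < D)
    (hf : Integrable fun x => f x * h x) :
    ∫ x, f x * h x = (∫ x in Ioo (D / 2) D, f (D - x) * h (D - x)) +
      ∫ x in Ioo (D / 2) D, f x * h x := by
  rw [hh.integral_eq_setIntegral, ← integral_Ioc_eq_integral_Ioo,
    ← integral_Ioc_eq_integral_Ioo, ← integral_Ioc_eq_integral_Ioo,
    ← intervalIntegral.integral_of_le hD.le, ← intervalIntegral.integral_of_le (by linarith),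
    ← intervalIntegral.integral_of_le (by linarith),
    intervalIntegral.integral_comp_sub_left (fun x => f x * h x) D, sub_self, sub_half]
  exact (intervalIntegral.integral_add_adjacent_intervals hf.intervalIntegrable
    hf.intervalIntegrable).symm

/-- The half-interval spectral gap inequality. -/
theorem half_gap (hp : 1 < p) (hN : 1 < N) (hD0 : 0 < D)
    (hD : 0 < K → D ≤ Real.pi / Real.sqrt (K / (N - 1))) (hh : IsComparable K N D h)
    (hlam : lam ∈ modelParameters p K N D) {v : ℝ → ℝ} {L : NNReal} (hv : LipschitzWith L v)
    (hv0 : v (D / 2) = 0) :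
    lam * ∫ x in Ioo (D / 2) D, |v x| ^ p * h x ≤
      ∫ x in Ioo (D / 2) D, |deriv v x| ^ p * h x := by
  obtain ⟨α, φ, rfl, hφ⟩ := exists_isHalfSolution_of_mem_modelParameters hp hN hD0 hD hlam
  have hab : D / 2 < D := by linarith
  have hI : ∀ x ∈ Ioo (D / 2) D, x ∈ Ioo 0 D := fun x hx => ⟨by linarith [hx.1], hx.2⟩
  have hmid : D / 2 ∈ Ioo 0 D := ⟨by linarith, hab⟩
  have hmp : ∀ x ∈ Ioo (D / 2) D, 0 < snPow K N x := fun x hx => snPow_pos hN hD (hI x hx)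
  -- The density is split as `h = snPow * (h / snPow)`. The monotone factor is bounded by its value
  -- at `D/2`, which is finite because `D/2` is interior to `(0, D)`.
  have hgap := integral_mul_antitone_nonneg (g := fun x => h x / snPow K N x)
    (R := h (D / 2) / snPow K N (D / 2)) hab
    (intervalIntegrable_energyGap (lam := (p - 1) * α ^ p) hp (continuous_snPow (K := K) hN) hv _ _)
    (fun y hy => hφ.integral_energyGap_nonneg hp hab (continuous_snPow hN) hmp
      (fun x hx => snPow_hasDerivAt hN (sn_pos_of_mem_Ioo hN hD (hI x hx))) hv hv0 hy)
    (hh.antitone.mono hI)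
    (fun x hx => ⟨div_nonneg (hh.nonneg x) (hmp x hx).le, hh.antitone hmid (hI x hx) hx.1.le⟩)
    (hh.measurable.div (continuous_snPow hN).measurable)
  have heq : ∀ x ∈ Ioo (D / 2) D, energyGap p ((p - 1) * α ^ p) (snPow K N) v x *
      (h x / snPow K N x) =
      |deriv v x| ^ p * h x - (p - 1) * α ^ p * (|v x| ^ p * h x) := fun x hx => by
    have := hmp x hx
    rw [energyGap]
    field_simp
  rw [setIntegral_congr_fun measurableSet_Ioo heq, integral_sub
    (hh.integrable_abs_deriv_rpow_mul hp hv).integrableOn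
    ((hh.integrable_abs_rpow_mul hp hv.continuous).integrableOn.const_mul _),
    integral_const_mul] at hgap
  linarith

/-- Vanishing at `D/2` decouples the halves, and the left half is the right half of the reflected
density and function. -/
theorem gap_of_eq_zero (hp : 1 < p) (hN : 1 < N) (hD0 : 0 < D)
    (hD : 0 < K → D ≤ Real.pi / Real.sqrt (K / (N - 1))) (hh : IsComparable K N D h)
    (hlam : lam ∈ modelParameters p K N D) {v : ℝ → ℝ} {L : NNReal} (hv : LipschitzWith L v)
    (hv0 : v (D / 2) = 0) :
    lam * ∫ x, |v x| ^ p * h x ≤ ∫ x, |deriv v x| ^ p * h x := by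
  have hv' : LipschitzWith L fun x => v (D - x) := by
    refine LipschitzWith.of_dist_le_mul fun x y => ?_
    have := hv.dist_le_mul (D - x) (D - y)
    rwa [dist_sub_left] at this
  have h1 := hh.half_gap hp hN hD0 hD hlam hv hv0
  have h2 := hh.reflect.half_gap hp hN hD0 hD hlam hv' (by rw [sub_half, hv0])
  simp_rw [deriv_comp_const_sub, abs_neg] at h2
  rw [hh.integral_eq_add hD0 (hh.integrable_abs_rpow_mul hp hv.continuous),
    hh.integral_eq_add hD0 (hh.integrable_abs_deriv_rpow_mul hp hv)]
  linarith

/-- Among the translates of `u`, those with vanishing `p`-mean have the smallest `L^p` norm. -/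
theorem integral_le_integral_sub (hp : 1 < p) (hh : IsComparable K N D h)
    (hu : IsAdmissible p h u) (s : ℝ) :
    ∫ x, |u x| ^ p * h x ≤ ∫ x, |u x - s| ^ p * h x := by
  obtain ⟨L, hL⟩ := hu.lipschitz
  have hi1 := hh.integrable_abs_rpow_mul hp hL.continuous
  have hi2 := hh.integrable_abs_rpow_mul hp (hL.continuous.sub (continuous_const (y := s)))
  have hi3 : Integrable fun x => u x * |u x| ^ (p - 2) * h x := by
    refine ((hh.integrable_continuous_mul (f := fun x => |u x| ^ (p - 1))
      (hL.continuous.abs.rpow_const fun _ => Or.inr (by linarith)))).mono ?_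
      (Eventually.of_forall fun x => ?_)
    · exact ((hL.continuous.measurable.mul (hL.continuous.measurable.abs.pow_const _)).mul
        hh.measurable).aestronglyMeasurable
    · rw [norm_mul, norm_mul (|u x| ^ (p - 1)), mul_comm (u x), Real.norm_eq_abs, abs_abs_rpow_mul_self hp,
        Real.norm_of_nonneg (by positivity : 0 ≤ |u x| ^ (p - 1))]
  -- Pointwise this is the tangent-line inequality of `|·|^p` at `u x`; the linear term integrates
  -- to `0`.
  have hpt : ∀ x, |u x| ^ p * h x - p * s * (u x * |u x| ^ (p - 2) * h x) ≤
      |u x - s| ^ p * h x := fun x => by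
    have h1 := mul_abs_rpow_le hp (u x - s) (u x)
    have h2 := abs_rpow_mul_self_mul_self hp (u x)
    have h3 := mul_le_mul_of_nonneg_right h1 (hh.nonneg x)
    have h4 : p * (|u x| ^ (p - 2) * u x * (u x - s)) =
        p * |u x| ^ p - p * s * (u x * |u x| ^ (p - 2)) := by rw [← h2]; ring
    rw [h4] at h3
    linarith
  have := integral_mono (hi1.sub (hi3.const_mul (p * s))) hi2 hpt
  have e : ∫ x, |u x| ^ p * h x - p * s * (u x * |u x| ^ (p - 2) * h x) =
      ∫ x, |u x| ^ p * h x := by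
    rw [integral_sub hi1 (hi3.const_mul _), integral_const_mul, hu.mean_zero]
    ring
  simp only [Pi.sub_apply] at this
  rwa [e] at this

theorem integral_pos (hh : IsComparable K N D h) {f : ℝ → ℝ} (hf : Continuous f)
    (hf0 : ∀ x, 0 ≤ f x) {x₀ : ℝ} (hx₀ : x₀ ∈ Ioo 0 D) (hfx : 0 < f x₀) :
    0 < ∫ x, f x * h x := by
  rw [integral_pos_iff_support_of_nonneg (fun x => mul_nonneg (hf0 x) (hh.nonneg x))
    (hh.integrable_continuous_mul hf)]
  have hopen : IsOpen (Ioo 0 D ∩ f ⁻¹' Ioi 0) := isOpen_Ioo.inter (isOpen_Ioi.preimage hf)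
  refine (hopen.measure_pos volume ⟨x₀, hx₀, hfx⟩).trans_le (measure_mono fun x hx => ?_)
  exact (mul_pos hx.2 (hh.pos x hx.1)).ne'

/-- Without an admissible function the infimum would be the default value `0`. A piecewise linear
function with its kink and zero at `D/2` works once its slopes satisfy `β^(p-1) = B` and `γ^(p-1) =
A`, which balances the two halves of the mean. -/
theorem exists_isAdmissible (hp : 1 < p) (hD0 : 0 < D) (hh : IsComparable K N D h) :
    ∃ u, IsAdmissible p h u := by
  have hp1 : 0 < p - 1 := by linarith
  have hc1 : Continuous fun x : ℝ => max (x - D / 2) 0 ^ (p - 1) :=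
    (by fun_prop : Continuous fun x : ℝ => max (x - D / 2) 0).rpow_const fun _ => Or.inr hp1.le
  have hc2 : Continuous fun x : ℝ => max (D / 2 - x) 0 ^ (p - 1) :=
    (by fun_prop : Continuous fun x : ℝ => max (D / 2 - x) 0).rpow_const fun _ => Or.inr hp1.le
  have hA : 0 < ∫ x, max (x - D / 2) 0 ^ (p - 1) * h x :=
    hh.integral_pos hc1 (fun x => by positivity) (x₀ := 3 * D / 4)
      ⟨by linarith, by linarith⟩ (Real.rpow_pos_of_pos (lt_max_of_lt_left (by linarith)) _)
  have hB : 0 < ∫ x, max (D / 2 - x) 0 ^ (p - 1) * h x :=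
    hh.integral_pos hc2 (fun x => by positivity) (x₀ := D / 4)
      ⟨by linarith, by linarith⟩ (Real.rpow_pos_of_pos (lt_max_of_lt_left (by linarith)) _)
  set A := ∫ x, max (x - D / 2) 0 ^ (p - 1) * h x with hAdef
  set B := ∫ x, max (D / 2 - x) 0 ^ (p - 1) * h x with hBdef
  set β := B ^ (1 / (p - 1)) with hβ
  set γ := A ^ (1 / (p - 1)) with hγ
  have hβ0 : 0 < β := by positivity
  have hγ0 : 0 < γ := by positivity
  have hβp : β ^ (p - 1) = B := by
    rw [hβ, ← Real.rpow_mul hB.le, one_div_mul_cancel hp1.ne', Real.rpow_one]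
  have hγp : γ ^ (p - 1) = A := by
    rw [hγ, ← Real.rpow_mul hA.le, one_div_mul_cancel hp1.ne', Real.rpow_one]
  set u : ℝ → ℝ := fun x => β * max (x - D / 2) 0 - γ * max (D / 2 - x) 0 with hu
  have hlip : ∃ C : NNReal, LipschitzWith C u := by
    have l1 : LipschitzWith 1 fun x : ℝ => max (x - D / 2) 0 := by
      have := (LipschitzWith.id (α := ℝ)).sub (LipschitzWith.const (D / 2))
      rw [add_zero] at this
      exact this.max_const 0
    have l2 : LipschitzWith 1 fun x : ℝ => max (D / 2 - x) 0 := by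
      have := (LipschitzWith.const (α := ℝ) (D / 2)).sub (LipschitzWith.id (α := ℝ))
      rw [zero_add] at this
      exact this.max_const 0
    have l3 := ((lipschitzWith_smul β).comp l1).sub ((lipschitzWith_smul γ).comp l2)
    exact ⟨_, l3⟩
  obtain ⟨C, hC⟩ := hlip
  refine ⟨u, ⟨C, hC⟩, hh.integrable_abs_rpow_mul hp hC.continuous, ?_, ?_⟩
  · refine hh.integral_pos (hC.continuous.abs.rpow_const fun _ => Or.inr (by linarith))
      (fun x => by positivity) (x₀ := 3 * D / 4) ⟨by linarith, by linarith⟩ ?_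
    refine Real.rpow_pos_of_pos (abs_pos.2 ?_) _
    have e1 : max (3 * D / 4 - D / 2) 0 = D / 4 := by rw [max_eq_left] <;> linarith
    have e2 : max (D / 2 - 3 * D / 4) 0 = 0 := max_eq_right (by linarith)
    simp only [hu, e1, e2]
    have : 0 < β * (D / 4) := by positivity
    linarith
  · have hpt : ∀ x, u x * |u x| ^ (p - 2) * h x =
        B * (max (x - D / 2) 0 ^ (p - 1) * h x) - A * (max (D / 2 - x) 0 ^ (p - 1) * h x) := by
      intro x
      have hpow : ∀ y : ℝ, 0 < y → y * y ^ (p - 2) = y ^ (p - 1) := fun y hy => by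
        rw [mul_comm, ← Real.rpow_add_one hy.ne']; congr 1; ring
      rcases lt_trichotomy x (D / 2) with hx | hx | hx
      · have e1 : max (x - D / 2) 0 = 0 := max_eq_right (by linarith)
        have e2 : max (D / 2 - x) 0 = D / 2 - x := max_eq_left (by linarith)
        have hpos : 0 < γ * (D / 2 - x) := mul_pos hγ0 (by linarith)
        have e3 : u x = -(γ * (D / 2 - x)) := by simp only [hu, e1, e2]; ring
        rw [e3, e1, e2, abs_neg, abs_of_pos hpos, Real.zero_rpow hp1.ne', neg_mul, hpow _ hpos,
          Real.mul_rpow hγ0.le (by linarith), hγp]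
        ring
      · have e1 : max (x - D / 2) 0 = 0 := max_eq_right (by linarith)
        have e2 : max (D / 2 - x) 0 = 0 := max_eq_right (by linarith)
        have e3 : u x = 0 := by simp only [hu, e1, e2]; ring
        rw [e3, e1, e2, Real.zero_rpow hp1.ne']
        ring
      · have e1 : max (x - D / 2) 0 = x - D / 2 := max_eq_left (by linarith)
        have e2 : max (D / 2 - x) 0 = 0 := max_eq_right (by linarith)
        have hpos : 0 < β * (x - D / 2) := mul_pos hβ0 (by linarith)
        have e3 : u x = β * (x - D / 2) := by simp only [hu, e1, e2]; ring
        rw [e3, e1, e2, abs_of_pos hpos, Real.zero_rpow hp1.ne', hpow _ hpos,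
          Real.mul_rpow hβ0.le (by linarith), hβp]
        ring
    simp_rw [hpt]
    rw [integral_sub ((hh.integrable_continuous_mul hc1).const_mul _)
      ((hh.integrable_continuous_mul hc2).const_mul _), integral_const_mul, integral_const_mul,
      ← hAdef, ← hBdef]
    ring

/-- Every parameter of the model problem is a lower bound for the spectral gap. -/
theorem le_spectralGap (hp : 1 < p) (hN : 1 < N) (hD0 : 0 < D)
    (hD : 0 < K → D ≤ Real.pi / Real.sqrt (K / (N - 1))) (hh : IsComparable K N D h)
    (hlam : lam ∈ modelParameters p K N D) : lam ≤ spectralGap p h := by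
  obtain ⟨u₀, hu₀⟩ := hh.exists_isAdmissible hp hD0
  refine le_csInf ⟨_, u₀, hu₀, rfl⟩ ?_
  rintro r ⟨u, hu, rfl⟩
  rw [le_div_iff₀ hu.ne_zero]
  obtain ⟨L, hL⟩ := hu.lipschitz
  have hv : LipschitzWith L fun x => u x - u (D / 2) := by
    simpa using hL.sub (LipschitzWith.const (u (D / 2)))
  have h1 := hh.gap_of_eq_zero hp hN hD0 hD hlam hv (sub_self _)
  simp_rw [deriv_sub_const] at h1
  exact (mul_le_mul_of_nonneg_left (hh.integral_le_integral_sub hp hu _) hlam.1).trans h1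

end IsComparable

end MCPGap

end

noncomputable section

namespace MCPGap

/-! ### Densities with the measure contraction property -/

open Set Filter Topology

variable {p K N D : ℝ} {h : ℝ → ℝ}

theorem setOf_le_min_bonnetMyers (hD : 0 < K → D ≤ Real.pi / Real.sqrt (K / (N - 1))) :
    {x : ℝ | 0 ≤ x ∧ (x : EReal) ≤ min (D : EReal) (bonnetMyers K N)} = Icc 0 D := by
  rw [min_eq_left (le_bonnetMyers_iff.2 hD)]
  ext x
  simp

/-- The class `densities K N D` only depends on `min D D_{K,N}`. -/
theorem exists_densities_eq (hN : 1 < N) (hD0 : 0 < D) :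
    ∃ E, 0 < E ∧ E ≤ D ∧ (E : EReal) ≤ bonnetMyers K N ∧ densities K N D = densities K N E := by
  by_cases hD : (D : EReal) ≤ bonnetMyers K N
  · exact ⟨D, hD0, le_rfl, hD, rfl⟩
  have hK : 0 < K := by
    by_contra hK
    exact hD (le_bonnetMyers_iff.2 fun h => absurd h hK)
  have hb : bonnetMyers K N = ((Real.pi / Real.sqrt (K / (N - 1)) : ℝ) : EReal) := if_pos hK
  refine ⟨Real.pi / Real.sqrt (K / (N - 1)), div_pos Real.pi_pos (sqrt_curvature_pos hN hK), ?_,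
    hb.ge, ?_⟩
  · rw [hb, EReal.coe_le_coe_iff] at hD
    exact (not_le.1 hD).le
  · rw [densities, densities, min_eq_right (not_le.1 hD).le, ← hb, min_self]

theorem sigma_rpow_mul_ofReal (hN : 1 < N) {t θ y : ℝ} (ht : t ∈ Icc (0 : ℝ) 1) (hθ : 0 < θ)
    (hθ' : 0 < K → θ < Real.pi / Real.sqrt (K / (N - 1))) :
    sigma K N t θ ^ (N - 1) * ENNReal.ofReal y =
      ENNReal.ofReal ((sn K N (t * θ) / sn K N θ) ^ (N - 1) * y) := by
  have h1 := sn_pos hN hθ hθ'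
  have h2 : 0 ≤ sn K N (t * θ) := sn_nonneg hN (mul_nonneg ht.1 hθ.le) fun hK =>
    (mul_le_of_le_one_left hθ.le ht.2).trans (hθ' hK).le
  have h3 : 0 ≤ sn K N (t * θ) / sn K N θ := by positivity
  rw [sigma_eq hN hθ hθ', ENNReal.ofReal_rpow_of_nonneg h3 (by linarith),
    ← ENNReal.ofReal_mul (by positivity)]

/-- This is contraction towards `x₁`: the parameter `1 - x/y` selects the point of the segment at
distance `x` from `x₁`. With `x₁` an end point of the support it becomes a monotonicity statement.
-/
theorem IsMCPDensity.div_snPow_le (hN : 1 < N) (hh : IsMCPDensity K N h) {x₀ x₁ x y : ℝ}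
    (hx₀ : x₀ ∈ tsupport h) (hx₁ : x₁ ∈ tsupport h) (hx : 0 < x) (hxy : x ≤ y)
    (hy : 0 < K → y < Real.pi / Real.sqrt (K / (N - 1))) (hdist : |x₁ - x₀| = y) :
    h x₀ / snPow K N y ≤ h ((1 - x / y) * x₁ + x / y * x₀) / snPow K N x := by
  have hy0 : 0 < y := hx.trans_le hxy
  have h1 := hh.contraction x₀ hx₀ x₁ hx₁ (1 - x / y)
    ⟨by rw [sub_nonneg, div_le_one hy0]; exact hxy, by have := div_pos hx hy0; linarith⟩
  rw [sub_sub_cancel, hdist, sigma_rpow_mul_ofReal hN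
    ⟨(div_pos hx hy0).le, (div_le_one hy0).2 hxy⟩ hy0 hy, ENNReal.ofReal_le_ofReal_iff
    (hh.nonneg _), div_mul_cancel₀ _ hy0.ne'] at h1
  have hsx := sn_pos hN hx fun hK => hxy.trans_lt (hy hK)
  have hsy := sn_pos hN hy0 hy
  have hmx : 0 < snPow K N x := Real.rpow_pos_of_pos hsx _
  have hmy : 0 < snPow K N y := Real.rpow_pos_of_pos hsy _
  rw [Real.div_rpow hsx.le hsy.le] at h1
  change snPow K N x / snPow K N y * h x₀ ≤ _ at h1
  rw [div_le_div_iff₀ hmy hmx]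
  rw [div_mul_eq_mul_div, div_le_iff₀ hmy] at h1
  linarith

/-- Densities with the measure contraction property satisfy the comparison property. -/
theorem isComparable_of_mem_densities (hN : 1 < N) (hD0 : 0 < D)
    (hD : 0 < K → D ≤ Real.pi / Real.sqrt (K / (N - 1))) (hh : h ∈ densities K N D) :
    IsComparable K N D h := by
  obtain ⟨hM, hsupp⟩ := hh
  rw [setOf_le_min_bonnetMyers hD] at hsupp
  have hlt : ∀ y ∈ Ioo 0 D, 0 < K → y < Real.pi / Real.sqrt (K / (N - 1)) := fun y hy hK =>
    hy.2.trans_le (hD hK)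
  have hanti : AntitoneOn (fun x => h x / snPow K N x) (Ioo 0 D) := by
    intro x hx y hy hxy
    have := hM.div_snPow_le hN (x₀ := y) (x₁ := 0) (x := x) (y := y)
      (by rw [hsupp]; exact Ioo_subset_Icc_self hy) (by rw [hsupp]; exact ⟨le_rfl, hD0.le⟩) hx.1 hxy
      (hlt y hy) (by rw [zero_sub, abs_neg, abs_of_pos hy.1])
    rwa [mul_zero, zero_add, div_mul_cancel₀ _ hy.1.ne'] at this
  have hanti' : AntitoneOn (fun x => h (D - x) / snPow K N x) (Ioo 0 D) := by
    intro x hx y hy hxy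
    have := hM.div_snPow_le hN (x₀ := D - y) (x₁ := D) (x := x) (y := y)
      (by rw [hsupp]; exact ⟨by linarith [hy.2], by linarith [hy.1]⟩)
      (by rw [hsupp]; exact ⟨hD0.le, le_rfl⟩) hx.1 hxy
      (hlt y hy) (by rw [sub_sub_cancel, abs_of_pos hy.1])
    have e : (1 - x / y) * D + x / y * (D - y) = D - x := by
      have := hy.1.ne'
      field_simp
      ring
    rwa [e] at this
  refine ⟨hM.measurable, hM.nonneg, hM.integrable, fun x hx => ?_, fun x hx => ?_, hanti, hanti'⟩
  · by_contra hne
    exact hx (hsupp ▸ subset_tsupport h hne)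
  -- The support condition supplies one interior point where `h > 0`. Positivity spreads to its left
  -- by `hanti` and to its right by `hanti'`.
  · have hmem : D / 2 ∈ closure (Function.support h) := by
      change D / 2 ∈ tsupport h
      rw [hsupp]; constructor <;> linarith
    obtain ⟨x₀, hx₀, hne⟩ := mem_closure_iff.1 hmem (Ioo 0 D) isOpen_Ioo
      ⟨by linarith, by linarith⟩
    have hpos : 0 < h x₀ := (hM.nonneg x₀).lt_of_ne (Ne.symm hne)
    have hm : ∀ y ∈ Ioo 0 D, 0 < snPow K N y := fun y hy => snPow_pos hN hD hy
    have hr : ∀ y ∈ Ioo 0 D, D - y ∈ Ioo 0 D := fun y hy => ⟨by linarith [hy.2], by linarith [hy.1]⟩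
    rcases le_total x x₀ with hle | hle
    · have h1 : h x₀ / snPow K N x₀ ≤ h x / snPow K N x := hanti hx hx₀ hle
      have h2 : 0 < h x₀ / snPow K N x₀ := div_pos hpos (hm _ hx₀)
      exact (div_pos_iff_of_pos_right (hm x hx)).1 (h2.trans_le h1)
    · have h1 := hanti' (hr x hx) (hr x₀ hx₀) (by linarith)
      simp only [sub_sub_cancel] at h1
      have h2 : 0 < h x₀ / snPow K N (D - x₀) := div_pos hpos (hm _ (hr _ hx₀))
      exact (div_pos_iff_of_pos_right (hm _ (hr x hx))).1 (h2.trans_le h1)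

/-! ### The model density -/

/-- The model density, whose logarithmic derivative is `modelT`. -/
def modelDensity (K N D : ℝ) : ℝ → ℝ :=
  (Icc 0 D).indicator fun x => snPow K N (max x (D - x))

theorem modelDensity_reflect (x : ℝ) : modelDensity K N D (D - x) = modelDensity K N D x := by
  have : D - x ∈ Icc 0 D ↔ x ∈ Icc 0 D := by
    constructor <;> rintro ⟨h1, h2⟩ <;> constructor <;> linarith
  simp only [modelDensity, indicator_apply, this, sub_sub_cancel, max_comm]

theorem modelDensity_of_mem {x : ℝ} (hx : x ∈ Icc (D / 2) D) (hD0 : 0 < D) :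
    modelDensity K N D x = snPow K N x := by
  have hx' : x ∈ Icc 0 D := ⟨by linarith [hx.1], hx.2⟩
  rw [modelDensity, indicator_of_mem hx', max_eq_left (by linarith [hx.1])]

/-- This is the contraction inequality of the model density before taking powers. If both points lie
in the same half, it is an addition formula with a non-negative remainder. In the mixed case one
also uses `sn (D - x) ≤ sn x` for `x ≥ D/2`. -/
theorem sn_mul_max_le (hN : 1 < N) (hD0 : 0 < D)
    (hD : 0 < K → D ≤ Real.pi / Real.sqrt (K / (N - 1))) {x₀ x x₁ : ℝ} (h0 : 0 ≤ x₀) (h1 : x₀ ≤ x)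
    (h2 : x ≤ x₁) (h3 : x₁ ≤ D) :
    sn K N (x₁ - x) * sn K N (max x₀ (D - x₀)) ≤ sn K N (max x (D - x)) * sn K N (x₁ - x₀) := by
  have hnn : ∀ y ∈ Icc 0 D, 0 ≤ sn K N y := fun y hy => sn_nonneg hN hy.1 fun hK =>
    hy.2.trans (hD hK)
  have key : sn K N (x₁ - x) * sn K N (D - x₀) ≤ sn K N (D - x) * sn K N (x₁ - x₀) := by
    have := sn_mul_sub_sub (K := K) hN (D - x₀) (x₁ - x₀) (x - x₀)
    rw [show D - x₀ - (x - x₀) = D - x by ring, show x₁ - x₀ - (x - x₀) = x₁ - x by ring,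
      show D - x₀ - (x₁ - x₀) = D - x₁ by ring] at this
    have h4 := mul_nonneg (hnn (x - x₀) ⟨by linarith, by linarith⟩)
      (hnn (D - x₁) ⟨by linarith, by linarith⟩)
    linarith
  rcases le_total x (D / 2) with hx | hx
  · rwa [max_eq_right (by linarith : x ≤ D - x), max_eq_right (by linarith : x₀ ≤ D - x₀)]
  rw [max_eq_left (by linarith : D - x ≤ x)]
  rcases le_total x₀ (D / 2) with hx₀ | hx₀
  · rw [max_eq_right (by linarith : x₀ ≤ D - x₀)]
    refine key.trans (mul_le_mul_of_nonneg_right ?_ (hnn _ ⟨by linarith, by linarith⟩))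
    have := sn_mul_add_sub (K := K) hN (D / 2) (D / 2) (x - D / 2)
    rw [show D / 2 + (x - D / 2) = x by ring, show D / 2 - (x - D / 2) = D - x by ring,
      show D / 2 + D / 2 = D by ring] at this
    have h4 := mul_nonneg (hnn (x - D / 2) ⟨by linarith, by linarith⟩) (hnn D ⟨hD0.le, le_rfl⟩)
    have h5 : 0 < sn K N (D / 2) := sn_pos_of_mem_Ioo hN hD ⟨by linarith, by linarith⟩
    rw [← this, ← sub_mul] at h4
    linarith [nonneg_of_mul_nonneg_left h4 h5]
  · rw [max_eq_left (by linarith : D - x₀ ≤ x₀)]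
    have := sn_mul_add_sub (K := K) hN x₀ (x₁ - x₀) (x - x₀)
    rw [show x₀ + (x - x₀) = x by ring, show x₁ - x₀ - (x - x₀) = x₁ - x by ring,
      show x₀ + (x₁ - x₀) = x₁ by ring] at this
    have h4 := mul_nonneg (hnn (x - x₀) ⟨by linarith, by linarith⟩)
      (hnn x₁ ⟨by linarith, by linarith⟩)
    linarith

theorem modelDensity_mem_densities (hN : 1 < N) (hD0 : 0 < D)
    (hD : 0 < K → D ≤ Real.pi / Real.sqrt (K / (N - 1))) :
    modelDensity K N D ∈ densities K N D := by
  have hN1 : 0 < N - 1 := by linarith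
  have hmax : ∀ x ∈ Icc 0 D, max x (D - x) ∈ Icc 0 D := fun x hx =>
    ⟨le_max_of_le_left hx.1, max_le hx.2 (by linarith [hx.1])⟩
  have hsnn : ∀ y ∈ Icc 0 D, 0 ≤ sn K N y := fun y hy => sn_nonneg hN hy.1 fun hK =>
    hy.2.trans (hD hK)
  have hcont : Continuous fun x => snPow K N (max x (D - x)) :=
    (continuous_snPow hN).comp (by fun_prop)
  have hsupp : tsupport (modelDensity K N D) = Icc 0 D := by
    refine subset_antisymm (closure_minimal (fun x hx => ?_) isClosed_Icc) ?_
    · by_contra hx'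
      exact hx (indicator_of_notMem hx' _)
    · rw [← closure_Ioo hD0.ne]
      refine closure_mono fun x hx => ?_
      rw [Function.mem_support, modelDensity, indicator_of_mem (Ioo_subset_Icc_self hx)]
      exact (snPow_pos hN hD ⟨lt_max_of_lt_left hx.1, max_lt hx.2 (by linarith [hx.1])⟩).ne'
  refine ⟨⟨hcont.measurable.indicator measurableSet_Icc, fun x => ?_, ?_, ?_⟩, ?_⟩
  · exact indicator_nonneg (fun x hx => snPow_nonneg hN hD (hmax x hx)) x
  · exact (hcont.continuousOn.integrableOn_compact isCompact_Icc).integrable_indicator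
      measurableSet_Icc
  · rw [hsupp]
    -- the case `x₀ < x₁`; the opposite case follows by reflection
    have main : ∀ x₀ ∈ Icc 0 D, ∀ x₁ ∈ Icc 0 D, x₀ < x₁ → ∀ t ∈ Icc (0 : ℝ) 1,
        sigma K N (1 - t) |x₁ - x₀| ^ (N - 1) * ENNReal.ofReal (modelDensity K N D x₀) ≤
          ENNReal.ofReal (modelDensity K N D (t * x₁ + (1 - t) * x₀)) := by
      intro x₀ hx₀ x₁ hx₁ hlt t ht
      have hθ : 0 < x₁ - x₀ := by linarith
      rw [abs_of_pos hθ]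
      by_cases hθ' : 0 < K → x₁ - x₀ < Real.pi / Real.sqrt (K / (N - 1))
      · have e : t * x₁ + (1 - t) * x₀ = x₁ - (1 - t) * (x₁ - x₀) := by ring
        have hx1 : (1 - t) * (x₁ - x₀) ≤ x₁ - x₀ :=
          mul_le_of_le_one_left hθ.le (by linarith [ht.1])
        have hx2 : 0 ≤ (1 - t) * (x₁ - x₀) := mul_nonneg (by linarith [ht.2]) hθ.le
        rw [sigma_rpow_mul_ofReal hN ⟨by linarith [ht.2], by linarith [ht.1]⟩ hθ hθ', e]
        set δ := (1 - t) * (x₁ - x₀)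
        have hx : x₁ - δ ∈ Icc 0 D := ⟨by linarith [hx₀.1], by linarith [hx₁.2]⟩
        refine ENNReal.ofReal_le_ofReal ?_
        rw [modelDensity, indicator_of_mem hx₀, indicator_of_mem hx]
        have h1 := sn_mul_max_le (K := K) hN hD0 hD hx₀.1 (by linarith : x₀ ≤ x₁ - δ)
          (by linarith : x₁ - δ ≤ x₁) hx₁.2
        rw [sub_sub_cancel] at h1
        have h2 := sn_pos hN hθ hθ'
        have h3 := hsnn δ ⟨hx2, by linarith [hx₀.1, hx₁.2]⟩
        have h4 := hsnn _ (hmax x₀ hx₀)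
        unfold snPow
        rw [← Real.mul_rpow (by positivity) h4]
        refine Real.rpow_le_rpow (by positivity) ?_ hN1.le
        rw [div_mul_eq_mul_div, div_le_iff₀ h2]
        exact h1
      -- Here the distortion coefficient is `∞`. The distance can only equal `D_{K,N} = D`, so `x₀ =
      -- 0`, where the model density vanishes, and `∞ * 0 = 0`.
      · push Not at hθ'
        obtain ⟨hK, hge⟩ := hθ'
        have hD' := hD hK
        have e1 : D = Real.pi / Real.sqrt (K / (N - 1)) := by linarith [hx₀.1, hx₁.2]
        have e2 : x₀ = 0 := by linarith [hx₀.1, hx₁.2]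
        have e3 : modelDensity K N D x₀ = 0 := by
          rw [modelDensity, indicator_of_mem hx₀, e2, sub_zero, max_eq_right hD0.le, snPow, e1,
            sn_diameter hN hK, Real.zero_rpow hN1.ne']
        rw [e3, ENNReal.ofReal_zero, mul_zero]
        exact zero_le
    intro x₀ hx₀ x₁ hx₁ t ht
    rcases lt_trichotomy x₀ x₁ with hlt | heq | hgt
    · exact main x₀ hx₀ x₁ hx₁ hlt t ht
    · subst heq
      have h1 : sigma K N (1 - t) |x₀ - x₀| = ENNReal.ofReal (1 - t) := by
        have : ¬((N - 1) * Real.pi ^ 2 ≤ 0) := by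
          have := Real.pi_pos
          simp only [not_le]; positivity
        simp [sigma, this]
      have h2 : t * x₀ + (1 - t) * x₀ = x₀ := by ring
      rw [h1, h2]
      refine mul_le_of_le_one_left zero_le (ENNReal.rpow_le_one ?_ hN1.le)
      exact ENNReal.ofReal_le_one.2 (by linarith [ht.1])
    · have := main (D - x₀) ⟨by linarith [hx₀.2], by linarith [hx₀.1]⟩ (D - x₁)
        ⟨by linarith [hx₁.2], by linarith [hx₁.1]⟩ (by linarith) t ht
      have e : t * (D - x₁) + (1 - t) * (D - x₀) = D - (t * x₁ + (1 - t) * x₀) := by ring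
      rw [e, modelDensity_reflect, modelDensity_reflect, sub_sub_sub_cancel_left, abs_sub_comm]
        at this
      exact this
  · rw [hsupp, setOf_le_min_bonnetMyers hD]

/-! ### Scaling in non-positive curvature -/

/-- With `r = D'/D`, the quotient is the product of `f (r x) / snPow (r x)` and `snPow (r x) / snPow
x`. Both are non-negative and non-increasing, the second because `K ≤ 0`. -/
theorem antitoneOn_comp_mul (hN : 1 < N) (hK : K ≤ 0) {f : ℝ → ℝ} {D' : ℝ} (hD'0 : 0 < D')
    (hD' : D' ≤ D) (hf0 : ∀ x, 0 ≤ f x) (hf : AntitoneOn (fun x => f x / snPow K N x) (Ioo 0 D')) :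
    AntitoneOn (fun x => f (D' / D * x) / snPow K N x) (Ioo 0 D) := by
  have hD0 : 0 < D := hD'0.trans_le hD'
  set r := D' / D with hr
  have hr0 : 0 < r := by positivity
  have hr1 : r ≤ 1 := (div_le_one hD0).2 hD'
  have hrD : r * D = D' := div_mul_cancel₀ _ hD0.ne'
  have hs : ∀ x, 0 < x → 0 < sn K N x := fun x hx => sn_pos hN hx fun h => absurd h (not_lt.2 hK)
  have hm : ∀ x, 0 < x → 0 < snPow K N x := fun x hx => Real.rpow_pos_of_pos (hs x hx) _
  intro x hx y hy hxy
  have hx' : r * x ∈ Ioo 0 D' := ⟨mul_pos hr0 hx.1, by rw [← hrD]; gcongr; exact hx.2⟩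
  have hy' : r * y ∈ Ioo 0 D' := ⟨mul_pos hr0 hy.1, by rw [← hrD]; gcongr; exact hy.2⟩
  have h1 := hf hx' hy' (mul_le_mul_of_nonneg_left hxy hr0.le)
  have h2 : snPow K N (r * y) / snPow K N y ≤ snPow K N (r * x) / snPow K N x := by
    have := sn_mul_le hN hK (r := r) ⟨hr0.le, hr1⟩ hx.1 hxy
    unfold snPow
    rw [← Real.div_rpow (hs _ hy'.1).le (hs _ hy.1).le,
      ← Real.div_rpow (hs _ hx'.1).le (hs _ hx.1).le]
    refine Real.rpow_le_rpow (div_pos (hs _ hy'.1) (hs _ hy.1)).le ?_ (by linarith)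
    rw [div_le_div_iff₀ (hs _ hy.1) (hs _ hx.1)]
    exact this
  have h3 := mul_le_mul h1 h2 (div_pos (hm _ hy'.1) (hm _ hy.1)).le
    (div_nonneg (hf0 _) (hm _ hx'.1).le)
  beta_reduce at h3
  rwa [div_mul_div_cancel₀ (hm _ hy'.1).ne', div_mul_div_cancel₀ (hm _ hx'.1).ne'] at h3

/-- Comparability is all that the lower bound uses, so the full contraction property of the
stretched density is not required. -/
theorem IsComparable.comp_mul (hN : 1 < N) (hK : K ≤ 0) {D' : ℝ} (hD'0 : 0 < D')
    (hD' : D' ≤ D) (hh : IsComparable K N D' h) :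
    IsComparable K N D fun x => h (D' / D * x) := by
  have hD0 : 0 < D := hD'0.trans_le hD'
  have hr0 : 0 < D' / D := by positivity
  have hrD : D' / D * D = D' := div_mul_cancel₀ _ hD0.ne'
  refine ⟨hh.measurable.comp (measurable_const.mul measurable_id), fun x => hh.nonneg _,
    hh.integrable.comp_mul_left' hr0.ne', fun x hx => hh.eq_zero _ fun hx' => hx ?_,
    fun x hx => hh.pos _ ?_, antitoneOn_comp_mul hN hK hD'0 hD' hh.nonneg hh.antitone, ?_⟩
  · refine ⟨nonneg_of_mul_nonneg_right hx'.1 hr0, ?_⟩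
    have := hx'.2
    rw [← hrD, hrD] at this
    exact le_of_mul_le_mul_left (this.trans hrD.ge) hr0
  · refine ⟨mul_pos hr0 hx.1, ?_⟩
    have := mul_lt_mul_of_pos_left hx.2 hr0
    rwa [hrD] at this
  · have := antitoneOn_comp_mul (f := fun x => h (D' - x)) hN hK hD'0 hD'
      (fun x => hh.nonneg _) hh.antitone_reflect
    have e : ∀ x, D' / D * (D - x) = D' - D' / D * x := fun x => by rw [mul_sub, hrD]
    simpa only [e] using this

theorem spectralGap_set_bddBelow (p : ℝ) (hh : ∀ x, 0 ≤ h x) :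
    BddBelow {r | ∃ u : ℝ → ℝ, IsAdmissible p h u ∧
      r = (∫ x, |deriv u x| ^ p * h x) / ∫ x, |u x| ^ p * h x} := by
  refine ⟨0, ?_⟩
  rintro r ⟨u, hu, rfl⟩
  exact div_nonneg (integral_nonneg fun x => mul_nonneg (by positivity) (hh x)) hu.ne_zero.le

theorem spectralGap_nonneg (p : ℝ) (hh : ∀ x, 0 ≤ h x) : 0 ≤ spectralGap p h := by
  refine Real.sInf_nonneg ?_
  rintro r ⟨u, hu, rfl⟩
  exact div_nonneg (integral_nonneg fun x => mul_nonneg (by positivity) (hh x)) hu.ne_zero.le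

/-- Stretching a density decreases its spectral gap. -/
theorem spectralGap_comp_mul_le (hp : 1 < p) {r : ℝ} (hr0 : 0 < r) (hr1 : r ≤ 1)
    (hh : ∀ x, 0 ≤ h x) (hne : ∃ u, IsAdmissible p h u) :
    spectralGap p (fun x => h (r * x)) ≤ spectralGap p h := by
  obtain ⟨u₀, hu₀⟩ := hne
  refine le_csInf ⟨_, u₀, hu₀, rfl⟩ ?_
  rintro _ ⟨u, hu, rfl⟩
  have hri : 0 < r⁻¹ := by positivity
  -- Changing variables gives the same factor `r⁻¹` in mass and energy, while the chain rule leaves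
  -- a factor `r^p ≤ 1` in the energy.
  have hscale : ∀ F : ℝ → ℝ, ∫ x, F (r * x) = r⁻¹ * ∫ x, F x := fun F => by
    rw [Measure.integral_comp_mul_left, abs_of_pos hri, smul_eq_mul]
  have hmass := hscale fun x => |u x| ^ p * h x
  have hmean := hscale fun x => u x * |u x| ^ (p - 2) * h x
  have henergy := hscale fun x => |deriv u x| ^ p * h x
  have hadm : IsAdmissible p (fun x => h (r * x)) fun x => u (r * x) := by
    refine ⟨?_, hu.integrable.comp_mul_left' hr0.ne', ?_, ?_⟩
    · obtain ⟨C, hC⟩ := hu.lipschitz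
      exact ⟨_, hC.comp (lipschitzWith_smul r)⟩
    · rw [hmass]
      exact mul_pos hri hu.ne_zero
    · rw [hmean, hu.mean_zero, mul_zero]
  refine (csInf_le (spectralGap_set_bddBelow p fun x => hh _) ⟨_, hadm, rfl⟩).trans ?_
  have hd : ∀ x, |deriv (fun x => u (r * x)) x| ^ p * h (r * x) =
      r ^ p * (|deriv u (r * x)| ^ p * h (r * x)) := fun x => by
    rw [deriv_comp_mul_left, smul_eq_mul, abs_mul, abs_of_pos hr0,
      Real.mul_rpow hr0.le (abs_nonneg _), mul_assoc]
  simp_rw [hd]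
  rw [integral_const_mul, henergy, hmass, mul_left_comm, mul_div_mul_left _ _ hri.ne']
  refine div_le_div_of_nonneg_right ?_ hu.ne_zero.le
  refine mul_le_of_le_one_left (integral_nonneg fun x => mul_nonneg (by positivity) (hh x)) ?_
  exact Real.rpow_le_one hr0.le hr1 (by linarith)

end MCPGap

end

noncomputable section

namespace MCPGap

/-! ### The upper bound for the spectral gap of the model density -/

open Set Filter Topology

variable {p K N D lam α : ℝ} {φ : ℝ → ℝ}

namespace IsHalfSolution

variable {c : ℝ → ℝ} {a b : ℝ}

theorem continuousOn_logDerivHalf_Ioc (hp : 1 < p)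
    (h : IsHalfSolution c (drift p) (piP p / 2) a b α φ) :
    ContinuousOn (logDerivHalf p α φ) (Ioc a b) := by
  have hpi := piP_pos hp
  have hφ : ContinuousOn φ (Ioc a b) := h.continuousOn_Icc.mono Ioc_subset_Icc_self
  have hmem : ∀ x ∈ Ioc a b, φ x ∈ Ioc 0 (piP p / 2) := fun x hx => by
    rcases eq_or_lt_of_le hx.2 with rfl | hlt
    · rw [h.right]; exact ⟨by linarith, le_rfl⟩
    · exact Ioo_subset_Ioc_self (h.mem x ⟨hx.1, hlt⟩)
  have hmaps : MapsTo φ (Ioc a b) (Icc (-(piP p / 2)) (piP p / 2)) := fun x hx =>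
    ⟨by linarith [(hmem x hx).1], (hmem x hx).2⟩
  exact (continuousOn_const.mul ((cosPBase_continuousOn hp).comp hφ hmaps)).div
    ((sinP_continuousOn hp).comp hφ hmaps) fun x hx => (MCPGap.sinP_pos hp (hmem x hx)).ne'

theorem tendsto_logDerivHalf (hp : 1 < p) (hab : a < b)
    (h : IsHalfSolution c (drift p) (piP p / 2) a b α φ) :
    Tendsto (logDerivHalf p α φ) (𝓝[<] b) (𝓝 0) := by
  have h1 := (h.continuousOn_logDerivHalf_Ioc hp) b ⟨hab, le_rfl⟩
  have h2 : logDerivHalf p α φ b = 0 := by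
    rw [logDerivHalf, h.right, cosPBase_piP_half hp, mul_zero, zero_div]
  rw [ContinuousWithinAt, h2] at h1
  exact h1.mono_left (nhdsWithin_le_of_mem (mem_of_superset (Ioo_mem_nhdsLT hab)
    Ioo_subset_Ioc_self))

/-- The eigenfunction associated with a half solution. -/
theorem exists_eigenfunction (hp : 1 < p) (hab : a < b) (hc : ContinuousOn c (Ico a b))
    (h : IsHalfSolution c (drift p) (piP p / 2) a b α φ) :
    ∃ (U : ℝ → ℝ) (L : NNReal), LipschitzWith L U ∧ U a = 0 ∧
      ∀ x ∈ Ioo a b, 0 < U x ∧ HasDerivAt U (logDerivHalf p α φ x * U x) x := by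
  have hp1 : 0 < p - 1 := by linarith
  have hpi := piP_pos hp
  have hα := h.alpha_pos
  have hφc : ContinuousOn φ (Ico a b) := h.continuousOn_Icc.mono Ico_subset_Icc_self
  have hmaps : MapsTo φ (Ico a b) (Icc (-(piP p / 2)) (piP p / 2)) := fun x hx => by
    rcases eq_or_lt_of_le hx.1 with rfl | hlt
    · rw [h.left]; constructor <;> linarith
    · exact Ioo_subset_Icc_self (h.mem_Ioo_symm hp ⟨hlt, hx.2⟩)
  -- This is `r'/r`, the amplitude equation obtained by requiring `(r sin_p φ)' = α r cos_p φ` along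
  -- the phase equation.
  set e : ℝ → ℝ := fun x => -(c x * cosPBase p (φ x) ^ p / (p - 1)) with he
  have hec : ContinuousOn e (Ico a b) :=
    ((hc.mul (((cosPBase_continuousOn hp).comp hφc hmaps).rpow_const
      fun _ _ => Or.inr (by linarith))).div_const _).neg
  have hei : ∀ y ∈ Ico a b, IntervalIntegrable e volume a y := fun y hy =>
    (hec.mono (by rw [uIcc_of_le hy.1]; exact Icc_subset_Ico_right hy.2)).intervalIntegrable
  set r : ℝ → ℝ := fun x => Real.exp (∫ t in a..x, e t) with hr
  have hr0 : ∀ x, 0 < r x := fun x => Real.exp_pos _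
  have hrd : ∀ x ∈ Ioo a b, HasDerivAt r (r x * e x) x := fun x hx => by
    have hcx : ContinuousAt e x := (hec.mono Ioo_subset_Ico_self).continuousAt
      (Ioo_mem_nhds hx.1 hx.2)
    exact (intervalIntegral.integral_hasDerivAt_right (hei x (Ioo_subset_Ico_self hx))
      ((hec.mono Ioo_subset_Ico_self).stronglyMeasurableAtFilter isOpen_Ioo x hx) hcx).exp
  set u : ℝ → ℝ := fun x => r x * sinP p (φ x) with hu
  have hu0 : ∀ x ∈ Ioo a b, 0 < u x := fun x hx => mul_pos (hr0 x) (h.sinP_pos hp hx)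
  have hud' : ∀ x ∈ Ioo a b, logDerivHalf p α φ x * u x = α * r x * cosPBase p (φ x) := by
    intro x hx
    have := h.sinP_pos hp hx
    simp only [logDerivHalf, hu]
    field_simp
  have hud : ∀ x ∈ Ioo a b, HasDerivAt u (logDerivHalf p α φ x * u x) x := by
    intro x hx
    have hm := h.mem_Ioo_symm hp hx
    have hC := cosPBase_pos hp hm
    have hφ := h.toIsFlow.hasDerivAt hx
    rw [drift_eq (Ioo_subset_Icc_self (h.mem x hx))] at hφ
    refine ((hrd x hx).mul ((sinP_hasDerivAt hp hm).comp x hφ)).congr_deriv ?_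
    have e3 : cosPBase p (φ x) ^ p = cosPBase p (φ x) ^ (p - 1) * cosPBase p (φ x) := by
      rw [← Real.rpow_add_one hC.ne']; congr 1; ring
    rw [hud' x hx]
    simp only [he, Function.comp, e3]
    field_simp
    ring
  set x₁ := (a + b) / 2 with hx₁def
  have hx₁ : x₁ ∈ Ioo a b := ⟨by linarith, by linarith⟩
  have hrc : ContinuousOn r (Icc a x₁) := by
    have h1 := intervalIntegral.continuousOn_primitive_interval' (hei x₁ (Ioo_subset_Ico_self hx₁))
      left_mem_uIcc
    rw [uIcc_of_le hx₁.1.le] at h1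
    exact h1.rexp
  obtain ⟨R, hR⟩ := isCompact_Icc.exists_bound_of_continuousOn hrc
  obtain ⟨Q, hQ⟩ := isCompact_Icc.exists_bound_of_continuousOn
    ((h.continuousOn_logDerivHalf_Ioc hp).mono
      (fun x hx => ⟨hx₁.1.trans_le hx.1, hx.2⟩ : Icc x₁ b ⊆ Ioc a b))
  have hQ0 : 0 ≤ Q := (norm_nonneg _).trans (hQ x₁ ⟨le_rfl, hx₁.2.le⟩)
  -- Close to `b` the amplitude is hard to control, since `c` may be singular. There `u' = q u` with
  -- `q` bounded by `Q`, so `u` grows at most exponentially and `u'` stays bounded.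
  have hgrow : AntitoneOn (fun x => u x * Real.exp (-(Q * x))) (Ico x₁ b) := by
    have hI : ∀ x ∈ Ico x₁ b, x ∈ Ioo a b := fun x hx => ⟨hx₁.1.trans_le hx.1, hx.2⟩
    have hd : ∀ x ∈ Ico x₁ b, HasDerivAt (fun x => u x * Real.exp (-(Q * x)))
        ((logDerivHalf p α φ x - Q) * (u x * Real.exp (-(Q * x)))) x := fun x hx => by
      have h1 : HasDerivAt (fun x => Real.exp (-(Q * x))) (Real.exp (-(Q * x)) * (-Q)) x := by
        have := (((hasDerivAt_id x).const_mul Q).neg).exp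
        simpa using this
      exact ((hud x (hI x hx)).mul h1).congr_deriv (by ring)
    refine antitoneOn_of_deriv_nonpos (convex_Ico _ _)
      (fun x hx => (hd x hx).continuousAt.continuousWithinAt)
      (fun x hx => (hd x (interior_subset hx)).differentiableAt.differentiableWithinAt)
      fun x hx => ?_
    have hx' := interior_subset hx
    rw [(hd x hx').deriv]
    refine mul_nonpos_of_nonpos_of_nonneg ?_
      (mul_nonneg (hu0 x (hI x hx')).le (Real.exp_pos _).le)
    have := (le_abs_self _).trans (hQ x ⟨hx'.1, hx'.2.le⟩)
    linarith
  set B := max (α * R) (Q * (u x₁ * Real.exp (Q * (b - x₁)))) with hB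
  have hbound : ∀ x ∈ Ioo a b, ‖logDerivHalf p α φ x * u x‖ ≤ B := by
    intro x hx
    rcases le_total x x₁ with hle | hle
    · refine le_max_of_le_left ?_
      have hm := Ioo_subset_Icc_self (h.mem_Ioo_symm hp hx)
      have h1 := (le_abs_self _).trans (hR x ⟨hx.1.le, hle⟩)
      rw [hud' x hx, Real.norm_of_nonneg
        (mul_nonneg (mul_nonneg hα.le (hr0 x).le) (cosPBase_nonneg hp hm)), mul_assoc]
      gcongr
      calc r x * cosPBase p (φ x) ≤ r x * 1 :=
            mul_le_mul_of_nonneg_left (cosPBase_le_one hp hm) (hr0 x).le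
        _ ≤ R := by rwa [mul_one]
    · refine le_max_of_le_right ?_
      have h1 := hgrow ⟨le_rfl, hx₁.2⟩ ⟨hle, hx.2⟩ hle
      beta_reduce at h1
      rw [norm_mul, Real.norm_of_nonneg (hu0 x hx).le]
      refine mul_le_mul (hQ x ⟨hle, hx.2.le⟩) ?_ (hu0 x hx).le hQ0
      have h2 : u x ≤ u x₁ * Real.exp (Q * (x - x₁)) := by
        have h3 := mul_le_mul_of_nonneg_right h1 (Real.exp_pos (Q * x)).le
        rw [mul_assoc, mul_assoc (u x₁), ← Real.exp_add, ← Real.exp_add, neg_add_cancel, Real.exp_zero,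
          mul_one] at h3
        refine h3.trans (le_of_eq ?_)
        congr 2
        ring
      refine h2.trans (mul_le_mul_of_nonneg_left (Real.exp_le_exp.2 ?_) (hu0 x₁ hx₁).le)
      have := hx.2
      gcongr
  have hLip : LipschitzOnWith B.toNNReal u (Ioo a b) := by
    refine (convex_Ioo a b).lipschitzOnWith_of_nnnorm_hasDerivWithin_le
      (fun x hx => (hud x hx).hasDerivWithinAt) fun x hx => ?_
    rw [← NNReal.coe_le_coe, coe_nnnorm]
    exact (hbound x hx).trans (Real.le_coe_toNNReal B)
  obtain ⟨U, hU, hUeq⟩ := hLip.extend_real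
  refine ⟨U, _, hU, ?_, fun x hx => ?_⟩
  · have h1 : Tendsto U (𝓝[>] a) (𝓝 (U a)) :=
      (hU.continuous.tendsto a).mono_left nhdsWithin_le_nhds
    have h2 : Tendsto u (𝓝[>] a) (𝓝 (r a * sinP p (φ a))) := by
      have hsc : ContinuousOn (fun x => sinP p (φ x)) (Ico a b) :=
        (sinP_continuousOn hp).comp hφc hmaps
      have h3 : ContinuousOn u (Icc a x₁) :=
        hrc.mul (hsc.mono (Icc_subset_Ico_right hx₁.2))
      exact (h3 a ⟨le_rfl, hx₁.1.le⟩).mono_left (nhdsWithin_le_of_mem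
        (mem_of_superset (Ioo_mem_nhdsGT hx₁.1) Ioo_subset_Icc_self))
    rw [h.left, sinP_zero hp, mul_zero] at h2
    refine tendsto_nhds_unique h1 (h2.congr' ?_)
    filter_upwards [Ioo_mem_nhdsGT hab] with x hx using hUeq hx
  · rw [← hUeq hx]
    refine ⟨hu0 x hx, (hud x hx).congr_of_eventuallyEq ?_⟩
    filter_upwards [Ioo_mem_nhds hx.1 hx.2] with y hy using (hUeq hy).symm

/-- The eigenfunction has Rayleigh quotient at most `(p - 1) α ^ p`. -/
theorem integral_energyGap_nonpos (hp : 1 < p) (hab : a < b)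
    (h : IsHalfSolution c (drift p) (piP p / 2) a b α φ) {m U : ℝ → ℝ} {L : NNReal}
    (hm : Continuous m) (hmpos : ∀ x ∈ Ioo a b, 0 < m x)
    (hmd : ∀ x ∈ Ioo a b, HasDerivAt m (c x * m x) x) (hU : LipschitzWith L U)
    (hU' : ∀ x ∈ Ioo a b, 0 < U x ∧ HasDerivAt U (logDerivHalf p α φ x * U x) x) :
    ∫ z in a..b, energyGap p ((p - 1) * α ^ p) m U z ≤ 0 := by
  have hp1 : 0 < p - 1 := by linarith
  have hint := intervalIntegrable_energyGap (lam := (p - 1) * α ^ p) hp hm hU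
  set B : ℝ → ℝ := fun x => logDerivHalf p α φ x ^ (p - 1) * m x * |U x| ^ p with hB
  -- This is the equality case of Picone's inequality. The energy on `[x, y]` is `B y - B x ≤ B y`,
  -- and `B` tends to `0` at `b` because `u'/u` does.
  have hBd : ∀ x ∈ Ioo a b, HasDerivAt B (energyGap p ((p - 1) * α ^ p) m U x) x := by
    intro x hx
    obtain ⟨hUx, hUd⟩ := hU' x hx
    have hq := h.logDerivHalf_pos hp hx
    have hd := ((h.hasDerivAt_logDerivHalf_rpow hp hx).mul (hmd x hx)).mul
      ((hasDerivAt_abs_rpow (U x) hp).comp x hUd)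
    refine hd.congr_deriv ?_
    have e1 := abs_rpow_mul_self_mul_self hp (U x)
    have e2 : logDerivHalf p α φ x ^ p =
        logDerivHalf p α φ x ^ (p - 1) * logDerivHalf p α φ x := by
      rw [← Real.rpow_add_one hq.ne']; congr 1; ring
    simp only [energyGap, Function.comp, Pi.mul_apply, hUd.deriv, abs_mul, abs_of_pos hq]
    rw [Real.mul_rpow hq.le (abs_nonneg _), e2]
    linear_combination (p * logDerivHalf p α φ x ^ (p - 1) * m x * logDerivHalf p α φ x) * e1
  have hB0 : ∀ x ∈ Ioo a b, 0 ≤ B x := fun x hx => by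
    have := h.logDerivHalf_pos hp hx
    have := hmpos x hx
    positivity
  have hxy : ∀ x ∈ Ioo a b, ∀ y ∈ Ioo a b, x ≤ y →
      ∫ z in x..y, energyGap p ((p - 1) * α ^ p) m U z ≤ B y := by
    intro x hx y hy hle
    rw [intervalIntegral.integral_eq_sub_of_hasDerivAt (f := B) (fun z hz => ?_) (hint x y)]
    · linarith [hB0 x hx]
    · rw [uIcc_of_le hle] at hz
      exact hBd z ⟨hx.1.trans_le hz.1, hz.2.trans_lt hy.2⟩
  have hay : ∀ y ∈ Ioo a b, ∫ z in a..y, energyGap p ((p - 1) * α ^ p) m U z ≤ B y := by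
    intro y hy
    have hc := (intervalIntegral.continuous_primitive hint y).neg
    have hlim : Tendsto (fun x => ∫ z in x..y, energyGap p ((p - 1) * α ^ p) m U z) (𝓝[>] a)
        (𝓝 (∫ z in a..y, energyGap p ((p - 1) * α ^ p) m U z)) := by
      have := (hc.tendsto a).mono_left (nhdsWithin_le_nhds (s := Ioi a))
      simpa only [Pi.neg_def, ← intervalIntegral.integral_symm] using this
    refine le_of_tendsto hlim ?_
    filter_upwards [Ioo_mem_nhdsGT hy.1] with x hx
    exact hxy x ⟨hx.1, hx.2.trans hy.2⟩ y hy hx.2.le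
  have hlim1 := ((intervalIntegral.continuous_primitive hint a).tendsto b).mono_left
    (nhdsWithin_le_nhds (s := Iio b))
  have hlim2 : Tendsto B (𝓝[<] b) (𝓝 0) := by
    have h1 : Tendsto (fun x => m x * |U x| ^ p) (𝓝[<] b) (𝓝 (m b * |U b| ^ p)) :=
      (hm.mul (hU.continuous.abs.rpow_const fun _ => Or.inr (by linarith))).continuousAt.mono_left
        nhdsWithin_le_nhds
    have h2 := ((h.tendsto_logDerivHalf hp hab).rpow_const (p := p - 1) (Or.inr hp1.le)).mul h1
    rw [Real.zero_rpow hp1.ne', zero_mul] at h2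
    exact h2.congr fun x => by simp only [hB]; ring
  refine le_of_tendsto_of_tendsto hlim1 hlim2 ?_
  filter_upwards [Ioo_mem_nhdsLT hab] with y hy using hay y hy

end IsHalfSolution

/-- Every parameter of the model problem is an upper bound for the spectral gap of the model
density. -/
theorem spectralGap_modelDensity_le (hp : 1 < p) (hN : 1 < N) (hD0 : 0 < D)
    (hD : 0 < K → D ≤ Real.pi / Real.sqrt (K / (N - 1)))
    (hlam : lam ∈ modelParameters p K N D) : spectralGap p (modelDensity K N D) ≤ lam := by
  obtain ⟨α, φ, rfl, hφ⟩ := exists_isHalfSolution_of_mem_modelParameters hp hN hD0 hD hlam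
  have hp1 : 0 < p - 1 := by linarith
  have hab : D / 2 < D := by linarith
  have hI : ∀ x ∈ Ioo (D / 2) D, x ∈ Ioo 0 D := fun x hx => ⟨by linarith [hx.1], hx.2⟩
  have hh := isComparable_of_mem_densities hN hD0 hD (modelDensity_mem_densities hN hD0 hD)
  obtain ⟨U, L, hU, hU0, hU'⟩ := hφ.exists_eigenfunction hp hab
    ((cotKN_continuousOn hN hD).mono fun x hx => ⟨by linarith [hx.1], hx.2⟩)
  -- On each half one of the two terms is frozen at `U (D/2) = 0`, so `W` is the extension of `U`
  -- that is odd about `D/2`.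
  set W : ℝ → ℝ := fun x => U (max x (D / 2)) - U (max (D - x) (D / 2)) with hW
  have hWL : ∃ L', LipschitzWith L' W := by
    have l1 : LipschitzWith 1 fun x : ℝ => max x (D / 2) := LipschitzWith.id.max_const _
    have l2 : LipschitzWith 1 fun x : ℝ => max (D - x) (D / 2) := by
      have := (LipschitzWith.const (α := ℝ) D).sub (LipschitzWith.id (α := ℝ))
      rw [zero_add] at this
      exact this.max_const _
    exact ⟨_, (hU.comp l1).sub (hU.comp l2)⟩
  obtain ⟨L', hWL⟩ := hWL
  have hWodd : ∀ x, W (D - x) = -W x := fun x => by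
    simp only [hW, sub_sub_cancel, neg_sub]
  have hWright : ∀ x, D / 2 ≤ x → W x = U x := fun x hx => by
    simp only [hW]
    rw [max_eq_left hx, max_eq_right (by linarith), hU0, sub_zero]
  have hWd : ∀ x ∈ Ioo (D / 2) D, 0 < W x ∧ HasDerivAt W (logDerivHalf p α φ x * W x) x := by
    intro x hx
    rw [hWright x hx.1.le]
    refine ⟨(hU' x hx).1, (hU' x hx).2.congr_of_eventuallyEq ?_⟩
    filter_upwards [Ioi_mem_nhds hx.1] with y hy using hWright y (le_of_lt hy)
  have hWderiv : ∀ x, deriv W (D - x) = deriv W x := fun x => by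
    have h1 : (fun y => W (D - y)) = fun y => -W y := funext hWodd
    have h2 : deriv (fun y => W (D - y)) x = deriv (fun y => -W y) x := by rw [h1]
    rw [deriv_comp_const_sub, deriv.fun_neg] at h2
    linarith
  have hmass0 : 0 < ∫ x, |W x| ^ p * modelDensity K N D x := by
    refine hh.integral_pos (hWL.continuous.abs.rpow_const fun _ => Or.inr (by linarith))
      (fun x => by positivity) (x₀ := 3 * D / 4) ⟨by linarith, by linarith⟩ ?_
    exact Real.rpow_pos_of_pos (abs_pos.2 (hWd _ ⟨by linarith, by linarith⟩).1.ne') _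
  have hadm : IsAdmissible p (modelDensity K N D) W := by
    refine ⟨⟨L', hWL⟩, hh.integrable_abs_rpow_mul hp hWL.continuous, hmass0, ?_⟩
    -- Reflection about `D/2` turns the `p`-mean into its negative.
    have h1 := integral_sub_left_eq_self
      (fun x => W x * |W x| ^ (p - 2) * modelDensity K N D x) volume D
    simp_rw [hWodd, modelDensity_reflect, abs_neg, neg_mul, integral_neg] at h1
    linarith
  refine (csInf_le (spectralGap_set_bddBelow p hh.nonneg) ⟨W, hadm, rfl⟩).trans ?_
  rw [div_le_iff₀ hmass0, hh.integral_eq_add hD0 (hh.integrable_abs_rpow_mul hp hWL.continuous),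
    hh.integral_eq_add hD0 (hh.integrable_abs_deriv_rpow_mul hp hWL)]
  simp_rw [hWodd, hWderiv, modelDensity_reflect, abs_neg]
  have hgap := hφ.integral_energyGap_nonpos hp hab (continuous_snPow hN)
    (fun x hx => snPow_pos hN hD (hI x hx))
    (fun x hx => snPow_hasDerivAt hN (sn_pos_of_mem_Ioo hN hD (hI x hx))) hWL hWd
  have heq : ∀ x ∈ Ioo (D / 2) D, energyGap p ((p - 1) * α ^ p) (snPow K N) W x =
      |deriv W x| ^ p * modelDensity K N D x -
        (p - 1) * α ^ p * (|W x| ^ p * modelDensity K N D x) := fun x hx => by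
    rw [energyGap, modelDensity_of_mem (Ioo_subset_Icc_self hx) hD0]
    ring
  rw [intervalIntegral.integral_of_le hab.le, integral_Ioc_eq_integral_Ioo,
    setIntegral_congr_fun measurableSet_Ioo heq, integral_sub
    (hh.integrable_abs_deriv_rpow_mul hp hWL).integrableOn
    ((hh.integrable_abs_rpow_mul hp hWL.continuous).integrableOn.const_mul _),
    integral_const_mul] at hgap
  linarith

/-! ### The model constant -/

/-- Each parameter bounds the gap of the model density from below and from above. Existence of the
minimum is therefore automatic. -/
theorem modelParameters_eq_singleton (hp : 1 < p) (hN : 1 < N) (hD0 : 0 < D)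
    (hD : 0 < K → D ≤ Real.pi / Real.sqrt (K / (N - 1))) :
    modelParameters p K N D = {spectralGap p (modelDensity K N D)} := by
  refine (modelParameters_nonempty hp hN hD0 hD).subset_singleton_iff.1 fun lam hlam => ?_
  exact le_antisymm ((isComparable_of_mem_densities hN hD0 hD
    (modelDensity_mem_densities hN hD0 hD)).le_spectralGap hp hN hD0 hD hlam)
    (spectralGap_modelDensity_le hp hN hD0 hD hlam)

theorem modelConstant_eq (hp : 1 < p) (hN : 1 < N) (hD0 : 0 < D)
    (hD : 0 < K → D ≤ Real.pi / Real.sqrt (K / (N - 1))) :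
    modelConstant p K N D = spectralGap p (modelDensity K N D) := by
  rw [modelConstant, modelParameters_eq_singleton hp hN hD0 hD, csInf_singleton]

theorem isLeast_modelConstant (hp : 1 < p) (hN : 1 < N) (hD0 : 0 < D)
    (hD : 0 < K → D ≤ Real.pi / Real.sqrt (K / (N - 1))) :
    IsLeast (modelParameters p K N D) (modelConstant p K N D) := by
  rw [modelConstant_eq hp hN hD0 hD, modelParameters_eq_singleton hp hN hD0 hD]
  exact isLeast_singleton

theorem modelConstant_le_spectralGap (hp : 1 < p) (hN : 1 < N) (hD0 : 0 < D)
    (hD : 0 < K → D ≤ Real.pi / Real.sqrt (K / (N - 1))) {h : ℝ → ℝ}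
    (hh : IsComparable K N D h) : modelConstant p K N D ≤ spectralGap p h :=
  hh.le_spectralGap hp hN hD0 hD (isLeast_modelConstant hp hN hD0 hD).1

theorem optimalConstant_set_bddBelow (p K N D : ℝ) :
    BddBelow {r | ∃ D' : ℝ, 0 < D' ∧ D' ≤ D ∧ ∃ h ∈ densities K N D', r = spectralGap p h} := by
  refine ⟨0, ?_⟩
  rintro r ⟨D', _, _, h, hh, rfl⟩
  exact spectralGap_nonneg p hh.1.nonneg

theorem optimalConstant_le_modelConstant (hp : 1 < p) (hN : 1 < N) {D' : ℝ} (hD'0 : 0 < D')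
    (hD' : 0 < K → D' ≤ Real.pi / Real.sqrt (K / (N - 1))) (hle : D' ≤ D) :
    optimalConstant p K N D ≤ modelConstant p K N D' := by
  rw [modelConstant_eq hp hN hD'0 hD']
  exact csInf_le (optimalConstant_set_bddBelow p K N D)
    ⟨D', hD'0, hle, _, modelDensity_mem_densities hN hD'0 hD', rfl⟩

/-- A density on a shorter interval is stretched to length `D`, where the lower bound applies; the
stretching has only lowered its gap. -/
theorem optimalConstant_of_nonpos (hp : 1 < p) (hN : 1 < N) (hD0 : 0 < D) (hK : K ≤ 0) :
    optimalConstant p K N D = modelConstant p K N D := by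
  have hD : ∀ D : ℝ, 0 < K → D ≤ Real.pi / Real.sqrt (K / (N - 1)) := fun _ h =>
    absurd h (not_lt.2 hK)
  refine le_antisymm (optimalConstant_le_modelConstant hp hN hD0 (hD D) le_rfl) ?_
  refine le_csInf ⟨_, D, hD0, le_rfl, _, modelDensity_mem_densities hN hD0 (hD D), rfl⟩ ?_
  rintro r ⟨D', hD'0, hD', h, hh, rfl⟩
  have hcomp := isComparable_of_mem_densities hN hD'0 (hD D') hh
  exact (modelConstant_le_spectralGap hp hN hD0 (hD D) (hcomp.comp_mul hN hK hD'0 hD')).trans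
    (spectralGap_comp_mul_le hp (div_pos hD'0 hD0) ((div_le_one hD0).2 hD') hh.1.nonneg
      (hcomp.exists_isAdmissible hp hD'0))

theorem optimalConstant_eq_sInf (hp : 1 < p) (hN : 1 < N) (hD0 : 0 < D) :
    optimalConstant p K N D = sInf (modelConstant p K N ''
      {D' : ℝ | 0 < D' ∧ (D' : EReal) ≤ min (D : EReal) (bonnetMyers K N)}) := by
  obtain ⟨E, hE0, hED, hEb, -⟩ := exists_densities_eq (K := K) hN hD0
  have hEK := le_bonnetMyers_iff.1 hEb
  refine le_antisymm ?_ ?_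
  · refine le_csInf ⟨_, mem_image_of_mem _ (show E ∈ {D' : ℝ | 0 < D' ∧ (D' : EReal) ≤ min (D : EReal) (bonnetMyers K N)} from
      ⟨hE0, le_min (EReal.coe_le_coe_iff.2 hED) hEb⟩)⟩ ?_
    rintro r ⟨D', ⟨hD'0, hD'⟩, rfl⟩
    rw [le_min_iff, EReal.coe_le_coe_iff] at hD'
    exact optimalConstant_le_modelConstant hp hN hD'0 (le_bonnetMyers_iff.1 hD'.2) hD'.1
  · refine le_csInf ⟨_, E, hE0, hED, _, modelDensity_mem_densities hN hE0 hEK, rfl⟩ ?_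
    rintro r ⟨D', hD'0, hD', h, hh, rfl⟩
    -- For `D' > D_{K,N}` the class is that of `D_{K,N}`, so such lengths add nothing.
    obtain ⟨F, hF0, hFD, hFb, hF⟩ := exists_densities_eq (K := K) hN hD'0
    have hFK := le_bonnetMyers_iff.1 hFb
    rw [hF] at hh
    refine (csInf_le ⟨0, ?_⟩ (mem_image_of_mem _
      (show F ∈ {D' : ℝ | 0 < D' ∧ (D' : EReal) ≤ min (D : EReal) (bonnetMyers K N)} from
        ⟨hF0, le_min (EReal.coe_le_coe_iff.2 (hFD.trans hD')) hFb⟩))).trans (modelConstant_le_spectralGap hp hN hF0 hFK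
        (isComparable_of_mem_densities hN hF0 hFK hh))
    rintro r ⟨D', ⟨hD'0, hD'⟩, rfl⟩
    exact Real.sInf_nonneg fun x hx => hx.1

end MCPGap

end

theorem corollary3p10 (p K N D : ℝ) (hp : 1 < p) (hN : 1 < N) (hD : 0 < D) :
    (∀ D' : ℝ, 0 < D' → (D' : EReal) ≤ min (D : EReal) (MCPGap.bonnetMyers K N) →
      IsLeast (MCPGap.modelParameters p K N D') (MCPGap.modelConstant p K N D')) ∧
    (K ≤ 0 → MCPGap.optimalConstant p K N D = MCPGap.modelConstant p K N D) ∧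
    (0 < K → MCPGap.optimalConstant p K N D =
      sInf (MCPGap.modelConstant p K N ''
        {D' : ℝ | 0 < D' ∧ (D' : EReal) ≤ min (D : EReal) (MCPGap.bonnetMyers K N)})) :=
  ⟨fun _ hD'0 hD' => MCPGap.isLeast_modelConstant hp hN hD'0
      (MCPGap.le_bonnetMyers_iff.1 (hD'.trans (min_le_right _ _))),
    fun hK => MCPGap.optimalConstant_of_nonpos hp hN hD hK,
    fun _ => MCPGap.optimalConstant_eq_sInf hp hN hD⟩
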